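/- Let $K$ be a field of characteristic $0$. For a $K$-vector space $V$ let $J(V)$ be the free (non-unital) Jordan algebra on $V$ and let $T(V)=\bigoplus_{n\ge 1}V^{\otimes n}$ be the free non-unital associative algebra on $V$. Let $\sigma$ be the anti-automorphism of $T(V)$ that is the identity on $V$. Put $CJ(V)=T(V)^{\sigma}$ and let $SJ(V)$ be the Jordan subalgebra of $T(V)$ generated by $V$, for the product $x\circ y=\frac12(xy+yx)$. For a Jordan algebra $A$ let $\partial_{x,y}z=x(zy)-(xz)y$, let $\mathrm{Inner}\,A$ be the span of all $\partial_{x,y}$ with $x,y\in A$, and let $\mathcal{B}A=\Lambda^2A/\mathrm{span}\{a\wedge a^2 : a\in A\}$; write $\{a,b\}$ for the class of $a\wedge b$ in $\mathcal{B}A$. Let $[T,T](V)=[T(V),T(V)]$ be the span of all commutators. In $CJ(V)$ one has $4\,\partial_{x,y}z=[[x,y],z]$, and a sum of commutators $c$ is identified with the derivation $z\mapsto[c,z]$. All of these are functors of $V$. Consider the natural transformations $$\Theta_J: J(V)\otimes V\to\mathcal{B}J(V),\ a\otimes v\mapsto\{a,v\};\qquad \Theta_{SJ}: SJ(V)\otimes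 V\to\mathrm{Inner}\,SJ(V),\ a\otimes v\mapsto\partial_{a,v};$$ $$\Theta_{CJ}: CJ(V)\otimes V\to\mathrm{Inner}\,CJ(V),\ u\otimes v\mapsto[u,v]\ (=4\,\partial_{u,v});\qquad \Theta_T: T(V)\otimes V\to[T,T](V),\ u\otimes v\mapsto[u,v].$$ For a functor $F$ from vector spaces to vector spaces, its suspension $\Sigma F$ is the functor for which $\Sigma F(V)$ is the space of all elements of $F(Kx_0\oplus V)$ of weight one in $x_0$, that is, on which the endomorphism $x_0\mapsto zx_0$, $v\mapsto v$ $(v\in V)$ acts as multiplication by $z$, for all $z\in K^*$. A natural transformation $\Theta:F(V)\otimes V\to G(V)$ restricts to a map $\Sigma F(V)\otimes V\to\Sigma G(V)$. The triple $(F,G,\Theta)$ is called cyclic if $\Sigma F(K^D)\otimes K^D\to\Sigma G(K^D)$ is an isomorphism for all integers $D\ge 0$. **Theorem.** 1. The triples $(J,\mathcal{B}J,\Theta_J)$, $(SJ,\mathrm{Inner}\,SJ,\Theta_{SJ})$, $(CJ,\mathrm{Inner}\,CJ,\Theta_{CJ})$ and $(T,[T,T],\Theta_T)$ are cyclic. 2.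 There are isomorphisms of functors $J\cong\Sigma\,\mathrm{Ker}\,\Theta_J$, $SJ\cong\Sigma\,\mathrm{Ker}\,\Theta_{SJ}$, $CJ\cong\Sigma\,\mathrm{Ker}\,\Theta_{CJ}$ and $T\cong\Sigma\,\mathrm{Ker}\,\Theta_T$. 3. For $F\in\{J,SJ,CJ,T\}$ let $\mathcal{F}(n)\subset F(K^n)$ be the space of multilinear elements (those of weight $(1,\dots,1)$ under the diagonal matrices), with $\mathfrak{S}_n$ acting by permutation of the basis vectors. The spaces $\mathcal{F}(n)$ are finite dimensional, and $\mathcal{F}$ is cyclic as an $\mathfrak{S}$-module: there are finite dimensional representations $\mathcal{E}(n)$ of $\mathfrak{S}_n$ such that $\mathcal{F}(n)\cong\mathcal{E}(n+1)|_{\mathfrak{S}_n}$ for all $n\ge0$, where $\mathfrak{S}_n\subset\mathfrak{S}_{n+1}$ is the stabilizer of one point. 4. The operads $\mathcal{J}$, $\mathcal{SJ}$, $\mathcal{CJ}$ and $\mathcal{T}$ formed by these spaces, whose composition $p\circ_iq$ is the substitution of $q$ for the $i$-th variable of $p$, are cyclic operads. That is, for each of them, denoted $\mathcal{F}$, the actions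 of $\mathfrak{S}_n$ on $\mathcal{F}(n)$ extend to actions of $\mathfrak{S}_{n+1}$, the group of permutations of $\{0,1,\dots,n\}$, in which $\mathfrak{S}_n$ is the stabilizer of $0$, such that the cycles $c:0\mapsto1\mapsto\cdots\mapsto n\mapsto0$ fix the unit of $\mathcal{F}(1)$ and satisfy, for all $p\in\mathcal{F}(m)$ and $q\in\mathcal{F}(n)$, $c(p\circ_iq)=(cp)\circ_{i+1}q$ for $1\le i<m$, and $c(p\circ_mq)=(cq)\circ_1(cp)$ for $m,n\ge1$. -/

import Mathlib

open CategoryTheory TensorProduct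

universe u

noncomputable section

namespace JordanCyclic

/-! ## Free Jordan algebras -/

section FreeJordanAlgebra

variable (K : Type u) [Field K] (V : Type u) [AddCommGroup V] [Module K V]

/-- The relations of the free Jordan algebra on the vector space `V`, imposed on the free
non-unital non-associative algebra on the set `V`: the generators depend linearly on `V`, the
product is commutative and satisfies the Jordan identity `x²(yx) = (x²y)x`; the last four
constructors close the relation under the algebra operations. -/
inductive FreeJordan.Rel : FreeNonUnitalNonAssocAlgebra K V → FreeNonUnitalNonAssocAlgebra K V → Prop
  | of_add (v w : V) : FreeJordan.Rel (FreeNonUnitalNonAssocAlgebra.of K (v + w))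
      (FreeNonUnitalNonAssocAlgebra.of K v + FreeNonUnitalNonAssocAlgebra.of K w)
  | of_smul (t : K) (v : V) : FreeJordan.Rel (FreeNonUnitalNonAssocAlgebra.of K (t • v))
      (t • FreeNonUnitalNonAssocAlgebra.of K v)
  | comm (a b : FreeNonUnitalNonAssocAlgebra K V) : FreeJordan.Rel (a * b) (b * a)
  | jordan (x y : FreeNonUnitalNonAssocAlgebra K V) :
      FreeJordan.Rel ((x * x) * (y * x)) (((x * x) * y) * x)
  | smul (t : K) {a b : FreeNonUnitalNonAssocAlgebra K V} :
      FreeJordan.Rel a b → FreeJordan.Rel (t • a) (t • b)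
  | add_right {a b : FreeNonUnitalNonAssocAlgebra K V} (c : FreeNonUnitalNonAssocAlgebra K V) :
      FreeJordan.Rel a b → FreeJordan.Rel (a + c) (b + c)
  | mul_left (a : FreeNonUnitalNonAssocAlgebra K V) {b c : FreeNonUnitalNonAssocAlgebra K V} :
      FreeJordan.Rel b c → FreeJordan.Rel (a * b) (a * c)
  | mul_right {a b : FreeNonUnitalNonAssocAlgebra K V} (c : FreeNonUnitalNonAssocAlgebra K V) :
      FreeJordan.Rel a b → FreeJordan.Rel (a * c) (b * c)

/-- The free (non-unital) Jordan algebra `J(V)` on the vector space `V`. -/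
def FreeJordan : Type u := Quot (FreeJordan.Rel K V)

namespace FreeJordan

variable {K V}

theorem Rel.addLeft (a : FreeNonUnitalNonAssocAlgebra K V) {b c : FreeNonUnitalNonAssocAlgebra K V}
    (h : Rel K V b c) : Rel K V (a + b) (a + c) := by
  rw [add_comm _ b, add_comm _ c]; exact h.add_right _

theorem Rel.neg {a b : FreeNonUnitalNonAssocAlgebra K V} (h : Rel K V a b) :
    Rel K V (-a) (-b) := by
  simpa only [neg_one_smul] using h.smul (-1)

theorem Rel.subLeft (a : FreeNonUnitalNonAssocAlgebra K V) {b c : FreeNonUnitalNonAssocAlgebra K V}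
    (h : Rel K V b c) : Rel K V (a - b) (a - c) := by
  simpa only [sub_eq_add_neg] using h.neg.addLeft a

theorem Rel.subRight {a b : FreeNonUnitalNonAssocAlgebra K V} (c : FreeNonUnitalNonAssocAlgebra K V)
    (h : Rel K V a b) : Rel K V (a - c) (b - c) := by
  simpa only [sub_eq_add_neg] using h.add_right (-c)

theorem Rel.smulOfTower {S : Type*} [Monoid S] [DistribMulAction S K] [IsScalarTower S K K] (t : S)
    (a b : FreeNonUnitalNonAssocAlgebra K V) (h : Rel K V a b) : Rel K V (t • a) (t • b) := by
  rw [← smul_one_smul K t a, ← smul_one_smul K t b]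
  exact h.smul _

variable (K V)

instance {S : Type*} [Monoid S] [DistribMulAction S K] [IsScalarTower S K K] :
    SMul S (FreeJordan K V) where smul t := Quot.map (t • ·) (Rel.smulOfTower t)

instance : Zero (FreeJordan K V) where zero := Quot.mk _ 0

instance : Add (FreeJordan K V) where
  add := Quot.map₂ (· + ·) (fun _ _ _ => Rel.addLeft _) fun _ _ _ => Rel.add_right _

instance : Neg (FreeJordan K V) where neg := Quot.map Neg.neg fun _ _ => Rel.neg

instance : Sub (FreeJordan K V) where
  sub := Quot.map₂ Sub.sub (fun _ _ _ => Rel.subLeft _) fun _ _ _ => Rel.subRight _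

instance : Mul (FreeJordan K V) where
  mul := Quot.map₂ (· * ·) (fun _ _ _ => Rel.mul_left _) fun _ _ _ => Rel.mul_right _

instance : AddGroup (FreeJordan K V) :=
  Function.Surjective.addGroup (Quot.mk _) Quot.mk_surjective rfl (fun _ _ => rfl)
    (fun _ => rfl) (fun _ _ => rfl) (fun _ _ => rfl) fun _ _ => rfl

instance : AddCommSemigroup (FreeJordan K V) :=
  Function.Surjective.addCommSemigroup (Quot.mk _) Quot.mk_surjective fun _ _ => rfl

instance : AddCommGroup (FreeJordan K V) :=
  { (inferInstance : AddGroup (FreeJordan K V)),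
    (inferInstance : AddCommSemigroup (FreeJordan K V)) with }

instance : Module K (FreeJordan K V) :=
  Function.Surjective.module K ⟨⟨Quot.mk (Rel K V), rfl⟩, fun _ _ => rfl⟩
    Quot.mk_surjective (fun _ _ => rfl)

instance : NonUnitalNonAssocCommRing (FreeJordan K V) :=
  { (inferInstance : AddCommGroup (FreeJordan K V)),
    (inferInstance : Mul (FreeJordan K V)) with
    left_distrib := by rintro ⟨a⟩ ⟨b⟩ ⟨c⟩; exact congrArg (Quot.mk _) (mul_add a b c)
    right_distrib := by rintro ⟨a⟩ ⟨b⟩ ⟨c⟩; exact congrArg (Quot.mk _) (add_mul a b c)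
    zero_mul := by rintro ⟨a⟩; exact congrArg (Quot.mk _) (zero_mul a)
    mul_zero := by rintro ⟨a⟩; exact congrArg (Quot.mk _) (mul_zero a)
    mul_comm := by rintro ⟨a⟩ ⟨b⟩; exact Quot.sound (Rel.comm a b) }

instance : IsScalarTower K (FreeJordan K V) (FreeJordan K V) where
  smul_assoc := by rintro t ⟨a⟩ ⟨b⟩; exact congrArg (Quot.mk _) (smul_mul_assoc t a b)

instance : SMulCommClass K (FreeJordan K V) (FreeJordan K V) where
  smul_comm := by rintro t ⟨a⟩ ⟨b⟩; exact congrArg (Quot.mk _) (mul_smul_comm t a b).symm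

instance : IsCommJordan (FreeJordan K V) where
  lmul_comm_rmul_rmul := by
    intro a b
    have h : (a * a) * (b * a) = ((a * a) * b) * a := by
      rcases a with ⟨a⟩; rcases b with ⟨b⟩
      exact Quot.sound (Rel.jordan a b)
    rw [mul_comm (a * b), mul_comm a b, h, mul_comm _ a, mul_comm (a * a) b]

/-- The inclusion of the generating space. -/
def ι : V →ₗ[K] FreeJordan K V where
  toFun v := Quot.mk _ (FreeNonUnitalNonAssocAlgebra.of K v)
  map_add' v w := Quot.sound (Rel.of_add v w)
  map_smul' t v := Quot.sound (Rel.of_smul t v)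

variable {K V}
/-- The quotient map from the free non-associative algebra. -/
def mk : FreeNonUnitalNonAssocAlgebra K V →ₙₐ[K] FreeJordan K V where
  toFun := Quot.mk (Rel K V)
  map_smul' _ _ := rfl
  map_zero' := rfl
  map_add' _ _ := rfl
  map_mul' _ _ := rfl

theorem hom_ext {A : Type u} [NonUnitalNonAssocCommRing A] [Module K A]
    [IsScalarTower K A A] [SMulCommClass K A A] {f g : FreeJordan K V →ₙₐ[K] A}
    (h : ∀ v, f (ι K V v) = g (ι K V v)) : f = g := by
  have h' : f.comp mk = g.comp mk := FreeNonUnitalNonAssocAlgebra.hom_ext K h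
  ext ⟨a⟩
  exact DFunLike.congr_fun h' a

variable {A : Type u} [NonUnitalNonAssocCommRing A] [IsCommJordan A] [Module K A]
  [IsScalarTower K A A] [SMulCommClass K A A]

theorem lift_spec (f : V →ₗ[K] A) (a b : FreeNonUnitalNonAssocAlgebra K V) (h : Rel K V a b) :
    FreeNonUnitalNonAssocAlgebra.lift K f a = FreeNonUnitalNonAssocAlgebra.lift K f b := by
  induction h with
  | of_add v w => simp
  | of_smul t v => simp
  | comm a b => simp [mul_comm]
  | jordan x y =>
    simp only [map_mul]
    generalize FreeNonUnitalNonAssocAlgebra.lift K f x = x'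
    generalize FreeNonUnitalNonAssocAlgebra.lift K f y = y'
    have h := IsCommJordan.lmul_comm_rmul_rmul x' y'
    rw [mul_comm (x' * x'), mul_comm y' x', h, mul_comm y', mul_comm]
  | smul t _ h => simp only [map_smul, h]
  | add_right c _ h => simp only [map_add, h]
  | mul_left c _ h => simp only [map_mul, h]
  | mul_right c _ h => simp only [map_mul, h]

/-- The universal property of `J(V)`: a linear map from `V` to a Jordan algebra extends to an
algebra morphism. -/
def lift (f : V →ₗ[K] A) : FreeJordan K V →ₙₐ[K] A where
  toFun c := Quot.liftOn c (FreeNonUnitalNonAssocAlgebra.lift K f) (lift_spec f)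
  map_smul' := by rintro t ⟨a⟩; exact map_smul (FreeNonUnitalNonAssocAlgebra.lift K f) t a
  map_zero' := map_zero (FreeNonUnitalNonAssocAlgebra.lift K f)
  map_add' := by rintro ⟨a⟩ ⟨b⟩; exact map_add (FreeNonUnitalNonAssocAlgebra.lift K f) a b
  map_mul' := by rintro ⟨a⟩ ⟨b⟩; exact map_mul (FreeNonUnitalNonAssocAlgebra.lift K f) a b

@[simp] theorem lift_ι (f : V →ₗ[K] A) (v : V) : lift f (ι K V v) = f v :=
  FreeNonUnitalNonAssocAlgebra.lift_of_apply K f v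

end FreeJordan

end FreeJordanAlgebra

/-! ## Functors, suspension and cyclic triples -/

section Functors

variable {K : Type u} [Field K]

/-- A construction of free algebras on vector spaces, as a monad in Kleisli form: `obj V` is the
free algebra on `V`, `ι V` is the inclusion of the generators, and `bind f` is the morphism of
free algebras that extends the linear map `f`, i.e. substitution of `f v` for each generator `v`. -/
structure FreeAlg (K : Type u) [Field K] where
  obj : ModuleCat.{u} K → ModuleCat.{u} K
  ι : ∀ V : ModuleCat.{u} K, V →ₗ[K] obj V
  bind : ∀ {V W : ModuleCat.{u} K}, (V →ₗ[K] obj W) → (obj V →ₗ[K] obj W)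
  bind_ι : ∀ {V W : ModuleCat.{u} K} (f : V →ₗ[K] obj W), bind f ∘ₗ ι V = f
  bind_unit : ∀ V : ModuleCat.{u} K, bind (ι V) = LinearMap.id
  bind_bind : ∀ {U V W : ModuleCat.{u} K} (f : U →ₗ[K] obj V) (g : V →ₗ[K] obj W),
    bind g ∘ₗ bind f = bind (bind g ∘ₗ f)

/-- The functor `V ↦ (free algebra on V)`. -/
def FreeAlg.functor (M : FreeAlg K) : ModuleCat.{u} K ⥤ ModuleCat.{u} K where
  obj := M.obj
  map {_ W} f := ModuleCat.ofHom (M.bind (M.ι W ∘ₗ f.hom))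
  map_id V := by
    ext1
    simp only [ModuleCat.hom_ofHom, ModuleCat.hom_id, LinearMap.comp_id]
    exact M.bind_unit V
  map_comp f g := by
    ext1
    simp only [ModuleCat.hom_ofHom, ModuleCat.hom_comp]
    rw [M.bind_bind]
    congr 1
    rw [← LinearMap.comp_assoc f.hom (M.ι _), M.bind_ι, LinearMap.comp_assoc]

/-- The functor `F ⊗ Id`, i.e. `V ↦ F(V) ⊗ V`. -/
def tensorId (F : ModuleCat.{u} K ⥤ ModuleCat.{u} K) : ModuleCat.{u} K ⥤ ModuleCat.{u} K where
  obj V := ModuleCat.of K (F.obj V ⊗[K] V)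
  map f := ModuleCat.ofHom (TensorProduct.map (F.map f).hom f.hom)
  map_id V := by
    ext1
    simp
  map_comp f g := by
    ext1
    simp [TensorProduct.map_comp]

/-- The space `K x₀ ⊕ V`, where `x₀ = (1, 0)`. -/
abbrev addPoint (V : ModuleCat.{u} K) : ModuleCat.{u} K := ModuleCat.of K (K × V)

/-- The endomorphism `h(z)` of `K x₀ ⊕ V`, which multiplies `x₀` by `z` and fixes `V`. -/
def scalePoint (V : ModuleCat.{u} K) (z : K) : addPoint V ⟶ addPoint V :=
  ModuleCat.ofHom ((z • LinearMap.id).prodMap LinearMap.id)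

/-- The map `K x₀ ⊕ V → K x₀ ⊕ W` induced by `f : V → W`. -/
def addPointMap {V W : ModuleCat.{u} K} (f : V ⟶ W) : addPoint V ⟶ addPoint W :=
  ModuleCat.ofHom (LinearMap.id.prodMap f.hom)

/-- The subspace `ΣF(V)` of `F(K x₀ ⊕ V)`: all elements of weight one with respect to `x₀`. -/
def weightOne (F : ModuleCat.{u} K ⥤ ModuleCat.{u} K) (V : ModuleCat.{u} K) :
    Submodule K (F.obj (addPoint V)) where
  carrier := {v | ∀ z : K, z ≠ 0 → (F.map (scalePoint V z)).hom v = z • v}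
  add_mem' ha hb z hz := by rw [map_add, ha z hz, hb z hz, smul_add]
  zero_mem' z _ := by rw [map_zero, smul_zero]
  smul_mem' c a ha z hz := by rw [map_smul, ha z hz, smul_comm]

theorem scalePoint_comp_addPointMap {V W : ModuleCat.{u} K} (f : V ⟶ W) (z : K) :
    addPointMap f ≫ scalePoint W z = scalePoint V z ≫ addPointMap f := by
  ext x <;> simp [addPointMap, scalePoint]

theorem map_mem_weightOne (F : ModuleCat.{u} K ⥤ ModuleCat.{u} K) {V W : ModuleCat.{u} K}
    (f : V ⟶ W) {v : F.obj (addPoint V)} (hv : v ∈ weightOne F V) :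
    (F.map (addPointMap f)).hom v ∈ weightOne F W := by
  intro z hz
  rw [← LinearMap.comp_apply, ← ModuleCat.hom_comp, ← F.map_comp, scalePoint_comp_addPointMap,
    F.map_comp, ModuleCat.hom_comp, LinearMap.comp_apply, hv z hz, map_smul]

/-- The suspension `ΣF` of the functor `F`. -/
def suspension (F : ModuleCat.{u} K ⥤ ModuleCat.{u} K) : ModuleCat.{u} K ⥤ ModuleCat.{u} K where
  obj V := ModuleCat.of K (weightOne F V)
  map {V W} f := ModuleCat.ofHom
    ((F.map (addPointMap f)).hom.restrict (p := weightOne F V) (q := weightOne F W)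
      fun _ hv => map_mem_weightOne F f hv)
  map_id V := by
    ext1
    refine LinearMap.ext fun v => Subtype.ext ?_
    have h : addPointMap (𝟙 V) = 𝟙 (addPoint V) := by
      ext x <;> simp [addPointMap]
    simp [h]
  map_comp {U V W} f g := by
    ext1
    refine LinearMap.ext fun v => Subtype.ext ?_
    have h : addPointMap (f ≫ g) = addPointMap f ≫ addPointMap g := by
      ext x <;> simp [addPointMap]
    simp [h]

variable {F G : ModuleCat.{u} K ⥤ ModuleCat.{u} K}

/-- The linear map `F(V) ⊗ V → G(V)` given by a natural transformation `Θ : F ⊗ Id → G`. -/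
def thetaAt (Θ : tensorId F ⟶ G) (V : ModuleCat.{u} K) : (F.obj V ⊗[K] V) →ₗ[K] G.obj V :=
  (Θ.app V).hom

theorem thetaAt_naturality (Θ : tensorId F ⟶ G) {V W : ModuleCat.{u} K} (f : V ⟶ W)
    (t : F.obj V ⊗[K] V) :
    (G.map f).hom (thetaAt Θ V t) = thetaAt Θ W (TensorProduct.map (F.map f).hom f.hom t) :=
  (LinearMap.congr_fun (congrArg ModuleCat.Hom.hom (Θ.naturality f)) t).symm

theorem thetaAt_mem_weightOne (Θ : tensorId F ⟶ G) (V : ModuleCat.{u} K)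
    (t : weightOne F V ⊗[K] V) :
    thetaAt Θ (addPoint V)
      (TensorProduct.map (weightOne F V).subtype (LinearMap.inr K K V) t) ∈ weightOne G V := by
  intro z hz
  rw [thetaAt_naturality, ← map_smul]
  refine congrArg _ ?_
  induction t with
  | zero => simp
  | add a b ha hb => rw [map_add, map_add, ha, hb, smul_add]
  | tmul a v =>
    have ha : (F.map (scalePoint V z)).hom (a : F.obj (addPoint V)) = z • (a : F.obj (addPoint V)) :=
      a.2 z hz
    have hv : (scalePoint V z).hom (LinearMap.inr K K V v) = LinearMap.inr K K V v := by
      simp [scalePoint]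
    rw [TensorProduct.map_tmul, TensorProduct.map_tmul, Submodule.subtype_apply, ha, hv,
      TensorProduct.smul_tmul']

/-- The map `ΣF(V) ⊗ V → ΣG(V)` induced by a natural transformation `Θ : F ⊗ Id → G`, namely
the restriction of `Θ` at `K x₀ ⊕ V` to the subspace `ΣF(V) ⊗ V` of
`F(K x₀ ⊕ V) ⊗ (K x₀ ⊕ V)`. -/
def suspensionMap (Θ : tensorId F ⟶ G) (V : ModuleCat.{u} K) :
    (weightOne F V ⊗[K] V) →ₗ[K] weightOne G V :=
  LinearMap.codRestrict (weightOne G V)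
    (thetaAt Θ (addPoint V) ∘ₗ
      TensorProduct.map (weightOne F V).subtype (LinearMap.inr K K V))
    (thetaAt_mem_weightOne Θ V)

/-- The triple `(F, G, Θ)` is cyclic: `ΣF(K^D) ⊗ K^D → ΣG(K^D)` is an isomorphism for all `D`. -/
def IsCyclicTriple (Θ : tensorId F ⟶ G) : Prop :=
  ∀ D : ℕ, Function.Bijective (suspensionMap Θ (ModuleCat.of K (Fin D → K)))

end Functors

/-! ## The functors `J` and `𝓑J` -/

section JordanFunctors

variable (K : Type u) [Field K]

/-- The free Jordan algebras `J(V)`. -/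
def freeJordan : FreeAlg K where
  obj V := ModuleCat.of K (FreeJordan K V)
  ι V := FreeJordan.ι K V
  bind {V W} f := (FreeJordan.lift (V := V) (A := FreeJordan K W) f : FreeJordan K V →ₗ[K] FreeJordan K W)
  bind_ι f := LinearMap.ext fun v => FreeJordan.lift_ι (A := FreeJordan K _) f v
  bind_unit V := by
    have h : FreeJordan.lift (FreeJordan.ι K V) = NonUnitalAlgHom.id K (FreeJordan K V) :=
      FreeJordan.hom_ext fun v => by simp
    exact LinearMap.ext fun a => DFunLike.congr_fun h a
  bind_bind {U V W} f g := by
    have h : (FreeJordan.lift (A := FreeJordan K W) g).comp (FreeJordan.lift (A := FreeJordan K V) f)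
        = FreeJordan.lift (A := FreeJordan K W)
          ((FreeJordan.lift (A := FreeJordan K W) g : FreeJordan K V →ₗ[K] FreeJordan K W) ∘ₗ f) :=
      FreeJordan.hom_ext fun v => by simp
    exact LinearMap.ext fun a => DFunLike.congr_fun h a

/-- The subspace `R(A)` of `Λ²A` spanned by all `a ∧ a²`, for a (Jordan) algebra `A`. -/
def relB (A : Type u) [NonUnitalNonAssocCommRing A] [Module K A] : Submodule K (⋀[K]^2 A) :=
  Submodule.span K (Set.range fun a : A => exteriorPower.ιMulti K 2 ![a, a * a])

/-- The space `𝓑A = Λ²A / R(A)`. -/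
abbrev BSpace (A : Type u) [NonUnitalNonAssocCommRing A] [Module K A] : Type u :=
  (⋀[K]^2 A) ⧸ relB K A

variable {K}

theorem update_pair {A : Type u} (a b c : A) : Function.update ![a, b] 1 c = ![a, c] := by
  ext i
  fin_cases i <;> rfl

/-- The bilinear map `(a, b) ↦ {a, b}`, the class of `a ∧ b` in `𝓑A`. -/
def bracketB (A : Type u) [NonUnitalNonAssocCommRing A] [Module K A] : A →ₗ[K] A →ₗ[K] BSpace K A :=
  LinearMap.mk₂ K (fun a b => (relB K A).mkQ (exteriorPower.ιMulti K 2 ![a, b]))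
    (fun a a' b => by
      rw [← map_add]
      exact congrArg _ ((exteriorPower.ιMulti K 2).map_vecCons_add ![b] a a'))
    (fun c a b => by
      rw [← map_smul]
      exact congrArg _ ((exteriorPower.ιMulti K 2).map_vecCons_smul ![b] c a))
    (fun a b b' => by
      rw [← map_add]
      have h := (exteriorPower.ιMulti K 2 (M := A)).map_update_add ![a, 0] 1 b b'
      simp only [update_pair] at h
      exact congrArg (relB K A).mkQ h)
    (fun c a b => by
      rw [← map_smul]
      have h := (exteriorPower.ιMulti K 2 (M := A)).map_update_smul ![a, 0] 1 c b
      simp only [update_pair] at h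
      exact congrArg (relB K A).mkQ h)

section

variable {A B : Type u} [NonUnitalNonAssocCommRing A] [Module K A]
  [NonUnitalNonAssocCommRing B] [Module K B]

theorem relB_le_comap (φ : A →ₙₐ[K] B) :
    relB K A ≤ (relB K B).comap (exteriorPower.map 2 (φ : A →ₗ[K] B)) := by
  refine Submodule.span_le.2 ?_
  rintro _ ⟨a, rfl⟩
  refine Submodule.subset_span ⟨φ a, ?_⟩
  simp only [exteriorPower.map_apply_ιMulti]
  congr 1
  ext i
  fin_cases i <;> simp

/-- The map `𝓑A → 𝓑B`, `{a, a'} ↦ {φ a, φ a'}` induced by an algebra morphism `φ`. -/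
def mapB (φ : A →ₙₐ[K] B) : BSpace K A →ₗ[K] BSpace K B :=
  (relB K A).mapQ (relB K B) (exteriorPower.map 2 (φ : A →ₗ[K] B)) (relB_le_comap φ)

theorem mapB_bracketB (φ : A →ₙₐ[K] B) (a b : A) :
    mapB φ (bracketB A a b) = bracketB B (φ a) (φ b) := by
  simp only [mapB, bracketB, LinearMap.mk₂_apply, Submodule.mkQ_apply, Submodule.mapQ_apply,
    exteriorPower.map_apply_ιMulti]
  congr 2
  ext i
  fin_cases i <;> simp

theorem BSpace_hom_ext {N : Type u} [AddCommGroup N] [Module K N] {f g : BSpace K A →ₗ[K] N}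
    (h : ∀ a b, f (bracketB A a b) = g (bracketB A a b)) : f = g := by
  refine Submodule.linearMap_qext _ (exteriorPower.linearMap_ext ?_)
  ext v
  have hv : v = ![v 0, v 1] := by ext i; fin_cases i <;> rfl
  rw [hv]
  exact h _ _

end

variable (K)

/-- The functor `𝓑J : V ↦ 𝓑(J(V))`. -/
def functorBJ : ModuleCat.{u} K ⥤ ModuleCat.{u} K where
  obj V := ModuleCat.of K (BSpace K (FreeJordan K V))
  map {V W} f := ModuleCat.ofHom (mapB (FreeJordan.lift (FreeJordan.ι K W ∘ₗ f.hom)))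
  map_id V := by
    ext1
    refine BSpace_hom_ext fun a b => ?_
    have h : FreeJordan.lift (FreeJordan.ι K V) =
      NonUnitalAlgHom.id K (FreeJordan K V) := FreeJordan.hom_ext fun v => by simp
    simp [mapB_bracketB, h]
  map_comp {U V W} f g := by
    ext1
    refine BSpace_hom_ext fun a b => ?_
    have h : FreeJordan.lift (FreeJordan.ι K W ∘ₗ g.hom ∘ₗ f.hom) =
      (FreeJordan.lift (FreeJordan.ι K W ∘ₗ g.hom)).comp
        (FreeJordan.lift (FreeJordan.ι K V ∘ₗ f.hom)) := FreeJordan.hom_ext fun v => by simp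
    simp [mapB_bracketB, h]

/-- The natural transformation `Θ_J : J(V) ⊗ V → 𝓑J(V)`, `a ⊗ v ↦ {a, v}`. -/
def thetaJ : tensorId (freeJordan K).functor ⟶ functorBJ K where
  app V := ModuleCat.ofHom
    (TensorProduct.lift ((bracketB (FreeJordan K V)).compl₂ (FreeJordan.ι K V)))
  naturality {V W} f := by
    ext1
    refine TensorProduct.ext' fun a v => ?_
    have h := mapB_bracketB (FreeJordan.lift (FreeJordan.ι K W ∘ₗ f.hom)) a (FreeJordan.ι K V v)
    rw [FreeJordan.lift_ι] at h
    exact h.symm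

end JordanFunctors

/-! ## The functors `T`, `SJ`, `CJ`, `[T,T]` and the inner derivations -/

section TensorFunctors

/-- A family of subspaces `S(V)` of the tensor algebras of `V` such that `S(V)` contains `V` and
every substitution of elements of `S(W)` for the elements of `V` maps `S(V)` to `S(W)`. -/
structure TensorSub (K : Type u) [Field K] where
  carrier : ∀ (V : Type u) [AddCommGroup V] [Module K V], Submodule K (TensorAlgebra K V)
  ι_mem : ∀ (V : Type u) [AddCommGroup V] [Module K V] (v : V),
    TensorAlgebra.ι K v ∈ carrier V
  lift_mem : ∀ (V W : Type u) [AddCommGroup V] [Module K V] [AddCommGroup W] [Module K W]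
    (f : V →ₗ[K] TensorAlgebra K W), (∀ v, f v ∈ carrier W) →
    ∀ a ∈ carrier V, TensorAlgebra.lift K f a ∈ carrier W

variable {K : Type u} [Field K]

/-- The space `S(V)` as a type. -/
abbrev TensorSub.space (S : TensorSub K) (V : Type u) [AddCommGroup V] [Module K V] : Type u :=
  S.carrier V

/-- Extension of a linear map `V → S(W)` to `S(V) → S(W)` by substitution. -/
def TensorSub.bind (S : TensorSub K) {V W : Type u} [AddCommGroup V] [Module K V]
    [AddCommGroup W] [Module K W] (f : V →ₗ[K] S.space W) : S.space V →ₗ[K] S.space W :=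
  (TensorAlgebra.lift K ((S.carrier W).subtype ∘ₗ f)).toLinearMap.restrict
    (S.lift_mem V W _ fun v => (f v).2)

/-- The free algebras given by the spaces `S(V)`. -/
def TensorSub.freeAlg (S : TensorSub K) : FreeAlg K where
  obj V := ModuleCat.of K (S.space V)
  ι V := (TensorAlgebra.ι K).codRestrict (S.carrier V) (S.ι_mem V)
  bind {V W} f := S.bind (V := V) (W := W) f
  bind_ι f := LinearMap.ext fun v => Subtype.ext (TensorAlgebra.lift_ι_apply _ v)
  bind_unit V := by
    have h : TensorAlgebra.lift K (TensorAlgebra.ι K) = AlgHom.id K (TensorAlgebra K V) :=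
      TensorAlgebra.hom_ext (LinearMap.ext fun v => by simp)
    exact LinearMap.ext fun a => Subtype.ext (DFunLike.congr_fun h (a : TensorAlgebra K V))
  bind_bind {U V W} f g := by
    have h : (TensorAlgebra.lift K ((S.carrier W).subtype ∘ₗ g)).comp
        (TensorAlgebra.lift K ((S.carrier V).subtype ∘ₗ f)) =
        TensorAlgebra.lift K ((S.carrier W).subtype ∘ₗ S.bind (V := V) (W := W) g ∘ₗ f) :=
      TensorAlgebra.hom_ext (LinearMap.ext fun v => by
        simp only [AlgHom.comp_toLinearMap, LinearMap.comp_apply, AlgHom.toLinearMap_apply,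
          TensorAlgebra.lift_ι_apply]
        rfl)
    exact LinearMap.ext fun a => Subtype.ext (DFunLike.congr_fun h (a : TensorAlgebra K U))

variable (K)

/-- The free non-unital associative algebra `T(V)`: the augmentation ideal of the tensor
algebra, i.e. the sum of its components of positive degree. -/
def tensorT : TensorSub K where
  carrier V := LinearMap.ker (TensorAlgebra.algebraMapInv (R := K) (M := V)).toLinearMap
  ι_mem V _ _ v := by simp [TensorAlgebra.algebraMapInv]
  lift_mem V W _ _ _ _ f hf a ha := by
    have h : (TensorAlgebra.algebraMapInv (R := K) (M := W)).comp (TensorAlgebra.lift K f) =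
        TensorAlgebra.algebraMapInv :=
      TensorAlgebra.hom_ext (LinearMap.ext fun v => by
        have := hf v
        simpa [TensorAlgebra.algebraMapInv] using this)
    exact (DFunLike.congr_fun h a).trans ha

/-- The involution `σ` of the tensor algebra, i.e. the anti-automorphism that is the identity on
`V`, as an algebra morphism to the opposite algebra. -/
def sigma (V : Type u) [AddCommGroup V] [Module K V] :
    TensorAlgebra K V →ₐ[K] (TensorAlgebra K V)ᵐᵒᵖ :=
  TensorAlgebra.lift K ((MulOpposite.opLinearEquiv K).toLinearMap ∘ₗ TensorAlgebra.ι K)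

/-- The subspace of all `a` such that `σ a = a`. -/
def fixedSigma (V : Type u) [AddCommGroup V] [Module K V] : Submodule K (TensorAlgebra K V) :=
  LinearMap.ker ((sigma K V).toLinearMap - (MulOpposite.opLinearEquiv K).toLinearMap)

variable {K}

theorem mem_fixedSigma {V : Type u} [AddCommGroup V] [Module K V] {a : TensorAlgebra K V} :
    a ∈ fixedSigma K V ↔ sigma K V a = MulOpposite.op a := by
  simp [fixedSigma, sub_eq_zero]

/-- The Jordan product `a ∘ b = ½ (ab + ba)` of an associative algebra. -/
def jordanMul (A : Type u) [Ring A] [Algebra K A] : A →ₗ[K] A →ₗ[K] A :=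
  (2⁻¹ : K) • (LinearMap.mul K A + (LinearMap.mul K A).flip)

theorem jordanMul_apply (A : Type u) [Ring A] [Algebra K A] (a b : A) :
    jordanMul (K := K) A a b = (2⁻¹ : K) • (a * b + b * a) := rfl

variable (K)

/-- A family `S(V)` as above, consisting of Jordan subalgebras. -/
structure JordanTensorSub extends TensorSub K where
  jordanMul_mem : ∀ (V : Type u) [AddCommGroup V] [Module K V], ∀ a ∈ carrier V, ∀ b ∈ carrier V,
    jordanMul (K := K) (TensorAlgebra K V) a b ∈ carrier V

/-- The Cohn-Jordan algebra `CJ(V) = T(V)^σ`. -/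
def tensorCJ : JordanTensorSub K where
  carrier V := (tensorT K).carrier V ⊓ fixedSigma K V
  ι_mem V _ _ v := ⟨(tensorT K).ι_mem V v, by simp [mem_fixedSigma, sigma]⟩
  lift_mem V W _ _ _ _ f hf a ha := by
    refine ⟨(tensorT K).lift_mem V W f (fun v => (hf v).1) a ha.1, ?_⟩
    have h : (sigma K W).comp (TensorAlgebra.lift K f) =
        (AlgHom.op (TensorAlgebra.lift K f)).comp (sigma K V) :=
      TensorAlgebra.hom_ext (LinearMap.ext fun v => by
        have := mem_fixedSigma.1 (hf v).2
        simpa [sigma] using this)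
    have h2 := DFunLike.congr_fun h a
    have h3 := mem_fixedSigma.1 ha.2
    refine mem_fixedSigma.2 (h2.trans ?_)
    simp [h3]
  jordanMul_mem V _ _ a ha b hb := by
    refine ⟨?_, ?_⟩
    · have h1 : TensorAlgebra.algebraMapInv (R := K) (M := V) a = 0 := ha.1
      have h2 : TensorAlgebra.algebraMapInv (R := K) (M := V) b = 0 := hb.1
      change TensorAlgebra.algebraMapInv (R := K) (M := V) _ = 0
      simp [jordanMul_apply, h1, h2]
    · have h1 := mem_fixedSigma.1 ha.2
      have h2 := mem_fixedSigma.1 hb.2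
      refine mem_fixedSigma.2 ?_
      simp [jordanMul_apply, h1, h2, add_comm]

/-- The free special Jordan algebra `SJ(V)`: the smallest Jordan subalgebra of the tensor algebra
that contains `V`. -/
def tensorSJ : JordanTensorSub K where
  carrier V := sInf {S : Submodule K (TensorAlgebra K V) | (∀ v, TensorAlgebra.ι K v ∈ S) ∧
    ∀ a ∈ S, ∀ b ∈ S, jordanMul (K := K) (TensorAlgebra K V) a b ∈ S}
  ι_mem V _ _ v := Submodule.mem_sInf.2 fun _ hS => hS.1 v
  lift_mem V W _ _ _ _ f hf a ha := by
    refine Submodule.mem_sInf.2 fun S hS => ?_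
    refine Submodule.mem_sInf.1 ha (S.comap (TensorAlgebra.lift K f).toLinearMap) ⟨?_, ?_⟩
    · intro v
      have := Submodule.mem_sInf.1 (hf v) S hS
      simpa using this
    · intro a ha b hb
      have := hS.2 _ ha _ hb
      simpa [jordanMul_apply] using this
  jordanMul_mem V _ _ a ha b hb := Submodule.mem_sInf.2 fun S hS =>
    hS.2 _ (Submodule.mem_sInf.1 ha S hS) _ (Submodule.mem_sInf.1 hb S hS)

/-- The subspace `[T(V), T(V)]` spanned by all commutators. -/
def commutatorT (V : Type u) [AddCommGroup V] [Module K V] : Submodule K (TensorAlgebra K V) :=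
  Submodule.span K {c | ∃ a ∈ (tensorT K).carrier V, ∃ b ∈ (tensorT K).carrier V,
    c = a * b - b * a}

variable {K}

/-- The morphism `T(f)` of tensor algebras (with unit) induced by a linear map `f`. -/
def tensorMap {V W : Type u} [AddCommGroup V] [Module K V] [AddCommGroup W] [Module K W]
    (f : V →ₗ[K] W) : TensorAlgebra K V →ₐ[K] TensorAlgebra K W :=
  TensorAlgebra.lift K (TensorAlgebra.ι K ∘ₗ f)

theorem tensorMap_id (V : Type u) [AddCommGroup V] [Module K V] :
    tensorMap (LinearMap.id : V →ₗ[K] V) = AlgHom.id K _ :=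
  TensorAlgebra.hom_ext (LinearMap.ext fun v => by simp [tensorMap])

theorem tensorMap_comp {U V W : Type u} [AddCommGroup U] [Module K U] [AddCommGroup V] [Module K V]
    [AddCommGroup W] [Module K W] (f : U →ₗ[K] V) (g : V →ₗ[K] W) :
    tensorMap (g ∘ₗ f) = (tensorMap g).comp (tensorMap f) :=
  TensorAlgebra.hom_ext (LinearMap.ext fun v => by simp [tensorMap])

theorem tensorMap_mem (S : TensorSub K) {V W : Type u} [AddCommGroup V] [Module K V]
    [AddCommGroup W] [Module K W] (f : V →ₗ[K] W) {a : TensorAlgebra K V}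
    (ha : a ∈ S.carrier V) : tensorMap f a ∈ S.carrier W :=
  S.lift_mem V W _ (fun v => S.ι_mem W (f v)) a ha

theorem tensorMap_mem_commutatorT {V W : Type u} [AddCommGroup V] [Module K V]
    [AddCommGroup W] [Module K W] (f : V →ₗ[K] W) :
    ∀ c ∈ commutatorT K V, (tensorMap f).toLinearMap c ∈ commutatorT K W := by
  intro c hc
  refine (Submodule.span_le (p := (commutatorT K W).comap (tensorMap f).toLinearMap)).2 ?_ hc
  rintro _ ⟨a, ha, b, hb, rfl⟩
  exact Submodule.subset_span ⟨_, tensorMap_mem (tensorT K) f ha, _,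
    tensorMap_mem (tensorT K) f hb, by simp⟩

variable (K)

/-- The functor `[T,T] : V ↦ [T(V), T(V)]`. -/
def functorTT : ModuleCat.{u} K ⥤ ModuleCat.{u} K where
  obj V := ModuleCat.of K (commutatorT K V)
  map {V W} f := ModuleCat.ofHom ((tensorMap f.hom).toLinearMap.restrict
    (p := commutatorT K V) (q := commutatorT K W) (tensorMap_mem_commutatorT f.hom))
  map_id V := by
    ext1
    refine LinearMap.ext fun c => Subtype.ext ?_
    exact DFunLike.congr_fun (tensorMap_id (K := K) V) (c : TensorAlgebra K V)
  map_comp f g := by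
    ext1
    refine LinearMap.ext fun c => Subtype.ext ?_
    exact DFunLike.congr_fun (tensorMap_comp f.hom g.hom) (c : TensorAlgebra K _)

/-- The bilinear map `T(V) × V → [T(V), T(V)]`, `(u, v) ↦ [u, v] = uv - vu`. -/
def commT (V : Type u) [AddCommGroup V] [Module K V] :
    (tensorT K).space V →ₗ[K] V →ₗ[K] commutatorT K V :=
  LinearMap.mk₂ K (fun u v =>
    ⟨u * TensorAlgebra.ι K v - TensorAlgebra.ι K v * u,
      Submodule.subset_span ⟨u, u.2, _, (tensorT K).ι_mem V v, rfl⟩⟩)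
    (fun a b v => Subtype.ext (by simp [add_mul, mul_add]; abel))
    (fun c a v => Subtype.ext (by simp [smul_sub]))
    (fun a v w => Subtype.ext (by simp [add_mul, mul_add]; abel))
    (fun c a v => Subtype.ext (by simp [smul_sub]))

/-- The natural transformation `Θ_T : T(V) ⊗ V → [T(V), T(V)]`, `u ⊗ v ↦ [u, v]`. -/
def thetaT : tensorId (tensorT K).freeAlg.functor ⟶ functorTT K where
  app V := ModuleCat.ofHom (TensorProduct.lift (commT K V))
  naturality {V W} f := by
    ext1
    refine TensorProduct.ext' fun (a : (tensorT K).space V) v => Subtype.ext ?_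
    change tensorMap f.hom (a : TensorAlgebra K V) * TensorAlgebra.ι K (f.hom v) -
      TensorAlgebra.ι K (f.hom v) * tensorMap f.hom (a : TensorAlgebra K V) =
      tensorMap f.hom ((a : TensorAlgebra K V) * TensorAlgebra.ι K v - TensorAlgebra.ι K v * a)
    simp [tensorMap]

end TensorFunctors

section InnerDerivations

variable {K : Type u} [Field K]

/-- For an algebra `A` with product `m`, the bilinear map `(x, y) ↦ ∂_{x,y}`, where
`∂_{x,y} z = x(zy) - (xz)y`. -/
def innerDer {A : Type u} [AddCommGroup A] [Module K A] (m : A →ₗ[K] A →ₗ[K] A) :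
    A →ₗ[K] A →ₗ[K] (A →ₗ[K] A) :=
  LinearMap.mk₂ K (fun x y => m x ∘ₗ m.flip y - m.flip y ∘ₗ m x)
    (fun x x' y => by ext z; simp; abel)
    (fun c x y => by ext z; simp [smul_sub])
    (fun x y y' => by ext z; simp; abel)
    (fun c x y => by ext z; simp [smul_sub])

theorem innerDer_apply {A : Type u} [AddCommGroup A] [Module K A] (m : A →ₗ[K] A →ₗ[K] A)
    (x y z : A) : innerDer m x y z = m x (m z y) - m (m x z) y := rfl

/-- The space `Inner A` of inner derivations, i.e. of linear combinations of maps `∂_{x,y}`. -/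
def innerSpace {A : Type u} [AddCommGroup A] [Module K A] (m : A →ₗ[K] A →ₗ[K] A) :
    Submodule K (A →ₗ[K] A) :=
  Submodule.span K {d | ∃ x y, d = innerDer m x y}

theorem range_lift_innerDer {A : Type u} [AddCommGroup A] [Module K A]
    (m : A →ₗ[K] A →ₗ[K] A) :
    LinearMap.range (TensorProduct.lift (innerDer m)) = innerSpace m := by
  apply le_antisymm
  · rintro _ ⟨t, rfl⟩
    induction t with
    | zero => simp
    | add a b ha hb => rw [map_add]; exact add_mem ha hb
    | tmul x y => exact Submodule.subset_span ⟨x, y, by simp⟩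
  · refine Submodule.span_le.2 ?_
    rintro _ ⟨x, y, rfl⟩
    exact ⟨x ⊗ₜ y, by simp⟩

/-- The space `Inner A` as a type. -/
def Inner {A : Type u} [AddCommGroup A] [Module K A] (m : A →ₗ[K] A →ₗ[K] A) : Type u :=
  innerSpace m

instance {A : Type u} [AddCommGroup A] [Module K A] (m : A →ₗ[K] A →ₗ[K] A) :
    AddCommGroup (Inner m) := inferInstanceAs (AddCommGroup (innerSpace m))

instance {A : Type u} [AddCommGroup A] [Module K A] (m : A →ₗ[K] A →ₗ[K] A) :
    Module K (Inner m) := inferInstanceAs (Module K (innerSpace m))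

/-- The linear map given by an element of `Inner A`. -/
def Inner.val {A : Type u} [AddCommGroup A] [Module K A] {m : A →ₗ[K] A →ₗ[K] A} :
    Inner m →ₗ[K] (A →ₗ[K] A) := (innerSpace m).subtype

/-- The element `∂_{x,y}` of `Inner A`. -/
def toInner {A : Type u} [AddCommGroup A] [Module K A] (m : A →ₗ[K] A →ₗ[K] A) :
    A →ₗ[K] A →ₗ[K] Inner m :=
  LinearMap.mk₂ K (fun x y => ⟨innerDer m x y, Submodule.subset_span ⟨x, y, rfl⟩⟩)
    (fun x x' y => Subtype.ext (by simp; rfl))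
    (fun c x y => Subtype.ext (by simp; rfl))
    (fun x y y' => Subtype.ext (by simp; rfl))
    (fun c x y => Subtype.ext (by simp; rfl))

theorem toInner_coe {A : Type u} [AddCommGroup A] [Module K A] (m : A →ₗ[K] A →ₗ[K] A) (x y : A) :
    (toInner m x y).val = innerDer m x y := rfl

theorem Inner.hom_ext {A N : Type u} [AddCommGroup A] [Module K A] [AddCommGroup N]
    [Module K N] (m : A →ₗ[K] A →ₗ[K] A) {f g : Inner m →ₗ[K] N}
    (h : ∀ x y, f (toInner m x y) = g (toInner m x y)) : f = g := by
  refine LinearMap.ext fun ⟨d, hd⟩ => ?_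
  induction hd using Submodule.span_induction with
  | mem d hd =>
    obtain ⟨x, y, rfl⟩ := hd
    exact h x y
  | zero => exact (map_zero f).trans (map_zero g).symm
  | add a b ha hb h1 h2 =>
    exact (map_add f (⟨a, ha⟩ : Inner m) ⟨b, hb⟩).trans
      ((congrArg₂ (· + ·) h1 h2).trans (map_add g (⟨a, ha⟩ : Inner m) ⟨b, hb⟩).symm)
  | smul c a ha h1 =>
    exact (map_smul f c (⟨a, ha⟩ : Inner m)).trans
      ((congrArg (c • ·) h1).trans (map_smul g c (⟨a, ha⟩ : Inner m)).symm)

/-- A map of inner derivations `∂_{x,y} ↦ ∂_{φ x, φ y}`, when it is well defined. -/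
theorem exists_innerMap {A B : Type u} [AddCommGroup A] [Module K A] [AddCommGroup B] [Module K B]
    (m : A →ₗ[K] A →ₗ[K] A) (n : B →ₗ[K] B →ₗ[K] B) (φ : A →ₗ[K] B)
    (h : ∀ t, TensorProduct.lift (innerDer m) t = 0 →
      TensorProduct.lift (innerDer n) (TensorProduct.map φ φ t) = 0) :
    ∃ f : Inner m →ₗ[K] Inner n,
      ∀ x y, f (toInner m x y) = toInner n (φ x) (φ y) := by
  have hr : ∀ t, TensorProduct.lift (innerDer n) t ∈ innerSpace n := fun t => by
    rw [← range_lift_innerDer]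
    exact ⟨t, rfl⟩
  let g : A ⊗[K] A →ₗ[K] Inner n :=
    ((TensorProduct.lift (innerDer n)).codRestrict _ hr) ∘ₗ TensorProduct.map φ φ
  have hg : LinearMap.ker (TensorProduct.lift (innerDer m)) ≤ LinearMap.ker g := fun t ht =>
    Subtype.ext (h t ht)
  let e : LinearMap.range (TensorProduct.lift (innerDer m)) ≃ₗ[K] innerSpace m :=
    LinearEquiv.ofEq _ _ (range_lift_innerDer m)
  let p : A ⊗[K] A →ₗ[K] Inner m := e.toLinearMap ∘ₗ (TensorProduct.lift (innerDer m)).rangeRestrict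
  have hp : Function.Surjective p :=
    e.surjective.comp (LinearMap.surjective_rangeRestrict _)
  have hk : LinearMap.ker p ≤ LinearMap.ker g := fun t ht => hg (congrArg Subtype.val ht)
  refine ⟨(LinearMap.ker p).liftQ g hk ∘ₗ (p.quotKerEquivOfSurjective hp).symm.toLinearMap,
    fun x y => ?_⟩
  have h1 : toInner m x y = p.quotKerEquivOfSurjective hp (Submodule.Quotient.mk (x ⊗ₜ y)) := rfl
  rw [h1, LinearMap.comp_apply, LinearEquiv.coe_coe, LinearEquiv.symm_apply_apply,
    Submodule.liftQ_apply]
  rfl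

/-! Inner derivations of the Jordan subalgebras `S(V)` of the tensor algebra depend functorially
on `V`. This rests on the fact that a sum of commutators which is central vanishes. -/

/-- The linear map `a ⊗ b ↦ ab - ba`. -/
def commSum (A : Type u) [Ring A] [Algebra K A] : A ⊗[K] A →ₗ[K] A :=
  TensorProduct.lift (LinearMap.mul K A - (LinearMap.mul K A).flip)

theorem commSum_tmul {A : Type u} [Ring A] [Algebra K A] (a b : A) :
    commSum (K := K) A (a ⊗ₜ b) = a * b - b * a := by
  simp [commSum]

theorem monoidAlgebra_central {κ : Type u} [Nontrivial κ] (c : MonoidAlgebra K (FreeMonoid κ))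
    (hc : ∀ i : κ, c * MonoidAlgebra.single (FreeMonoid.of i) 1 =
      MonoidAlgebra.single (FreeMonoid.of i) 1 * c) :
    ∃ k : K, c = algebraMap K _ k := by
  have key : ∀ w : FreeMonoid κ, w ≠ 1 → c.coeff w = 0 := by
    intro w hw
    by_contra hne
    have hlast : ∀ i : κ, ∃ u, FreeMonoid.of i * w = u * FreeMonoid.of i := by
      intro i
      by_contra hno
      have h1 := MonoidAlgebra.coeff_mul_single_of_forall_mul_ne (1 : K) c
        (fun d hd => hno ⟨d, hd.symm⟩)
      rw [hc i, MonoidAlgebra.coeff_single_mul_eq_mul_coeff (m₂ := w)] at h1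
      · exact hne (by simpa using h1)
      · intro a _
        exact mul_right_inj _
    have hl : ∀ i : κ, (FreeMonoid.toList w).getLast? = some i := by
      intro i
      obtain ⟨u, hu⟩ := hlast i
      have h2 : (FreeMonoid.toList (FreeMonoid.of i * w)).getLast? =
          (FreeMonoid.toList (u * FreeMonoid.of i)).getLast? := by rw [hu]
      have hw' : FreeMonoid.toList w ≠ [] := fun h => hw (FreeMonoid.toList.injective h)
      rw [FreeMonoid.toList_mul, FreeMonoid.toList_mul, List.getLast?_append_of_ne_nil _ hw',
        List.getLast?_append_of_ne_nil _ (by simp)] at h2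
      simpa using h2
    obtain ⟨i, j, hij⟩ := exists_pair_ne κ
    exact hij (Option.some.inj ((hl i).symm.trans (hl j)))
  refine ⟨c.coeff 1, ?_⟩
  ext w
  by_cases hw : w = 1
  · subst hw; simp
  · rw [key w hw]; simp [hw]

theorem commSum_eq_zero {V : Type u} [AddCommGroup V] [Module K V]
    (t : TensorAlgebra K V ⊗[K] TensorAlgebra K V)
    (h : ∀ v, commSum (K := K) _ t * TensorAlgebra.ι K v =
      TensorAlgebra.ι K v * commSum (K := K) _ t) :
    commSum (K := K) _ t = 0 := by
  let b := Module.Free.chooseBasis K V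
  rcases subsingleton_or_nontrivial (Module.Free.ChooseBasisIndex K V) with hs | hn
  · have h1 : ∀ v w : V, TensorAlgebra.ι K v * TensorAlgebra.ι K w =
        TensorAlgebra.ι K w * TensorAlgebra.ι K v := by
      intro v w
      rcases isEmpty_or_nonempty (Module.Free.ChooseBasisIndex K V) with he | ⟨⟨i⟩⟩
      · have : Subsingleton V := b.repr.injective.subsingleton
        rw [Subsingleton.elim v w]
      · have hv : ∀ v, v = b.repr v i • b i := fun v => by
          apply b.ext_elem
          intro j
          rw [Subsingleton.elim j i]
          simp
        rw [hv v, hv w]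
        simp [smul_smul, mul_comm]
    have h2 : ∀ (v : V) (a : TensorAlgebra K V), a * TensorAlgebra.ι K v =
        TensorAlgebra.ι K v * a := by
      intro v a
      induction a using TensorAlgebra.induction with
      | algebraMap r => exact Algebra.commutes r _
      | ι w => exact h1 w v
      | mul a a' h h' => rw [mul_assoc, h', ← mul_assoc, h, mul_assoc]
      | add a a' h h' => rw [add_mul, mul_add, h, h']
    have h3 : ∀ a a' : TensorAlgebra K V, a * a' = a' * a := by
      intro a a'
      induction a' using TensorAlgebra.induction with
      | algebraMap r => exact (Algebra.commutes r _).symm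
      | ι w => exact h2 w a
      | mul c c' h h' => rw [← mul_assoc, h, mul_assoc, h', mul_assoc]
      | add c c' h h' => rw [add_mul, mul_add, h, h']
    induction t with
    | zero => simp
    | add x y hx hy => rw [map_add, hx fun v => (h2 v _), hy fun v => (h2 v _), add_zero]
    | tmul x y => rw [commSum_tmul, h3, sub_self]
  · let e : TensorAlgebra K V ≃ₐ[K] MonoidAlgebra K (FreeMonoid (Module.Free.ChooseBasisIndex K V)) :=
      (TensorAlgebra.equivFreeAlgebra b).trans FreeAlgebra.equivMonoidAlgebraFreeMonoid
    have he : ∀ i, e (TensorAlgebra.ι K (b i)) = MonoidAlgebra.single (FreeMonoid.of i) 1 := by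
      intro i
      simp [e, FreeAlgebra.equivMonoidAlgebraFreeMonoid]
    obtain ⟨k, hk⟩ := monoidAlgebra_central (e (commSum (K := K) _ t)) fun i => by
      rw [← he, ← map_mul, ← map_mul, h]
    have hk2 : commSum (K := K) _ t = algebraMap K _ k := e.injective (by rw [hk, e.commutes])
    have h0 : ∀ t : TensorAlgebra K V ⊗[K] TensorAlgebra K V,
        TensorAlgebra.algebraMapInv (R := K) (M := V) (commSum (K := K) _ t) = 0 := by
      intro t
      induction t with
      | zero => simp
      | add x y hx hy => rw [map_add, map_add, hx, hy, add_zero]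
      | tmul x y => rw [commSum_tmul, map_sub, map_mul, map_mul, mul_comm, sub_self]
    have h1 := h0 t
    rw [hk2] at h1 ⊢
    rw [AlgHom.commutes] at h1
    have : k = 0 := h1
    rw [this, map_zero]

/-- The Jordan product of `S(V)`. -/
def JordanTensorSub.mul (S : JordanTensorSub K) (V : Type u) [AddCommGroup V] [Module K V] :
    S.space V →ₗ[K] S.space V →ₗ[K] S.space V :=
  LinearMap.mk₂ K (fun a b => ⟨jordanMul (TensorAlgebra K V) a b, S.jordanMul_mem V a a.2 b b.2⟩)
    (fun a a' b => Subtype.ext (by simp))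
    (fun c a b => Subtype.ext (by simp))
    (fun a b b' => Subtype.ext (by simp))
    (fun c a b => Subtype.ext (by simp))

theorem JordanTensorSub.mul_coe (S : JordanTensorSub K) (V : Type u) [AddCommGroup V] [Module K V]
    (a b : S.space V) :
    (S.mul V a b : TensorAlgebra K V) = (2⁻¹ : K) • ((a : TensorAlgebra K V) * b + b * a) := rfl

/-- `4 ∂_{x,y} z = [[x,y],z]` in the Jordan algebra `S(V)`. -/
theorem JordanTensorSub.lift_innerDer (S : JordanTensorSub K) [CharZero K] (V : Type u)
    [AddCommGroup V] [Module K V] (t : S.space V ⊗[K] S.space V) (z : S.space V) :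
    (4 : K) • (TensorProduct.lift (innerDer (S.mul V)) t z : TensorAlgebra K V) =
      commSum (K := K) _ (TensorProduct.map (S.carrier V).subtype (S.carrier V).subtype t) * z -
      z * commSum (K := K) _ (TensorProduct.map (S.carrier V).subtype (S.carrier V).subtype t) := by
  induction t with
  | zero => simp
  | add a b ha hb =>
    simp only [map_add, LinearMap.add_apply, Submodule.coe_add, smul_add, ha, hb, add_mul, mul_add]
    abel
  | tmul x y =>
    simp only [TensorProduct.lift.tmul, innerDer_apply, AddSubgroupClass.coe_sub, S.mul_coe,
      TensorProduct.map_tmul, commSum_tmul, Submodule.subtype_apply, mul_smul_comm, smul_mul_assoc,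
      ← smul_add, ← smul_sub, smul_smul]
    have h4 : (4 : K) * (2⁻¹ * 2⁻¹) = 1 := by norm_num
    rw [h4, one_smul]
    noncomm_ring

theorem JordanTensorSub.innerMap_wd (S : JordanTensorSub K) [CharZero K] {V W : Type u}
    [AddCommGroup V] [Module K V] [AddCommGroup W] [Module K W] (φ : V →ₗ[K] W)
    (ψ : S.space V →ₗ[K] S.space W)
    (hψ : ∀ a, (ψ a : TensorAlgebra K W) = tensorMap φ (a : TensorAlgebra K V))
    (t : S.space V ⊗[K] S.space V) (h : TensorProduct.lift (innerDer (S.mul V)) t = 0) :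
    TensorProduct.lift (innerDer (S.mul W)) (TensorProduct.map ψ ψ t) = 0 := by
  have h1 : commSum (K := K) _
      (TensorProduct.map (S.carrier V).subtype (S.carrier V).subtype t) = 0 := by
    refine commSum_eq_zero _ fun v => ?_
    have h2 := S.lift_innerDer V t ⟨TensorAlgebra.ι K v, S.ι_mem V v⟩
    rw [h] at h2
    simp only [LinearMap.zero_apply, ZeroMemClass.coe_zero, smul_zero] at h2
    exact (sub_eq_zero.1 h2.symm)
  have h3 : ∀ t : S.space V ⊗[K] S.space V, commSum (K := K) _
      (TensorProduct.map (S.carrier W).subtype (S.carrier W).subtype (TensorProduct.map ψ ψ t)) =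
      tensorMap φ (commSum (K := K) _
        (TensorProduct.map (S.carrier V).subtype (S.carrier V).subtype t)) := by
    intro t
    induction t with
    | zero => simp
    | add a b ha hb => simp only [map_add, ha, hb]
    | tmul x y => simp [commSum_tmul, hψ]
  refine LinearMap.ext fun z => Subtype.ext ?_
  have h4 := S.lift_innerDer W (TensorProduct.map ψ ψ t) z
  rw [h3, h1, map_zero, zero_mul, mul_zero, sub_zero] at h4
  simpa using h4

/-- The map `S(V) → S(W)` induced by a linear map `V → W`. -/
def JordanTensorSub.map (S : JordanTensorSub K) {V W : ModuleCat.{u} K} (f : V ⟶ W) :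
    S.space V →ₗ[K] S.space W :=
  (S.freeAlg.functor.map f).hom

theorem JordanTensorSub.map_coe (S : JordanTensorSub K) {V W : ModuleCat.{u} K} (f : V ⟶ W)
    (a : S.space V) : (S.map f a : TensorAlgebra K W) = tensorMap f.hom (a : TensorAlgebra K V) :=
  rfl

/-- The map `Inner S(V) → Inner S(W)`, `∂_{x,y} ↦ ∂_{S(f) x, S(f) y}`. -/
def JordanTensorSub.innerMap (S : JordanTensorSub K) [CharZero K] {V W : ModuleCat.{u} K}
    (f : V ⟶ W) : Inner (S.mul V) →ₗ[K] Inner (S.mul W) :=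
  (exists_innerMap _ _ (S.map f) (S.innerMap_wd f.hom (S.map f) (S.map_coe f))).choose

theorem JordanTensorSub.innerMap_toInner (S : JordanTensorSub K) [CharZero K]
    {V W : ModuleCat.{u} K} (f : V ⟶ W) (x y : S.space V) :
    S.innerMap f (toInner (S.mul V) x y) = toInner (S.mul W) (S.map f x) (S.map f y) :=
  (exists_innerMap _ _ (S.map f) (S.innerMap_wd f.hom (S.map f) (S.map_coe f))).choose_spec x y

/-- The functor `Inner S : V ↦ Inner S(V)`. -/
def JordanTensorSub.inner (S : JordanTensorSub K) [CharZero K] :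
    ModuleCat.{u} K ⥤ ModuleCat.{u} K where
  obj V := ModuleCat.of K (Inner (S.mul V))
  map f := ModuleCat.ofHom (S.innerMap f)
  map_id V := by
    ext1
    refine Inner.hom_ext _ fun x y => ?_
    have h : S.map (𝟙 V) = LinearMap.id :=
      congrArg ModuleCat.Hom.hom (S.freeAlg.functor.map_id V)
    refine (S.innerMap_toInner _ x y).trans ?_
    rw [h]
    rfl
  map_comp {U V W} f g := by
    ext1
    refine Inner.hom_ext _ fun x y => ?_
    have h : S.map (f ≫ g) = S.map g ∘ₗ S.map f :=
      congrArg ModuleCat.Hom.hom (S.freeAlg.functor.map_comp f g)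
    refine (S.innerMap_toInner _ x y).trans ?_
    have h2 : S.innerMap g (S.innerMap f (toInner (S.mul U) x y)) =
        toInner (S.mul W) (S.map g (S.map f x)) (S.map g (S.map f y)) := by
      rw [S.innerMap_toInner, S.innerMap_toInner]
    rw [h]
    exact h2.symm

/-- The natural transformation `S(V) ⊗ V → Inner S(V)`, `a ⊗ v ↦ ∂_{a,v}`. -/
def JordanTensorSub.theta (S : JordanTensorSub K) [CharZero K] :
    tensorId S.freeAlg.functor ⟶ S.inner where
  app V := ModuleCat.ofHom (TensorProduct.lift ((toInner (S.mul V)).compl₂ (S.freeAlg.ι V)))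
  naturality {V W} f := by
    ext1
    refine TensorProduct.ext' fun a v => ?_
    have h : S.map f (S.freeAlg.ι V v) = S.freeAlg.ι W (f.hom v) :=
      LinearMap.congr_fun (S.freeAlg.bind_ι (S.freeAlg.ι W ∘ₗ f.hom)) v
    have h2 := S.innerMap_toInner f a (S.freeAlg.ι V v)
    rw [h] at h2
    exact h2.symm

variable (K)

/-- The natural transformation `Θ_SJ : SJ(V) ⊗ V → Inner SJ(V)`, `a ⊗ v ↦ ∂_{a,v}`. -/
def thetaSJ [CharZero K] : tensorId (tensorSJ K).freeAlg.functor ⟶ (tensorSJ K).inner :=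
  (tensorSJ K).theta

/-- The natural transformation `Θ_CJ : CJ(V) ⊗ V → Inner CJ(V)`, `u ⊗ v ↦ [u, v]`, where a sum of
commutators `c` is identified with the inner derivation `z ↦ [c, z]`: `[u, v]` is identified with
`4 ∂_{u,v}`. -/
def thetaCJ [CharZero K] : tensorId (tensorCJ K).freeAlg.functor ⟶ (tensorCJ K).inner :=
  (4 : ℕ) • (tensorCJ K).theta

theorem thetaCJ_apply [CharZero K] (V : ModuleCat.{u} K) (u : (tensorCJ K).space V) (v : V)
    (z : (tensorCJ K).space V) :
    ((Inner.val (m := (tensorCJ K).mul V) (thetaAt (thetaCJ K) V (u ⊗ₜ v)) z :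
      (tensorCJ K).space V) : TensorAlgebra K V) =
      ((u : TensorAlgebra K V) * TensorAlgebra.ι K v - TensorAlgebra.ι K v * u) * z -
      z * ((u : TensorAlgebra K V) * TensorAlgebra.ι K v - TensorAlgebra.ι K v * u) := by
  have h := (tensorCJ K).lift_innerDer V (u ⊗ₜ
    (⟨TensorAlgebra.ι K v, (tensorCJ K).ι_mem V v⟩ : (tensorCJ K).space V)) z
  rw [TensorProduct.map_tmul, commSum_tmul] at h
  refine Eq.trans ?_ h
  have h2 : thetaAt (thetaCJ K) V (u ⊗ₜ v) =
      (4 : ℕ) • toInner ((tensorCJ K).mul V) u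
        (⟨TensorAlgebra.ι K v, (tensorCJ K).ι_mem V v⟩ : (tensorCJ K).space V) := rfl
  have h3 : ∀ d : Inner ((tensorCJ K).mul V), Inner.val ((4 : ℕ) • d) = (4 : K) • Inner.val d := by
    intro d
    rw [map_nsmul, ← Nat.cast_smul_eq_nsmul K]
    rfl
  rw [h2, h3, toInner_coe]
  rfl

end InnerDerivations

/-! ## `𝔖`-modules and operads -/

section SymmetricSequences

variable {K : Type u} [Field K]

/-- A sequence of representations of the symmetric groups `𝔖_n`, acting on `{0, …, n-1}`. -/
structure SymSeq (K : Type u) [Field K] where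
  obj : ℕ → ModuleCat.{u} K
  rep : ∀ n, Representation K (Equiv.Perm (Fin n)) (obj n)

/-- An `𝔖`-module is a sequence of finite dimensional representations. -/
def SymSeq.IsSModule (E : SymSeq K) : Prop := ∀ n, Module.Finite K (E.obj n)

/-- The embedding `𝔖_n ⊂ 𝔖_{n+1}` as the subgroup of the permutations of `{0, …, n}` that fix `0`;
the element `i` of `{0, …, n-1}` corresponds to `i + 1`. -/
def symEmbedding (n : ℕ) : Equiv.Perm (Fin n) →* Equiv.Perm (Fin (n + 1)) :=
  Equiv.Perm.viaEmbeddingHom (Fin.succEmb n)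

theorem symEmbedding_succ (n : ℕ) (σ : Equiv.Perm (Fin n)) (i : Fin n) :
    symEmbedding n σ i.succ = (σ i).succ :=
  Equiv.Perm.viaEmbedding_apply σ (Fin.succEmb n) i

theorem symEmbedding_zero (n : ℕ) (σ : Equiv.Perm (Fin n)) : symEmbedding n σ 0 = 0 :=
  Equiv.Perm.viaEmbedding_apply_of_notMem σ (Fin.succEmb n) 0 (by simp)

/-- The restriction `Res E`, with `(Res E)(n) = E(n+1)` as a representation of `𝔖_n`. -/
def SymSeq.res (E : SymSeq K) : SymSeq K where
  obj n := E.obj (n + 1)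
  rep n := (E.rep (n + 1)).comp (symEmbedding n)

/-- Two sequences of representations are isomorphic. -/
def SymSeq.IsIso (E E' : SymSeq K) : Prop :=
  ∀ n, ∃ e : E.obj n ≃ₗ[K] E'.obj n, ∀ σ x, e (E.rep n σ x) = E'.rep n σ (e x)

/-- `E` is an `𝔖`-module and isomorphic to `Res E'` for some `𝔖`-module `E'`. -/
def SymSeq.IsCyclicSModule (E : SymSeq K) : Prop :=
  E.IsSModule ∧ ∃ E' : SymSeq K, E'.IsSModule ∧ E.IsIso E'.res

/-- The diagonal matrix with entries `z`. -/
def diagMap {n : ℕ} (z : Fin n → K) : (Fin n → K) →ₗ[K] (Fin n → K) :=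
  LinearMap.pi fun i => z i • LinearMap.proj i

/-- The permutation matrix of `σ`, i.e. the linear map `e_i ↦ e_{σ i}`. -/
def permMap {n : ℕ} (σ : Equiv.Perm (Fin n)) : (Fin n → K) →ₗ[K] (Fin n → K) :=
  LinearMap.funLeft K K σ.symm

theorem permMap_single {n : ℕ} (σ : Equiv.Perm (Fin n)) (i : Fin n) :
    permMap (K := K) σ (Pi.single i 1) = Pi.single (σ i) 1 := by
  ext j
  simp [permMap, LinearMap.funLeft_apply, Pi.single_apply, Equiv.symm_apply_eq]

/-- The linear map `K^m → K^n` induced by a functor. -/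
def mapPi (F : ModuleCat.{u} K ⥤ ModuleCat.{u} K) {m n : ℕ} (f : (Fin m → K) →ₗ[K] (Fin n → K)) :
    F.obj (ModuleCat.of K (Fin m → K)) →ₗ[K] F.obj (ModuleCat.of K (Fin n → K)) :=
  (F.map (ModuleCat.ofHom f)).hom

theorem mapPi_id (F : ModuleCat.{u} K ⥤ ModuleCat.{u} K) (n : ℕ) :
    mapPi F (LinearMap.id : (Fin n → K) →ₗ[K] (Fin n → K)) = LinearMap.id :=
  congrArg ModuleCat.Hom.hom (F.map_id (ModuleCat.of K (Fin n → K)))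

theorem mapPi_comp (F : ModuleCat.{u} K ⥤ ModuleCat.{u} K) {l m n : ℕ}
    (f : (Fin l → K) →ₗ[K] (Fin m → K)) (g : (Fin m → K) →ₗ[K] (Fin n → K)) :
    mapPi F (g ∘ₗ f) = mapPi F g ∘ₗ mapPi F f :=
  congrArg ModuleCat.Hom.hom (F.map_comp (ModuleCat.ofHom f) (ModuleCat.ofHom g))

/-- The multilinear part of `F(K^n)`, i.e. its weight space of weight `(1, …, 1)`. -/
def multilinear (F : ModuleCat.{u} K ⥤ ModuleCat.{u} K) (n : ℕ) :
    Submodule K (F.obj (ModuleCat.of K (Fin n → K))) where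
  carrier := {v | ∀ z : Fin n → K, (∀ i, z i ≠ 0) → mapPi F (diagMap z) v = (∏ i, z i) • v}
  add_mem' ha hb z hz := by rw [map_add, ha z hz, hb z hz, smul_add]
  zero_mem' z _ := by rw [map_zero, smul_zero]
  smul_mem' c a ha z hz := by rw [map_smul, ha z hz, smul_comm]

theorem mapPi_perm_mem (F : ModuleCat.{u} K ⥤ ModuleCat.{u} K) {n : ℕ} (σ : Equiv.Perm (Fin n)) :
    ∀ v ∈ multilinear F n, mapPi F (permMap σ) v ∈ multilinear F n := by
  intro v hv z hz
  have h : diagMap z ∘ₗ permMap σ = permMap σ ∘ₗ diagMap (z ∘ σ) := by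
    ext i j
    simp [diagMap, permMap, LinearMap.funLeft_apply]
  rw [← LinearMap.comp_apply, ← mapPi_comp, h, mapPi_comp, LinearMap.comp_apply,
    hv (z ∘ σ) fun i => hz (σ i), map_smul]
  congr 1
  exact Equiv.prod_comp σ z

/-- The sequence of the multilinear parts `F(K^n)_{(1, …, 1)}` of a functor `F`, on which `𝔖_n` acts
by permutation matrices. -/
def symSeq (F : ModuleCat.{u} K ⥤ ModuleCat.{u} K) : SymSeq K where
  obj n := ModuleCat.of K (multilinear F n)
  rep n :=
    { toFun := fun σ => (mapPi F (permMap σ)).restrict (mapPi_perm_mem F σ)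
      map_one' := by
        refine LinearMap.ext fun v => Subtype.ext ?_
        have h : permMap (K := K) (1 : Equiv.Perm (Fin n)) = LinearMap.id := rfl
        change mapPi F (permMap 1) v.1 = v.1
        rw [h, mapPi_id]
        rfl
      map_mul' := fun σ τ => by
        refine LinearMap.ext fun v => Subtype.ext ?_
        have h : permMap (K := K) (σ * τ) = permMap σ ∘ₗ permMap τ := rfl
        change mapPi F (permMap (σ * τ)) v.1 = mapPi F (permMap σ) (mapPi F (permMap τ) v.1)
        rw [h, mapPi_comp]
        rfl }

/-! The operad of multilinear elements: the composition `p ∘_i q` substitutes `q` for the `i`-th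
variable of `p`. Variables are numbered from `0`. -/

/-- The linear map `K^m → W` with values `w j` on the standard basis. -/
def onBasis {m : ℕ} {W : Type u} [AddCommGroup W] [Module K W] (w : Fin m → W) :
    (Fin m → K) →ₗ[K] W :=
  Fintype.linearCombination K w

theorem onBasis_single {m : ℕ} {W : Type u} [AddCommGroup W] [Module K W] (w : Fin m → W)
    (j : Fin m) : onBasis (K := K) w (Pi.single j 1) = w j := by
  simp [onBasis, Fintype.linearCombination_apply_single]

/-- The position in `p ∘_i q` of the variable `j ≠ i` of `p`, where `p` has `m` variables, `q` has
`n` variables and `p ∘_i q` has `k = m + n - 1` variables. -/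
def outerIdx {m n k : ℕ} (h : k + 1 = m + n) (i : Fin m) (j : {j : Fin m // j ≠ i}) : Fin k :=
  if hj : (j : Fin m).val < i.val then ⟨j.1.val, by have := i.2; omega⟩
  else ⟨j.1.val - 1 + n, by
    have := j.1.2
    have := Fin.val_ne_of_ne j.2
    omega⟩

/-- The position in `p ∘_i q` of the variable `l` of `q`. -/
def innerIdx {m n k : ℕ} (h : k + 1 = m + n) (i : Fin m) (l : Fin n) : Fin k :=
  ⟨i.val + l.val, by have := i.2; have := l.2; omega⟩

theorem bijective_idx {m n k : ℕ} (h : k + 1 = m + n) (i : Fin m) :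
    Function.Bijective (Sum.elim (outerIdx h i) (innerIdx h i)) := by
  rw [Fintype.bijective_iff_injective_and_card]
  constructor
  · rintro (⟨a, ha⟩ | a) (⟨b, hb⟩ | b) hab
    · have h1 := congrArg Fin.val hab
      have h2 := Fin.val_ne_of_ne ha
      have h3 := Fin.val_ne_of_ne hb
      have : a = b := by
        apply Fin.ext
        simp only [Sum.elim_inl, outerIdx] at h1
        split_ifs at h1 <;> simp only at h1 <;> omega
      subst this
      rfl
    · have h1 := congrArg Fin.val hab
      have h2 := Fin.val_ne_of_ne ha
      have h3 := b.2
      exfalso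
      simp only [Sum.elim_inl, Sum.elim_inr, outerIdx, innerIdx] at h1
      split_ifs at h1 <;> simp only at h1 <;> omega
    · have h1 := congrArg Fin.val hab
      have h2 := Fin.val_ne_of_ne hb
      have h3 := a.2
      exfalso
      simp only [Sum.elim_inl, Sum.elim_inr, outerIdx, innerIdx] at h1
      split_ifs at h1 <;> simp only at h1 <;> omega
    · have h1 := congrArg Fin.val hab
      simp only [Sum.elim_inr, innerIdx] at h1
      exact congrArg Sum.inr (Fin.ext (by omega))
  · have hi := i.2
    have h1 : Fintype.card {j : Fin m // j ≠ i} = m - 1 := by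
      rw [Fintype.card_subtype_compl]
      simp
    rw [Fintype.card_sum, h1, Fintype.card_fin, Fintype.card_fin]
    omega

variable (M : FreeAlg K)

/-- The inclusion of the generators. -/
def FreeAlg.unit (V : ModuleCat.{u} K) : V →ₗ[K] M.functor.obj V := M.ι V

/-- Substitution of elements of the free algebra on `W` for the elements of `V`. -/
def FreeAlg.extend {V W : ModuleCat.{u} K} (f : V →ₗ[K] M.functor.obj W) :
    M.functor.obj V →ₗ[K] M.functor.obj W := M.bind f

theorem FreeAlg.extend_unit {V W : ModuleCat.{u} K} (f : V →ₗ[K] M.functor.obj W) (v : V) :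
    M.extend f (M.unit V v) = f v :=
  LinearMap.congr_fun (M.bind_ι f) v

theorem FreeAlg.extend_extend {U V W : ModuleCat.{u} K} (f : U →ₗ[K] M.functor.obj V)
    (g : V →ₗ[K] M.functor.obj W) (a : M.functor.obj U) :
    M.extend g (M.extend f a) = M.extend (M.extend g ∘ₗ f) a :=
  LinearMap.congr_fun (M.bind_bind f g) a

/-- The inclusion of the generators in the free algebra on `K^n`. -/
def piUnit (n : ℕ) : (Fin n → K) →ₗ[K] M.functor.obj (ModuleCat.of K (Fin n → K)) :=
  M.unit (ModuleCat.of K (Fin n → K))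

/-- Substitution of the values `w j` for the variables of an element of the free algebra on `K^m`. -/
def subst {m k : ℕ} (w : Fin m → M.functor.obj (ModuleCat.of K (Fin k → K))) :
    M.functor.obj (ModuleCat.of K (Fin m → K)) →ₗ[K] M.functor.obj (ModuleCat.of K (Fin k → K)) :=
  M.extend (V := ModuleCat.of K (Fin m → K)) (onBasis w)

theorem mapPi_piUnit {m n : ℕ} (f : (Fin m → K) →ₗ[K] (Fin n → K)) (v : Fin m → K) :
    mapPi M.functor f (piUnit M m v) = piUnit M n (f v) :=
  M.extend_unit (V := ModuleCat.of K (Fin m → K)) (W := ModuleCat.of K (Fin n → K))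
    (piUnit M n ∘ₗ f) v

theorem diagMap_single {n : ℕ} (z : Fin n → K) (j : Fin n) :
    diagMap z (Pi.single j 1) = z j • (Pi.single j 1 : Fin n → K) := by
  ext l
  by_cases hl : l = j
  · subst hl; simp [diagMap]
  · simp [diagMap, hl]

theorem mapPi_subst {m k : ℕ} (w : Fin m → M.functor.obj (ModuleCat.of K (Fin k → K)))
    (f : (Fin k → K) →ₗ[K] (Fin k → K)) (g : Fin m → K)
    (hw : ∀ j, mapPi M.functor f (w j) = g j • w j)
    (p : M.functor.obj (ModuleCat.of K (Fin m → K))) :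
    mapPi M.functor f (subst M w p) = subst M w (mapPi M.functor (diagMap g) p) := by
  have h1 := M.extend_extend (U := ModuleCat.of K (Fin m → K)) (V := ModuleCat.of K (Fin k → K))
    (W := ModuleCat.of K (Fin k → K)) (onBasis w) (piUnit M k ∘ₗ f) p
  have h2 := M.extend_extend (U := ModuleCat.of K (Fin m → K)) (V := ModuleCat.of K (Fin m → K))
    (W := ModuleCat.of K (Fin k → K)) (piUnit M m ∘ₗ diagMap g) (onBasis w) p
  refine h1.trans (Eq.trans ?_ h2.symm)
  refine LinearMap.congr_fun (congrArg _ ?_) p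
  refine LinearMap.pi_ext' fun j => LinearMap.ext_ring ?_
  have h3 : mapPi M.functor f (onBasis w (Pi.single j (1 : K))) = subst M w (piUnit M m
      (diagMap g (Pi.single j 1))) := by
    rw [onBasis_single, diagMap_single, map_smul, map_smul, hw]
    have h4 : subst M w (piUnit M m (Pi.single j 1)) = onBasis w (Pi.single j (1 : K)) :=
      M.extend_unit (V := ModuleCat.of K (Fin m → K)) (W := ModuleCat.of K (Fin k → K)) _ _
    rw [h4, onBasis_single]
  exact h3

/-- The substitution in `p ∘_i q`: the values at the basis vectors of `K^m`, where the variable `i`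
is replaced by `q` in its new variables and the other variables are renumbered. -/
def substValue {m n k : ℕ} (h : k + 1 = m + n) (i : Fin m)
    (q : M.functor.obj (ModuleCat.of K (Fin n → K))) (j : Fin m) :
    M.functor.obj (ModuleCat.of K (Fin k → K)) :=
  if hj : j = i then
    mapPi M.functor (onBasis fun l => (Pi.single (innerIdx h i l) (1 : K) : Fin k → K)) q
  else piUnit M k (Pi.single (outerIdx h i ⟨j, hj⟩) 1)

theorem subst_mem {m n k : ℕ} (h : k + 1 = m + n) (i : Fin m)
    (p : multilinear M.functor m) (q : multilinear M.functor n) :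
    subst M (substValue M h i q.1) p.1 ∈ multilinear M.functor k := by
  intro z hz
  have hw : ∀ j, mapPi M.functor (diagMap z) (substValue M h i q.1 j) =
      (if hj : j = i then ∏ l, z (innerIdx h i l) else z (outerIdx h i ⟨j, hj⟩)) •
        substValue M h i q.1 j := by
    intro j
    by_cases hj : j = i
    · rw [show substValue M h i q.1 j =
        mapPi M.functor (onBasis fun l => (Pi.single (innerIdx h i l) (1 : K) : Fin k → K)) q.1
        from dif_pos hj,
        dif_pos hj]
      have h1 : diagMap z ∘ₗ onBasis (fun l => (Pi.single (innerIdx h i l) (1 : K) : Fin k → K)) =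
          onBasis (fun l => (Pi.single (innerIdx h i l) (1 : K) : Fin k → K)) ∘ₗ
            diagMap fun l => z (innerIdx h i l) := by
        refine LinearMap.pi_ext' fun l => LinearMap.ext_ring ?_
        change diagMap z (onBasis _ (Pi.single l (1 : K))) =
          onBasis _ (diagMap _ (Pi.single l (1 : K)))
        rw [diagMap_single, map_smul, onBasis_single, diagMap_single]
      rw [← LinearMap.comp_apply, ← mapPi_comp, h1, mapPi_comp, LinearMap.comp_apply,
        q.2 _ (fun l => hz _), map_smul]
    · rw [show substValue M h i q.1 j = piUnit M k (Pi.single (outerIdx h i ⟨j, hj⟩) (1 : K))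
        from dif_neg hj, dif_neg hj, mapPi_piUnit, diagMap_single, map_smul]
  rw [mapPi_subst M _ _ _ hw, p.2 _ ?_, map_smul]
  · congr 1
    rw [Fintype.prod_eq_mul_prod_subtype_ne _ i, ← (Equiv.ofBijective _ (bijective_idx h i)).prod_comp,
      Fintype.prod_sum_type, mul_comm]
    congr 1
    · refine Fintype.prod_congr _ _ fun j => ?_
      rw [dif_neg j.2]
      rfl
    · simp
  · intro j
    split_ifs with hj
    · exact Finset.prod_ne_zero_iff.2 fun l _ => hz _
    · exact hz _

/-- The composition `p ∘_i q` of the operad of multilinear elements. -/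
def partialComp {m n k : ℕ} (h : k + 1 = m + n) (i : Fin m) (p : (symSeq M.functor).obj m)
    (q : (symSeq M.functor).obj n) : (symSeq M.functor).obj k :=
  (⟨subst M (substValue M h i q.1) p.1, subst_mem M h i p q⟩ : multilinear M.functor k)

theorem piUnit_mem (z : Fin 1 → K) :
    mapPi M.functor (diagMap z) (piUnit M 1 (Pi.single 0 1)) =
      (∏ i, z i) • piUnit M 1 (Pi.single 0 1) := by
  rw [mapPi_piUnit, diagMap_single, map_smul]
  simp

/-- The unit of the operad of multilinear elements: the single variable. -/
def operadUnit : (symSeq M.functor).obj 1 :=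
  (⟨piUnit M 1 (Pi.single 0 1), fun z _ => piUnit_mem M z⟩ : multilinear M.functor 1)

/-- The operad `P` of multilinear elements is cyclic: the actions of `𝔖_n` on `P(n)` extend to
actions `ρ n` of `𝔖_{n+1}`, the permutations of the output `0` and the inputs `1, …, n`, such that
the cycles `c : 0 ↦ 1 ↦ ⋯ ↦ n ↦ 0` fix the unit and satisfy
`c (p ∘_i q) = (c p) ∘_{i+1} q` if `i` is not the last input of `p` and
`c (p ∘_i q) = (c q) ∘_{first} (c p)` if `i` is the last input of `p` and `q` has an input. -/
def IsCyclicOperad : Prop :=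
  ∃ ρ : ∀ n, Representation K (Equiv.Perm (Fin (n + 1))) ((symSeq M.functor).obj n),
    (∀ n σ, ρ n (symEmbedding n σ) = (symSeq M.functor).rep n σ) ∧
    ρ 1 (finRotate 2) (operadUnit M) = operadUnit M ∧
    (∀ (m n k : ℕ) (h : k + 1 = m + n) (i i' : Fin m), i'.val = i.val + 1 → ∀ p q,
      ρ k (finRotate (k + 1)) (partialComp M h i p q) =
        partialComp M h i' (ρ m (finRotate (m + 1)) p) q) ∧
    (∀ (m n k : ℕ) (h : k + 1 = m + n) (h' : k + 1 = n + m) (i : Fin m) (j : Fin n),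
      i.val + 1 = m → j.val = 0 → ∀ p q,
      ρ k (finRotate (k + 1)) (partialComp M h i p q) =
        partialComp M h' j (ρ n (finRotate (n + 1)) q) (ρ m (finRotate (m + 1)) p))

end SymmetricSequences

end JordanCyclic

end

open JordanCyclic

/-!
All four families of algebras carry a *rerooting* operation. A monomial in a free algebra is a planar
or abstract tree with one root and with leaves labelled by the generators; rerooting makes one of the
leaves the new root. For `f : V → F(W)` put `Δ_f(a)(m) ∈ F(W) ⊗ V`, for `a ∈ F(V)` and `m ∈ F(W)`, the
sum over all leaves `v` of `a` of the tree with new root `v`, in which `m` is attached at the old root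
and `f` is applied to the other leaves. It is determined by `Δ_f(v)(m) = m ⊗ v` and, writing `â` for
the element of `F(W)` obtained from `a` by the substitution `f`, by the product rules

* `Δ_f(ab)(m) = Δ_f(a)(b̂ m) + Δ_f(b)(m â)` in the associative case,
* `Δ_f(ab)(m) = Δ_f(a)(b̂ m) + Δ_f(b)(â m)` in the Jordan case.

In the Jordan case its existence amounts to the fact that `A × Hom(A, P)` with the product
`(a, φ)(b, ψ) = (ab, φ(b ·) + ψ(a ·))` is a Jordan algebra if `A` is one (`jordan_dual`). In the tensor
algebra it is constructed in the same way, and it preserves the subspaces `T`, `SJ` and `CJ`: for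
`SJ` by the product rule for `a ∘ b`, for `CJ` by averaging over the involution `σ`.

The structure `Rerooting` collects what the theorem needs. Besides the compatibility of `Δ` with
substitutions, this is a skew-symmetric bracket `br` on `F(V)` with values in `G(V)` that extends `Θ`,
spans `G(V)` and satisfies `br a m = -Θ(Δ a m)` (cyclic invariance of the bracket), and the
injectivity of `Θ` on `ΣF(V) ⊗ V`. The four parts of the theorem follow from this structure alone:

1. An element of weight one of `G(K x₀ ⊕ V)` is a sum of brackets `br a b` with `a` of weight zero and
  `b` of weight one in `x₀`, and such a bracket is `-Θ(Δ a b)`, with `Δ a b ∈ ΣF(V) ⊗ V`. Hence `Θ` is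
  surjective (`suspensionMap_bijective`).
2. The map `a ↦ a ⊗ x₀ + Δ(a)(x₀)` is an isomorphism from `F(V)` to the elements of weight one of
  `Ker Θ` (`functorIso`): by injectivity an element of `Ker Θ` of weight one is determined by its
  coefficient at `x₀`.
3. By 2, the multilinear part of `F(K^n)` is isomorphic to that of `(Ker Θ)(K^{n+1})`, on which
  `𝔖_{n+1}` acts by permutation matrices (`cyclicRep`).
4. In this action the cycle `c` acts by rerooting at the last variable (`cyclicRep_finRotate`). The
  identities for `c(p ∘_i q)` are then cases of the chain rule for `Δ` of a substitution
  (`rotate_substMap`, `rotate_substMap_last`).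

The injectivity of `Θ` is shown by explicit left inverses: for commutators in the tensor algebra
`commInv`, which reroots at the letters to the right of `x₀` only, and for `𝓑J` the map
`{a, b} ↦ Δ(b₀)(a₁) - Δ(a₀)(b₁)` of `exists_bracketB_inv`, where the indices denote the components of
weights zero and one in `x₀`. Sums of inner derivations of `SJ` and `CJ` are reduced to sums of
commutators, which are zero if they are central. Components of given weight are extracted from the
polynomial functions `z ↦ F(x₀ ↦ z x₀) a`.
-/

noncomputable section

namespace JordanCyclic

/-! ### Polynomial functions with values in a vector space -/

section Polynomial

variable {K : Type u} [Field K] {X Y Z : Type u} [AddCommGroup X] [Module K X]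
  [AddCommGroup Y] [Module K Y] [AddCommGroup Z] [Module K Z]

/-- The value at `z` of the polynomial `∑ z ^ k • c k` with coefficients in a vector space. -/
def evalPoly (X : Type u) [AddCommGroup X] [Module K X] (z : K) : (ℕ →₀ X) →ₗ[K] X :=
  Finsupp.lsum K fun k => z ^ k • LinearMap.id

theorem evalPoly_single (z : K) (k : ℕ) (x : X) :
    evalPoly X z (Finsupp.single k x) = z ^ k • x := by
  simp [evalPoly]

theorem map_evalPoly (f : X →ₗ[K] Y) (z : K) (c : ℕ →₀ X) :
    f (evalPoly X z c) = evalPoly Y z (Finsupp.mapRange.linearMap f c) := by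
  induction c using Finsupp.induction_linear with
  | zero => simp
  | add c d hc hd => simp only [map_add, hc, hd]
  | single k x => simp [evalPoly_single]

/-- The substitution `z ↦ w z` in a polynomial. -/
theorem exists_rescale (w : K) (c : ℕ →₀ X) :
    ∃ d : ℕ →₀ X, (∀ k, d k = w ^ k • c k) ∧ ∀ z, evalPoly X z d = evalPoly X (w * z) c := by
  induction c using Finsupp.induction_linear with
  | zero => exact ⟨0, by simp, by simp⟩
  | add c c' hc hc' =>
    obtain ⟨d, h1, h2⟩ := hc
    obtain ⟨d', h1', h2'⟩ := hc'
    exact ⟨d + d', fun k => by simp [h1, h1'], fun z => by simp [h2, h2']⟩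
  | single k x =>
    refine ⟨Finsupp.single k (w ^ k • x), fun j => ?_, fun z => ?_⟩
    · by_cases h : k = j
      · subst h; simp
      · simp [Finsupp.single_eq_of_ne' h]
    · simp [evalPoly_single, smul_smul, mul_pow, mul_comm]

/-- A polynomial with vector coefficients is determined by its values away from `0`. -/
theorem eq_zero_of_evalPoly_eq_zero [CharZero K] (c : ℕ →₀ X)
    (h : ∀ z : K, z ≠ 0 → evalPoly X z c = 0) : c = 0 := by
  have : Infinite K := CharZero.infinite K
  ext k
  let b := Module.Basis.ofVectorSpace K X
  refine b.ext_elem fun i => ?_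
  let P : Polynomial K := ∑ k ∈ c.support, Polynomial.monomial k (b.repr (c k) i)
  have hP : ∀ z, P.eval z = b.repr (evalPoly X z c) i := fun z => by
    simp [P, Polynomial.eval_finsetSum, evalPoly, Finsupp.lsum_apply, Finsupp.sum, mul_comm,
      Finsupp.finsetSum_apply]
  have hinf : {z : K | z ≠ 0}.Infinite := (Set.finite_singleton (0 : K)).infinite_compl
  have h0 : P = 0 := Polynomial.eq_zero_of_infinite_isRoot P (hinf.mono fun z hz => by
    simp [Polynomial.IsRoot, hP, h z hz])
  have h1 : P.coeff k = b.repr (c k) i := by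
    simp only [P, Polynomial.finsetSum_coeff, Polynomial.coeff_monomial]
    rw [Finset.sum_ite_eq']
    split_ifs with hk
    · rfl
    · simp [Finsupp.notMem_support_iff.1 hk]
  rw [← h1, h0]
  simp

/-- The polynomial functions `z ↦ ∑ z ^ k • x k` with `x k ∈ S k` for all `k`. -/
def polyIn (S : ℕ → Submodule K X) : Submodule K (K → X) :=
  Submodule.span K {φ | ∃ k, ∃ x ∈ S k, φ = fun z => z ^ k • x}

theorem pow_smul_mem_polyIn {S : ℕ → Submodule K X} (k : ℕ) {x : X} (hx : x ∈ S k) :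
    (fun z : K => z ^ k • x) ∈ polyIn S :=
  Submodule.subset_span ⟨k, x, hx, rfl⟩

theorem const_mem_polyIn {S : ℕ → Submodule K X} {x : X} (hx : x ∈ S 0) :
    (fun _ : K => x) ∈ polyIn S := by
  simpa using pow_smul_mem_polyIn 0 hx

theorem mem_polyIn_iff {S : ℕ → Submodule K X} {φ : K → X} :
    φ ∈ polyIn S ↔ ∃ c : ℕ →₀ X, (∀ k, c k ∈ S k) ∧ ∀ z, φ z = evalPoly X z c := by
  constructor
  · intro h
    induction h using Submodule.span_induction with
    | mem φ h =>
      obtain ⟨k, x, hx, rfl⟩ := h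
      refine ⟨Finsupp.single k x, fun j => ?_, fun z => (evalPoly_single z k x).symm⟩
      rw [Finsupp.single_apply]
      split_ifs with hj
      · exact hj ▸ hx
      · exact zero_mem _
    | zero => exact ⟨0, fun _ => zero_mem _, fun z => by simp⟩
    | add φ ψ _ _ h1 h2 =>
      obtain ⟨c, hc, hc'⟩ := h1
      obtain ⟨d, hd, hd'⟩ := h2
      exact ⟨c + d, fun k => add_mem (hc k) (hd k), fun z => by simp [hc', hd']⟩
    | smul t φ _ h1 =>
      obtain ⟨c, hc, hc'⟩ := h1
      exact ⟨t • c, fun k => Submodule.smul_mem _ _ (hc k), fun z => by simp [hc']⟩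
  · rintro ⟨c, hc, h⟩
    have h' : φ = ∑ k ∈ c.support, fun z : K => z ^ k • c k := by
      ext z
      simp [h, evalPoly, Finsupp.lsum_apply, Finsupp.sum]
    rw [h']
    exact Submodule.sum_mem _ fun k _ => pow_smul_mem_polyIn k (hc k)

/-- Polynomial functions and a bilinear map that is compatible with the given filtrations of
coefficients. -/
theorem polyIn_bilinear {S : ℕ → Submodule K X} {S' : ℕ → Submodule K Y}
    {S'' : ℕ → Submodule K Z} (B : X →ₗ[K] Y →ₗ[K] Z)
    (hB : ∀ i j, ∀ x ∈ S i, ∀ y ∈ S' j, B x y ∈ S'' (i + j)) {φ : K → X} {ψ : K → Y}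
    (hφ : φ ∈ polyIn S) (hψ : ψ ∈ polyIn S') : (fun z => B (φ z) (ψ z)) ∈ polyIn S'' := by
  induction hφ using Submodule.span_induction with
  | mem φ h =>
    obtain ⟨i, x, hx, rfl⟩ := h
    induction hψ using Submodule.span_induction with
    | mem ψ h =>
      obtain ⟨j, y, hy, rfl⟩ := h
      convert pow_smul_mem_polyIn (i + j) (hB i j x hx y hy) using 2 with z
      simp [smul_smul, pow_add, mul_comm]
    | zero => simp only [Pi.zero_apply, map_zero]; exact zero_mem _
    | add φ ψ _ _ h1 h2 => simp only [Pi.add_apply, map_add]; exact add_mem h1 h2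
    | smul t φ _ h1 =>
      convert Submodule.smul_mem _ t h1 using 1
      ext z
      simp
  | zero => simp only [Pi.zero_apply, map_zero, LinearMap.zero_apply]; exact zero_mem _
  | add φ ψ _ _ h1 h2 =>
    simp only [Pi.add_apply, map_add, LinearMap.add_apply]; exact add_mem h1 h2
  | smul t φ _ h1 =>
    simp only [Pi.smul_apply, map_smul, LinearMap.smul_apply]; exact Submodule.smul_mem _ t h1

/-- The product of two polynomials with vector coefficients, up to first order. -/
theorem exists_bilinear_evalPoly (B : X →ₗ[K] Y →ₗ[K] Z) (c : ℕ →₀ X) (d : ℕ →₀ Y) :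
    ∃ e : ℕ →₀ Z, (∀ z : K, B (evalPoly X z c) (evalPoly Y z d) = evalPoly Z z e) ∧
      e 0 = B (c 0) (d 0) ∧ e 1 = B (c 0) (d 1) + B (c 1) (d 0) := by
  induction c using Finsupp.induction_linear with
  | zero => exact ⟨0, by simp, by simp, by simp⟩
  | add c c' hc hc' =>
    obtain ⟨e, h1, h2, h3⟩ := hc
    obtain ⟨e', h1', h2', h3'⟩ := hc'
    refine ⟨e + e', fun z => by simp [h1, h1'], by simp [h2, h2'], ?_⟩
    simp only [Finsupp.add_apply, h3, h3', map_add, LinearMap.add_apply]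
    abel
  | single i x =>
    induction d using Finsupp.induction_linear with
    | zero => exact ⟨0, by simp, by simp, by simp⟩
    | add d d' hd hd' =>
      obtain ⟨e, h1, h2, h3⟩ := hd
      obtain ⟨e', h1', h2', h3'⟩ := hd'
      refine ⟨e + e', fun z => by simp [h1, h1'], by simp [h2, h2'], ?_⟩
      simp only [Finsupp.add_apply, h3, h3', map_add]
      abel
    | single j y =>
      refine ⟨Finsupp.single (i + j) (B x y), fun z => ?_, ?_, ?_⟩
      · simp [evalPoly_single, smul_smul, pow_add, mul_comm]
      · rcases i with _ | i <;> rcases j with _ | j <;> simp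
      · rcases i with _ | _ | i <;> rcases j with _ | _ | j <;> simp [Finsupp.single_apply]
        omega

variable [CharZero K]

theorem evalPoly_ext {c d : ℕ →₀ X} (h : ∀ z : K, z ≠ 0 → evalPoly X z c = evalPoly X z d) :
    c = d :=
  sub_eq_zero.1 (eq_zero_of_evalPoly_eq_zero (c - d) fun z hz => by rw [map_sub, h z hz, sub_self])

/-- A polynomial function in `polyIn S` that is homogeneous of degree `n` has its coefficient in
`S n`. -/
theorem mem_of_homogeneous {S : ℕ → Submodule K X} {φ : K → X} (hφ : φ ∈ polyIn S) (n : ℕ) {x : X}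
    (h : ∀ z : K, z ≠ 0 → φ z = z ^ n • x) : x ∈ S n := by
  obtain ⟨c, hc, hc'⟩ := mem_polyIn_iff.1 hφ
  have h1 : c = Finsupp.single n x := evalPoly_ext fun z hz => by
    rw [← hc', h z hz, evalPoly_single]
  simpa [h1] using hc n

/-- A polynomial function that is constant away from `0` is constant. -/
theorem eval_zero_of_const {S : ℕ → Submodule K X} {φ : K → X} (hφ : φ ∈ polyIn S) {x : X}
    (h : ∀ z : K, z ≠ 0 → φ z = x) : φ 0 = x := by
  obtain ⟨c, -, hc'⟩ := mem_polyIn_iff.1 hφ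
  have h1 : c = Finsupp.single 0 x := evalPoly_ext fun z hz => by
    rw [← hc', h z hz, evalPoly_single, pow_zero, one_smul]
  rw [hc', h1, evalPoly_single, pow_zero, one_smul]

/-- A polynomial function with values in a subspace has its coefficients in this subspace. -/
theorem coeff_mem_of_forall_mem (N : Submodule K X) {c : ℕ →₀ X}
    (h : ∀ z : K, z ≠ 0 → evalPoly X z c ∈ N) (k : ℕ) : c k ∈ N := by
  have h1 : Finsupp.mapRange.linearMap N.mkQ c = 0 := eq_zero_of_evalPoly_eq_zero _ fun z hz => by
    rw [← map_evalPoly]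
    exact (Submodule.Quotient.mk_eq_zero N).2 (h z hz)
  have h2 := DFunLike.congr_fun h1 k
  exact (Submodule.Quotient.mk_eq_zero N).1 h2

theorem polyIn_of_subtype (N : Submodule K X) {φ : K → N}
    (h : (fun z => (φ z : X)) ∈ polyIn fun _ => (⊤ : Submodule K X)) :
    φ ∈ polyIn fun _ => (⊤ : Submodule K N) := by
  obtain ⟨c, -, hc⟩ := mem_polyIn_iff.1 h
  have hN : ∀ k, c k ∈ N := coeff_mem_of_forall_mem N fun z _ => by rw [← hc]; exact (φ z).2
  have h' : φ = ∑ k ∈ c.support, fun z : K => z ^ k • (⟨c k, hN k⟩ : N) := by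
    ext z
    simp [hc, evalPoly, Finsupp.lsum_apply, Finsupp.sum]
  rw [h']
  exact Submodule.sum_mem _ fun k _ => pow_smul_mem_polyIn k trivial

/-- The linear coefficient of the polynomial functions `z ↦ Φ z y`, as a function of `y`. -/
theorem exists_linearCoeff (Φ : K → Y →ₗ[K] X)
    (h : ∀ y, (fun z => Φ z y) ∈ polyIn fun _ => (⊤ : Submodule K X)) :
    ∃ p : Y →ₗ[K] X, ∀ y (c : ℕ →₀ X), (∀ z, Φ z y = evalPoly X z c) → p y = c 1 := by
  choose c _ hc using fun y => mem_polyIn_iff.1 (h y)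
  refine ⟨{ toFun := fun y => c y 1, map_add' := fun x y => ?_, map_smul' := fun t y => ?_ }, ?_⟩
  · have : c (x + y) = c x + c y := evalPoly_ext fun z _ => by
      rw [map_add, ← hc, ← hc, ← hc, map_add]
    simp [this]
  · have : c (t • y) = t • c y := evalPoly_ext fun z _ => by
      rw [map_smul, ← hc, ← hc, map_smul]
    simp [this]
  · intro y d hd
    have : c y = d := evalPoly_ext fun z _ => by rw [← hc, hd]
    exact congrArg (· 1) this

end Polynomial

/-! ### Slices of tensors -/

section Slice

variable {K : Type u} [Field K] {X Y V W : Type u} [AddCommGroup X] [Module K X]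
  [AddCommGroup Y] [Module K Y] [AddCommGroup V] [Module K V] [AddCommGroup W] [Module K W]

/-- The contraction `X ⊗ V → X` with a linear form on `V`. -/
def slice (X : Type u) [AddCommGroup X] [Module K X] (ξ : V →ₗ[K] K) : X ⊗[K] V →ₗ[K] X :=
  (TensorProduct.rid K X).toLinearMap ∘ₗ ξ.lTensor X

@[simp] theorem slice_tmul (ξ : V →ₗ[K] K) (x : X) (v : V) : slice X ξ (x ⊗ₜ v) = ξ v • x := by
  simp [slice]

theorem slice_rTensor (ξ : V →ₗ[K] K) (f : X →ₗ[K] Y) (t : X ⊗[K] V) :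
    slice Y ξ (f.rTensor V t) = f (slice X ξ t) := by
  induction t with
  | zero => simp
  | add a b ha hb => simp only [map_add, ha, hb]
  | tmul x v => simp

theorem slice_lTensor (ξ : W →ₗ[K] K) (g : V →ₗ[K] W) (t : X ⊗[K] V) :
    slice X ξ (g.lTensor X t) = slice X (ξ ∘ₗ g) t := by
  induction t with
  | zero => simp
  | add a b ha hb => simp only [map_add, ha, hb]
  | tmul x v => simp

theorem slice_map (ξ : W →ₗ[K] K) (f : X →ₗ[K] Y) (g : V →ₗ[K] W) (t : X ⊗[K] V) :
    slice Y ξ (TensorProduct.map f g t) = f (slice X (ξ ∘ₗ g) t) := by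
  induction t with
  | zero => simp
  | add a b ha hb => simp only [map_add, ha, hb]
  | tmul x v => simp

theorem slice_smul (c : K) (ξ : V →ₗ[K] K) (t : X ⊗[K] V) :
    slice X (c • ξ) t = c • slice X ξ t := by
  simp [slice]

theorem slice_zero (t : X ⊗[K] V) : slice X (0 : V →ₗ[K] K) t = 0 := by
  simp [slice]

/-- A tensor whose slices lie in a subspace `N` of `X` comes from `N ⊗ V`. -/
theorem mem_range_rTensor_subtype (N : Submodule K X) (t : X ⊗[K] V)
    (h : ∀ ξ : V →ₗ[K] K, slice X ξ t ∈ N) : t ∈ LinearMap.range (N.subtype.rTensor V) := by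
  classical
  let b := Module.Basis.ofVectorSpace K V
  have ht : t = ((TensorProduct.equivFinsuppOfBasisRight b) t).sum fun i x => x ⊗ₜ b i := by
    rw [← TensorProduct.equivFinsuppOfBasisRight_symm_apply, LinearEquiv.symm_apply_apply]
  have hc : ∀ i, TensorProduct.equivFinsuppOfBasisRight b t i = slice X (b.coord i) t := fun i => by
    clear ht h
    induction t with
    | zero => simp
    | add a b ha hb => simp only [map_add, Finsupp.add_apply, ha, hb]
    | tmul x v => simp
  rw [ht]
  refine Submodule.sum_mem _ fun i _ => ?_
  rw [hc]
  exact ⟨(⟨_, h (b.coord i)⟩ : N) ⊗ₜ b i, by simp⟩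

end Slice

/-! ### The rerooting calculus of a free algebra -/

section Rerooting

variable {K : Type u} [Field K]

/-- The linear map of free algebras induced by a linear map of the generating spaces. -/
def FreeAlg.fmap (M : FreeAlg K) {V W : ModuleCat.{u} K} (f : V →ₗ[K] W) : M.obj V →ₗ[K] M.obj W :=
  M.bind (M.ι W ∘ₗ f)

theorem FreeAlg.bind_apply_ι (M : FreeAlg K) {V W : ModuleCat.{u} K} (f : V →ₗ[K] M.obj W) (v : V) :
    M.bind f (M.ι V v) = f v :=
  LinearMap.congr_fun (M.bind_ι f) v

theorem FreeAlg.bind_apply_bind (M : FreeAlg K) {U V W : ModuleCat.{u} K} (f : U →ₗ[K] M.obj V)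
    (g : V →ₗ[K] M.obj W) (a : M.obj U) : M.bind g (M.bind f a) = M.bind (M.bind g ∘ₗ f) a :=
  LinearMap.congr_fun (M.bind_bind f g) a

theorem FreeAlg.fmap_ι (M : FreeAlg K) {V W : ModuleCat.{u} K} (f : V →ₗ[K] W) (v : V) :
    M.fmap f (M.ι V v) = M.ι W (f v) :=
  M.bind_apply_ι _ v

theorem FreeAlg.fmap_comp_ι (M : FreeAlg K) {V W : ModuleCat.{u} K} (f : V →ₗ[K] W) :
    M.fmap f ∘ₗ M.ι V = M.ι W ∘ₗ f :=
  M.bind_ι _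

theorem FreeAlg.bind_fmap (M : FreeAlg K) {U V W : ModuleCat.{u} K} (f : U →ₗ[K] V)
    (g : V →ₗ[K] M.obj W) (a : M.obj U) : M.bind g (M.fmap f a) = M.bind (g ∘ₗ f) a := by
  rw [FreeAlg.fmap, M.bind_apply_bind, ← LinearMap.comp_assoc, M.bind_ι]

theorem FreeAlg.fmap_fmap (M : FreeAlg K) {U V W : ModuleCat.{u} K} (f : U →ₗ[K] V)
    (g : V →ₗ[K] W) (a : M.obj U) : M.fmap g (M.fmap f a) = M.fmap (g ∘ₗ f) a :=
  M.bind_fmap f _ a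

theorem FreeAlg.fmap_id (M : FreeAlg K) {V : ModuleCat.{u} K} (a : M.obj V) :
    M.fmap (LinearMap.id : V →ₗ[K] V) a = a :=
  LinearMap.congr_fun (M.bind_unit V) a

/-- A triple `(F, G, Θ)`, for the functor `F` of free algebras of some kind, together with the
operation of rerooting. An element `a` of the free algebra on `V`, in which elements `f v` of a free
algebra on `W` are substituted for the generators `v`, is a sum of trees with leaves in `V`;
`Δ f a m` is the sum over all leaves `v` of the terms `(the tree turned into one with root v and
with m attached at the former root) ⊗ v`. The bracket `br` is a bilinear skew-symmetric extension of
`Θ`, which rerooting expresses through `Θ`. The field `inj` is the injectivity of the suspension of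
`Θ`. -/
structure Rerooting (M : FreeAlg K) {G : ModuleCat.{u} K ⥤ ModuleCat.{u} K}
    (Θ : tensorId M.functor ⟶ G) where
  Δ : ∀ {V W : ModuleCat.{u} K}, (V →ₗ[K] M.obj W) →
    (M.obj V →ₗ[K] M.obj W →ₗ[K] M.obj W ⊗[K] V)
  Δ_ι : ∀ {V W : ModuleCat.{u} K} (f : V →ₗ[K] M.obj W) (v : V) (m : M.obj W),
    Δ f (M.ι V v) m = m ⊗ₜ v
  Δ_bind : ∀ {U V W : ModuleCat.{u} K} (f : U →ₗ[K] M.obj V) (g : V →ₗ[K] M.obj W) (a : M.obj U)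
    (m : M.obj W),
    Δ g (M.bind f a) m = TensorProduct.lift ((Δ g ∘ₗ f).flip) (Δ (M.bind g ∘ₗ f) a m)
  bind_Δ : ∀ {U V W : ModuleCat.{u} K} (f : U →ₗ[K] M.obj V) (g : V →ₗ[K] M.obj W) (a : M.obj U)
    (m : M.obj V), (M.bind g).rTensor U (Δ f a m) = Δ (M.bind g ∘ₗ f) a (M.bind g m)
  poly : ∀ {V W : ModuleCat.{u} K} (f g : V →ₗ[K] W) (a : M.obj V),
    (fun z : K => M.fmap (f + z • g) a) ∈ polyIn fun _ => (⊤ : Submodule K (M.obj W))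
  br : ∀ V : ModuleCat.{u} K, M.obj V →ₗ[K] M.obj V →ₗ[K] G.obj V
  br_ι : ∀ {V : ModuleCat.{u} K} (a : M.obj V) (v : V),
    br V a (M.ι V v) = thetaAt Θ V ((a : M.functor.obj V) ⊗ₜ v)
  br_swap : ∀ {V : ModuleCat.{u} K} (a b : M.obj V), br V a b = - br V b a
  br_map : ∀ {V W : ModuleCat.{u} K} (f : V ⟶ W) (a b : M.obj V),
    (G.map f).hom (br V a b) = br W (M.fmap f.hom a) (M.fmap f.hom b)
  br_span : ∀ {V : ModuleCat.{u} K} (x : G.obj V),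
    x ∈ Submodule.span K {y | ∃ a b : M.obj V, y = br V a b}
  br_Δ : ∀ {V : ModuleCat.{u} K} (a m : M.obj V),
    br V a m = - thetaAt Θ V (Δ (M.ι V) a m : M.obj V ⊗[K] V)
  inj : ∀ (V : ModuleCat.{u} K), Function.Injective (suspensionMap Θ V)
  finite : ∀ n, Module.Finite K (multilinear M.functor n)

namespace Rerooting

variable {M : FreeAlg K} {G : ModuleCat.{u} K ⥤ ModuleCat.{u} K} {Θ : tensorId M.functor ⟶ G}
  (R : Rerooting M Θ)

/-- The linear map `F(V) ⊗ V → G(V)`. -/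
def θ (_ : Rerooting M Θ) (V : ModuleCat.{u} K) : M.obj V ⊗[K] V →ₗ[K] G.obj V := thetaAt Θ V

theorem θ_map {V W : ModuleCat.{u} K} (f : V ⟶ W) (t : M.obj V ⊗[K] V) :
    (G.map f).hom (R.θ V t) = R.θ W (TensorProduct.map (M.fmap f.hom) f.hom t) :=
  thetaAt_naturality Θ f t

theorem fmap_Δ {U V W : ModuleCat.{u} K} (f : U →ₗ[K] M.obj V) (g : V →ₗ[K] W) (a : M.obj U)
    (m : M.obj V) :
    (M.fmap g).rTensor U (R.Δ f a m) = R.Δ (M.fmap g ∘ₗ f) a (M.fmap g m) :=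
  R.bind_Δ f _ a m

theorem Δ_fmap {U V W : ModuleCat.{u} K} (f : U →ₗ[K] V) (g : V →ₗ[K] M.obj W) (a : M.obj U)
    (m : M.obj W) : R.Δ g (M.fmap f a) m = f.lTensor (M.obj W) (R.Δ (g ∘ₗ f) a m) := by
  rw [FreeAlg.fmap, R.Δ_bind, ← LinearMap.comp_assoc f (M.ι V) (M.bind g), M.bind_ι]
  refine LinearMap.congr_fun ?_ _
  refine TensorProduct.ext' fun m u => ?_
  simp [R.Δ_ι]

/-! Weights with respect to `x₀`. -/

/-- The elements of weight `k` in `x₀` of the free algebra on `K x₀ ⊕ V`. -/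
def _root_.JordanCyclic.FreeAlg.weight (M : FreeAlg K) (V : ModuleCat.{u} K) (k : ℕ) :
    Submodule K (M.obj (addPoint V)) where
  carrier := {a | ∀ z : K, z ≠ 0 → M.fmap (scalePoint V z).hom a = z ^ k • a}
  add_mem' ha hb z hz := by rw [map_add, ha z hz, hb z hz, smul_add]
  zero_mem' z _ := by rw [map_zero, smul_zero]
  smul_mem' c a ha z hz := by rw [map_smul, ha z hz, smul_comm]

theorem scalePoint_eq (V : ModuleCat.{u} K) (z : K) : (scalePoint V z).hom =
    LinearMap.inr K K V ∘ₗ LinearMap.snd K K V +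
      z • (LinearMap.inl K K V ∘ₗ LinearMap.fst K K V) := by
  ext <;> simp [scalePoint]

theorem scale_mem_polyIn (R : Rerooting M Θ) (V : ModuleCat.{u} K) (a : M.obj (addPoint V)) :
    (fun z : K => M.fmap (scalePoint V z).hom a) ∈ polyIn fun _ =>
      (⊤ : Submodule K (M.obj (addPoint V))) := by
  simp_rw [scalePoint_eq]
  exact R.poly (W := addPoint V) (V := addPoint V) _ _ a

variable [CharZero K]

/-- Every element is a sum of elements of weights `k ≥ 0`. -/
theorem scale_mem_polyIn_weight (R : Rerooting M Θ) (V : ModuleCat.{u} K)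
    (a : M.obj (addPoint V)) :
    (fun z : K => M.fmap (scalePoint V z).hom a) ∈ polyIn (M.weight V) := by
  obtain ⟨c, -, hc⟩ := mem_polyIn_iff.1 (R.scale_mem_polyIn V a)
  refine mem_polyIn_iff.2 ⟨c, fun k w hw => ?_, hc⟩
  obtain ⟨d, hd, hd'⟩ := exists_rescale w c
  have h1 : Finsupp.mapRange.linearMap (M.fmap (scalePoint V w).hom) c = d :=
    evalPoly_ext fun z _ => by
      have h2 : (scalePoint V w).hom ∘ₗ (scalePoint V z).hom = (scalePoint V (w * z)).hom := by
        ext <;> simp [scalePoint]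
      rw [← map_evalPoly, hd', ← hc, ← hc, M.fmap_fmap, h2]
  rw [← hd, ← h1]
  rfl

/-- Elements of weight zero in `x₀` do not depend on `x₀`. -/
theorem eq_fmap_of_weight_zero (R : Rerooting M Θ) {V : ModuleCat.{u} K} {a : M.obj (addPoint V)}
    (h : ∀ z : K, z ≠ 0 → M.fmap (scalePoint V z).hom a = a) :
    a = M.fmap (W := addPoint V) (LinearMap.inr K K V)
      (M.fmap (V := addPoint V) (LinearMap.snd K K V) a) := by
  have h1 := eval_zero_of_const (R.scale_mem_polyIn V a) h
  rw [scalePoint_eq, zero_smul, add_zero] at h1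
  rw [M.fmap_fmap]
  exact h1.symm

end Rerooting
end Rerooting

/-! ### Cyclic triples and the kernel of `Θ` -/

section KernelFunctor

variable {K : Type u} [Field K] {F G : ModuleCat.{u} K ⥤ ModuleCat.{u} K}

theorem tensorId_map_mem_ker (Θ : tensorId F ⟶ G) {V W : ModuleCat.{u} K} (f : V ⟶ W) :
    ∀ t ∈ LinearMap.ker (thetaAt Θ V),
      TensorProduct.map (F.map f).hom f.hom t ∈ LinearMap.ker (thetaAt Θ W) := by
  intro t ht
  rw [LinearMap.mem_ker] at ht ⊢
  rw [← thetaAt_naturality, ht, map_zero]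

/-- The functor `V ↦ Ker (F(V) ⊗ V → G(V))`. -/
def kerFunctor (Θ : tensorId F ⟶ G) : ModuleCat.{u} K ⥤ ModuleCat.{u} K where
  obj V := ModuleCat.of K (LinearMap.ker (thetaAt Θ V))
  map {V W} f := ModuleCat.ofHom
    ((TensorProduct.map (F.map f).hom f.hom).restrict (tensorId_map_mem_ker Θ f))
  map_id V := by
    ext1
    refine LinearMap.ext fun t => Subtype.ext ?_
    change TensorProduct.map (F.map (𝟙 V)).hom (𝟙 V : V ⟶ V).hom t.1 = t.1
    simp
  map_comp f g := by
    ext1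
    refine LinearMap.ext fun t => Subtype.ext ?_
    change TensorProduct.map (F.map (f ≫ g)).hom (f ≫ g).hom t.1 =
      TensorProduct.map (F.map g).hom g.hom (TensorProduct.map (F.map f).hom f.hom t.1)
    simp [TensorProduct.map_comp]

/-- The inclusion of the pointwise kernel. -/
def kerFunctorι (Θ : tensorId F ⟶ G) : kerFunctor Θ ⟶ tensorId F where
  app V := ModuleCat.ofHom (LinearMap.ker (thetaAt Θ V)).subtype
  naturality _ _ _ := rfl

theorem kerFunctorι_comp (Θ : tensorId F ⟶ G) : kerFunctorι Θ ≫ Θ = 0 := by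
  ext V : 2
  ext1
  exact LinearMap.ext fun t => t.2

/-- The pointwise kernel is the kernel in the category of functors. -/
def kerFunctorIsLimit (Θ : tensorId F ⟶ G) :
    Limits.IsLimit (Limits.KernelFork.ofι (kerFunctorι Θ) (kerFunctorι_comp Θ)) :=
  Limits.KernelFork.IsLimit.ofι _ _
    (fun {H} g hg =>
      { app := fun V => ModuleCat.ofHom ((g.app V).hom.codRestrict (LinearMap.ker (thetaAt Θ V))
          fun x => LinearMap.congr_fun (congrArg (fun τ : H ⟶ G => (τ.app V).hom) hg) x)
        naturality := fun V W f => by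
          ext1
          refine LinearMap.ext fun x => Subtype.ext ?_
          exact LinearMap.congr_fun (congrArg ModuleCat.Hom.hom (g.naturality f)) x })
    (fun g hg => by
      ext V : 2
      rfl)
    (fun g hg m hm => by
      ext V : 2
      ext1
      refine LinearMap.ext fun x => Subtype.ext ?_
      exact LinearMap.congr_fun (congrArg (fun τ : _ ⟶ tensorId F => (τ.app V).hom) hm) x)

/-- The categorical kernel of `Θ` is the pointwise kernel. -/
def kernelIsoKerFunctor (Θ : tensorId F ⟶ G) : Limits.kernel Θ ≅ kerFunctor Θ :=
  (Limits.kernelIsKernel Θ).conePointUniqueUpToIso (kerFunctorIsLimit Θ)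

/-- The morphism of suspensions induced by a morphism of functors. -/
def suspensionHom (τ : F ⟶ G) : suspension F ⟶ suspension G where
  app V := ModuleCat.ofHom ((τ.app (addPoint V)).hom.restrict (p := weightOne F V)
    (q := weightOne G V) fun v hv z hz => by
      have h := LinearMap.congr_fun (congrArg ModuleCat.Hom.hom (τ.naturality (scalePoint V z))) v
      have h' : (τ.app (addPoint V)).hom ((F.map (scalePoint V z)).hom v) =
        (G.map (scalePoint V z)).hom ((τ.app (addPoint V)).hom v) := h
      rw [← h', hv z hz, map_smul])
  naturality V W f := by
    ext1
    refine LinearMap.ext fun x => Subtype.ext ?_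
    exact LinearMap.congr_fun (congrArg ModuleCat.Hom.hom (τ.naturality (addPointMap f))) x.1

/-- Isomorphic functors have isomorphic suspensions. -/
def suspensionIso (e : F ≅ G) : suspension F ≅ suspension G where
  hom := suspensionHom e.hom
  inv := suspensionHom e.inv
  hom_inv_id := by
    ext V : 2
    ext1
    refine LinearMap.ext fun x => Subtype.ext ?_
    exact LinearMap.congr_fun (congrArg (fun τ => (τ.app (addPoint V)).hom) e.hom_inv_id) x.1
  inv_hom_id := by
    ext V : 2
    ext1
    refine LinearMap.ext fun x => Subtype.ext ?_
    exact LinearMap.congr_fun (congrArg (fun τ => (τ.app (addPoint V)).hom) e.inv_hom_id) x.1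

end KernelFunctor

namespace Rerooting

variable {K : Type u} [Field K] {M : FreeAlg K} {G : ModuleCat.{u} K ⥤ ModuleCat.{u} K}
  {Θ : tensorId M.functor ⟶ G} (R : Rerooting M Θ)

/-- The element of `Ker Θ` that corresponds to an element `a` of the free algebra on `V`, for a
map `s : V → W` and a new generator `w`: the sum of `a ⊗ w` and of all rerootings of `a` whose
former root becomes the leaf `w`. -/
def expand {V W : ModuleCat.{u} K} (s : V →ₗ[K] W) (w : W) : M.obj V →ₗ[K] M.obj W ⊗[K] W :=
  (TensorProduct.mk K (M.obj W) W).flip w ∘ₗ M.fmap s +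
    s.lTensor (M.obj W) ∘ₗ (R.Δ (M.ι W ∘ₗ s)).flip (M.ι W w)

theorem expand_apply {V W : ModuleCat.{u} K} (s : V →ₗ[K] W) (w : W) (a : M.obj V) :
    R.expand s w a =
      M.fmap s a ⊗ₜ w + s.lTensor (M.obj W) (R.Δ (M.ι W ∘ₗ s) a (M.ι W w)) :=
  rfl

theorem expand_smul {V W : ModuleCat.{u} K} (s : V →ₗ[K] W) (c : K) (w : W) (a : M.obj V) :
    R.expand s (c • w) a = c • R.expand s w a := by
  simp only [expand_apply, map_smul, TensorProduct.tmul_smul, smul_add]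

/-- This is the cyclic invariance of the bracket, applied to `br a w`. -/
theorem θ_expand {V W : ModuleCat.{u} K} (s : V →ₗ[K] W) (w : W) (a : M.obj V) :
    R.θ W (R.expand s w a) = 0 := by
  have h1 := R.br_Δ (M.fmap s a) (M.ι W w)
  rw [R.br_ι, R.Δ_fmap] at h1
  rw [expand_apply, map_add]
  exact add_eq_zero_iff_eq_neg.2 h1

theorem map_expand {V W W' : ModuleCat.{u} K} (s : V →ₗ[K] W) (k : W →ₗ[K] W') (w : W)
    (a : M.obj V) :
    TensorProduct.map (M.fmap k) k (R.expand s w a) = R.expand (k ∘ₗ s) (k w) a := by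
  rw [expand_apply, expand_apply, map_add, TensorProduct.map_tmul, M.fmap_fmap, ← M.fmap_ι,
    ← LinearMap.comp_assoc s k (M.ι W'), ← M.fmap_comp_ι k, LinearMap.comp_assoc s (M.ι W),
    ← R.fmap_Δ]
  congr 1
  generalize R.Δ (M.ι W ∘ₗ s) a (M.ι W w) = t
  induction t with
  | zero => simp
  | add x y hx hy => simp only [map_add, hx, hy]
  | tmul x v => simp

theorem expand_fmap {U V W : ModuleCat.{u} K} (r : U →ₗ[K] V) (s : V →ₗ[K] W) (w : W)
    (a : M.obj U) : R.expand s w (M.fmap r a) = R.expand (s ∘ₗ r) w a := by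
  rw [expand_apply, expand_apply, M.fmap_fmap, R.Δ_fmap, ← LinearMap.comp_apply,
    ← LinearMap.lTensor_comp, LinearMap.comp_assoc]

theorem slice_expand {V W : ModuleCat.{u} K} (s : V →ₗ[K] W) (w : W) (ξ : W →ₗ[K] K)
    (a : M.obj V) : slice (M.obj W) ξ (R.expand s w a) =
      ξ w • M.fmap s a + slice (M.obj W) (ξ ∘ₗ s) (R.Δ (M.ι W ∘ₗ s) a (M.ι W w)) := by
  rw [expand_apply, map_add, slice_tmul, slice_lTensor]

/-- The coefficient of the new generator recovers `a`. -/
theorem slice_expand_eq {V W : ModuleCat.{u} K} (s : V →ₗ[K] W) (w : W) (ξ : W →ₗ[K] K)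
    (π : W →ₗ[K] V) (hξ : ξ ∘ₗ s = 0) (hw : ξ w = 1) (hπ : π ∘ₗ s = LinearMap.id) (a : M.obj V) :
    M.fmap π (slice (M.obj W) ξ (R.expand s w a)) = a := by
  rw [slice_expand, hξ, hw, slice_zero, one_smul, add_zero, M.fmap_fmap, hπ, M.fmap_id]

/-- The element `R.expand s w a` of `Ker Θ`. -/
def toKer {V W : ModuleCat.{u} K} (s : V →ₗ[K] W) (w : W) :
    M.obj V →ₗ[K] LinearMap.ker (thetaAt Θ W) :=
  (R.expand s w).codRestrict (LinearMap.ker (thetaAt Θ W)) (R.θ_expand s w)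

theorem toKer_mem_weightOne (V : ModuleCat.{u} K) (a : M.obj V) :
    R.toKer (W := addPoint V) (LinearMap.inr K K V) (1, 0) a ∈ weightOne (kerFunctor Θ) V := by
  intro z _
  refine Subtype.ext ((R.map_expand _ _ _ _).trans ?_)
  have hinr : (scalePoint V z).hom ∘ₗ LinearMap.inr K K V = LinearMap.inr K K V := by
    ext <;> simp [scalePoint]
  have hpt : (scalePoint V z).hom (1, 0) = z • ((1, 0) : K × V) := by simp [scalePoint]
  rw [hinr, hpt]
  exact R.expand_smul _ z _ a

/-! The suspension of `Θ` is bijective. -/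

/-- The tensors in `F(K x₀ ⊕ V) ⊗ V` of weight one in `x₀` come from `ΣF(V) ⊗ V`. -/
theorem mem_range_of_weight_one {V : ModuleCat.{u} K} (t : M.obj (addPoint V) ⊗[K] V)
    (h : ∀ z : K, z ≠ 0 → (M.fmap (scalePoint V z).hom).rTensor V t = z • t) :
    t ∈ LinearMap.range ((weightOne M.functor V).subtype.rTensor V) := by
  refine mem_range_rTensor_subtype (X := M.obj (addPoint V)) (weightOne M.functor V) t
    fun ξ z hz => ?_
  exact (slice_rTensor ξ (M.fmap (scalePoint V z).hom) t).symm.trans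
    ((congrArg _ (h z hz)).trans (map_smul _ z t))

theorem map_subtype_eq {X V W : Type u} [AddCommGroup X] [Module K X] [AddCommGroup V] [Module K V]
    [AddCommGroup W] [Module K W] (N : Submodule K X) (g : V →ₗ[K] W) (t : N ⊗[K] V) :
    TensorProduct.map N.subtype g t = g.lTensor X (N.subtype.rTensor V t) := by
  rw [← LinearMap.comp_apply, LinearMap.lTensor_comp_rTensor]

variable [CharZero K]

/-- The bracket of an element of weight zero and an element `b` of weight one lies in the image of
`ΣF(V) ⊗ V`, since rerooting the former produces elements with leaves in `V` to which `b` is attached. -/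
theorem br_mem_range {V : ModuleCat.{u} K} {a b : M.obj (addPoint V)} (ha : a ∈ M.weight V 0)
    (hb : b ∈ M.weight V 1) : R.br (addPoint V) a b ∈ LinearMap.range
      (thetaAt Θ (addPoint V) ∘ₗ
        TensorProduct.map (weightOne M.functor V).subtype (LinearMap.inr K K V)) := by
  have ha' := R.eq_fmap_of_weight_zero (V := V) (a := a) fun z hz => by
    rw [ha z hz, pow_zero, one_smul]
  generalize M.fmap (V := addPoint V) (LinearMap.snd K K V) a = a' at ha'
  obtain ⟨t, ht⟩ := mem_range_of_weight_one (M := M)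
    (R.Δ (W := addPoint V) (M.ι (addPoint V) ∘ₗ LinearMap.inr K K V) a' b) fun z hz => by
      have h1 : (scalePoint V z).hom ∘ₗ LinearMap.inr K K V = LinearMap.inr K K V := by
        ext <;> simp [scalePoint]
      rw [R.fmap_Δ, ← LinearMap.comp_assoc, M.fmap_comp_ι, LinearMap.comp_assoc, h1, hb z hz,
        pow_one, map_smul]
  refine ⟨-t, ?_⟩
  rw [R.br_Δ, ha', R.Δ_fmap (W := addPoint V), ← ht, map_neg]
  congr 1
  exact congrArg (thetaAt Θ (addPoint V)) (map_subtype_eq _ _ t)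

/-- `Θ` is injective on `ΣF(V) ⊗ V` by assumption. For surjectivity, `S` records that coefficients of
degree one lie in the image `N`; no condition is imposed in other degrees. -/
theorem suspensionMap_bijective (R : Rerooting M Θ) (V : ModuleCat.{u} K) :
    Function.Bijective (suspensionMap Θ V) := by
  refine ⟨R.inj V, fun x => ?_⟩
  let N : Submodule K (G.obj (addPoint V)) := LinearMap.range
    (thetaAt Θ (addPoint V) ∘ₗ
      TensorProduct.map (weightOne M.functor V).subtype (LinearMap.inr K K V))
  let S : ℕ → Submodule K (G.obj (addPoint V)) := fun k => if k = 1 then N else ⊤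
  have hB : ∀ i j, ∀ a ∈ M.weight V i, ∀ b ∈ M.weight V j,
      R.br (addPoint V) a b ∈ S (i + j) := by
    intro i j a ha b hb
    by_cases h : i + j = 1
    · simp only [S, if_pos h]
      obtain ⟨rfl, rfl⟩ | ⟨rfl, rfl⟩ : (i = 0 ∧ j = 1) ∨ (i = 1 ∧ j = 0) := by omega
      · exact R.br_mem_range ha hb
      · rw [R.br_swap]
        exact neg_mem (R.br_mem_range hb ha)
    · simp [S, h]
  have h1 : ∀ y : G.obj (addPoint V),
      (fun z : K => (G.map (scalePoint V z)).hom y) ∈ polyIn S := by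
    intro y
    induction R.br_span y using Submodule.span_induction with
    | mem y hy =>
      obtain ⟨a, b, rfl⟩ := hy
      simp only [R.br_map]
      exact polyIn_bilinear (R.br (addPoint V)) hB (R.scale_mem_polyIn_weight V a)
        (R.scale_mem_polyIn_weight V b)
    | zero => simp only [map_zero]; exact zero_mem _
    | add y y' _ _ h h' => simp only [map_add]; exact add_mem h h'
    | smul c y _ h => simp only [map_smul]; exact Submodule.smul_mem _ c h
  obtain ⟨t, ht⟩ : (x : G.obj (addPoint V)) ∈ N := by
    have h2 := mem_of_homogeneous (h1 x.1) 1 (x := x.1) fun z hz => by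
      rw [pow_one]; exact x.2 z hz
    simpa [S] using h2
  exact ⟨t, Subtype.ext ht⟩

theorem isCyclicTriple (R : Rerooting M Θ) : IsCyclicTriple Θ :=
  fun D => R.suspensionMap_bijective (ModuleCat.of K (Fin D → K))

/-! The functor of free algebras is the suspension of the kernel of `Θ`. -/

/-- An element of weight one of `Ker Θ` on `K x₀ ⊕ V` is determined by its coefficient `a ⊗ x₀`. -/
theorem exists_expand_eq {V : ModuleCat.{u} K} (t : M.obj (addPoint V) ⊗[K] addPoint V)
    (h0 : R.θ (addPoint V) t = 0)
    (h1 : ∀ z : K, z ≠ 0 →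
      TensorProduct.map (M.fmap (scalePoint V z).hom) (scalePoint V z).hom t = z • t) :
    ∃ a : M.obj V, R.expand (W := addPoint V) (LinearMap.inr K K V) (1, 0) a = t := by
  have hfst : ∀ z : K, LinearMap.fst K K V ∘ₗ (scalePoint V z).hom = z • LinearMap.fst K K V :=
    fun z => by ext <;> simp [scalePoint]
  have hsnd : ∀ z : K, LinearMap.snd K K V ∘ₗ (scalePoint V z).hom = LinearMap.snd K K V :=
    fun z => by ext <;> simp [scalePoint]
  have hinr : ∀ z : K, (scalePoint V z).hom ∘ₗ LinearMap.inr K K V = LinearMap.inr K K V :=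
    fun z => by ext <;> simp [scalePoint]
  have hpt : ∀ z : K, (scalePoint V z).hom (1, 0) = z • ((1, 0) : K × V) := fun z => by
    simp [scalePoint]
  have hdec : ∀ t : M.obj (addPoint V) ⊗[K] addPoint V,
      t = slice (M.obj (addPoint V)) (LinearMap.fst K K V) t ⊗ₜ ((1, 0) : K × V) +
        (LinearMap.inr K K V).lTensor _ ((LinearMap.snd K K V).lTensor _ t) := by
    intro t
    induction t with
    | zero => simp
    | add x y hx hy =>
      simp only [map_add, TensorProduct.add_tmul]
      nth_rewrite 1 [hx, hy]
      abel
    | tmul x v =>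
      rw [slice_tmul, TensorProduct.smul_tmul, LinearMap.lTensor_tmul, LinearMap.lTensor_tmul,
        ← TensorProduct.tmul_add]
      congr 1
      ext <;> simp
  have hm := R.eq_fmap_of_weight_zero (V := V)
    (a := slice (M.obj (addPoint V)) (LinearMap.fst K K V) t) fun z hz => by
      have h2 := congrArg (slice (M.obj (addPoint V)) (LinearMap.fst K K V)) (h1 z hz)
      rw [slice_map, hfst, slice_smul, map_smul, map_smul] at h2
      exact smul_right_injective _ hz h2
  generalize M.fmap (V := addPoint V) (LinearMap.snd K K V)
    (slice (M.obj (addPoint V)) (LinearMap.fst K K V) t) = a at hm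
  refine ⟨a, (sub_eq_zero.1 ?_).symm⟩
  have hd0 : slice (M.obj (addPoint V)) (LinearMap.fst K K V)
      (t - R.expand (W := addPoint V) (LinearMap.inr K K V) (1, 0) a) = 0 := by
    rw [map_sub, slice_expand, hm, LinearMap.fst_comp_inr, slice_zero]
    simp
  have hd1 : ∀ z : K, z ≠ 0 → TensorProduct.map (M.fmap (scalePoint V z).hom) (scalePoint V z).hom
      (t - R.expand (W := addPoint V) (LinearMap.inr K K V) (1, 0) a) =
      z • (t - R.expand (W := addPoint V) (LinearMap.inr K K V) (1, 0) a) := by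
    intro z hz
    rw [map_sub, h1 z hz, map_expand, hinr, hpt, smul_sub]
    congr 1
    exact R.expand_smul _ z _ a
  have hd2 : R.θ (addPoint V)
      (t - R.expand (W := addPoint V) (LinearMap.inr K K V) (1, 0) a) = 0 := by
    rw [map_sub, h0, θ_expand, sub_zero]
  generalize t - R.expand (W := addPoint V) (LinearMap.inr K K V) (1, 0) a = d at hd0 hd1 hd2
  obtain ⟨s, hs⟩ := mem_range_of_weight_one (M := M)
    ((LinearMap.snd K K V).lTensor (M.obj (addPoint V)) d) fun z hz => by
      rw [← map_smul, ← hd1 z hz, ← LinearMap.comp_apply, ← LinearMap.comp_apply,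
        LinearMap.rTensor_comp_lTensor, LinearMap.lTensor_comp_map, hsnd]
  have hd : d = (LinearMap.inr K K V).lTensor _ ((LinearMap.snd K K V).lTensor _ d) := by
    conv_lhs => rw [hdec d]
    rw [hd0, TensorProduct.zero_tmul, zero_add]
  -- the difference has no term at `x₀`, hence lies in `ΣF(V) ⊗ V`, where `Θ` is injective
  have hs0 : s = 0 := by
    apply R.inj V
    rw [map_zero]
    apply Subtype.ext
    refine (congrArg (thetaAt Θ (addPoint V)) (map_subtype_eq _ _ s)).trans ?_
    refine Eq.trans ?_ hd2
    rw [hd]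
    exact congrArg (fun t => thetaAt Θ (addPoint V) ((LinearMap.inr K K V).lTensor _ t)) hs
  rw [hd, ← hs, hs0]
  exact (congrArg _ (map_zero _)).trans (map_zero _)

/-- The isomorphism of the free algebra on `V` with the elements of weight one of `Ker Θ`. -/
def expandEquiv (V : ModuleCat.{u} K) : M.obj V ≃ₗ[K] weightOne (kerFunctor Θ) V :=
  LinearEquiv.ofBijective
    ((R.toKer (W := addPoint V) (LinearMap.inr K K V) (1, 0)).codRestrict
      (weightOne (kerFunctor Θ) V) (R.toKer_mem_weightOne V)) <| by
    constructor
    · intro a b hab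
      have h : R.expand (W := addPoint V) (LinearMap.inr K K V) (1, 0) a =
          R.expand (W := addPoint V) (LinearMap.inr K K V) (1, 0) b :=
        congrArg (fun x : weightOne (kerFunctor Θ) V => (Subtype.val x).val) hab
      have hs := R.slice_expand_eq (W := addPoint V) (LinearMap.inr K K V) (1, 0)
        (LinearMap.fst K K V) (LinearMap.snd K K V) (LinearMap.fst_comp_inr K K V) rfl
        (LinearMap.snd_comp_inr K K V)
      rw [← hs a, ← hs b, h]
    · rintro ⟨⟨t, ht⟩, ht1⟩
      obtain ⟨a, ha⟩ := R.exists_expand_eq t ht fun z hz => congrArg Subtype.val (ht1 z hz)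
      exact ⟨a, Subtype.ext (Subtype.ext ha)⟩

/-- The functor of free algebras is isomorphic to the suspension of `Ker Θ`. -/
def functorIso : M.functor ≅ suspension (Limits.kernel Θ) :=
  (NatIso.ofComponents (fun V => (R.expandEquiv V).toModuleIso) (fun {V W} f => by
    ext1
    refine LinearMap.ext fun a => Subtype.ext (Subtype.ext ?_)
    refine Eq.trans ?_ (R.map_expand (W := addPoint V) (W' := addPoint W) (LinearMap.inr K K V)
      (addPointMap f).hom (1, 0) a).symm
    refine (R.expand_fmap (W := addPoint W) f.hom (LinearMap.inr K K W) (1, 0) a).trans ?_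
    have h1 : (addPointMap f).hom ∘ₗ LinearMap.inr K K V = LinearMap.inr K K W ∘ₗ f.hom := by
      ext <;> simp [addPointMap]
    have h2 : (addPointMap f).hom (1, 0) = ((1, 0) : K × W) := by simp [addPointMap]
    rw [h1, h2]) : M.functor ≅ suspension (kerFunctor Θ)) ≪≫
  suspensionIso (kernelIsoKerFunctor Θ).symm

end Rerooting

/-! ### The cyclic operad of multilinear elements -/

section Basis

variable {K : Type u} [Field K]

/-- The space `K^n` as an object. -/
abbrev piObj (K : Type u) [Field K] (n : ℕ) : ModuleCat.{u} K :=
  ModuleCat.of K (Fin n → K)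

theorem pi_linearMap_ext {n : ℕ} {X : Type u} [AddCommGroup X] [Module K X]
    {f g : (Fin n → K) →ₗ[K] X} (h : ∀ j, f (Pi.single j 1) = g (Pi.single j 1)) : f = g :=
  LinearMap.pi_ext' fun j => LinearMap.ext_ring (h j)

/-- The inclusion `e_j ↦ e_{j+1}` of `K^n` in `K^{n+1}`. -/
def shiftMap (K : Type u) [Field K] (n : ℕ) : (Fin n → K) →ₗ[K] (Fin (n + 1) → K) :=
  onBasis fun j => Pi.single j.succ 1

/-- The projection of `K^{n+1}` to `K^n` that forgets the coordinate `0`. -/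
def unshiftMap (K : Type u) [Field K] (n : ℕ) : (Fin (n + 1) → K) →ₗ[K] (Fin n → K) :=
  LinearMap.funLeft K K Fin.succ

/-- The nilpotent map `e_0 ↦ e_1 ↦ ⋯ ↦ e_{n-1} ↦ 0` of `K^n`. -/
def nextMap (K : Type u) [Field K] (n : ℕ) : (Fin n → K) →ₗ[K] (Fin n → K) :=
  onBasis fun j => if h : j.val + 1 < n then Pi.single ⟨j.val + 1, h⟩ 1 else 0

theorem shiftMap_single {n : ℕ} (j : Fin n) :
    shiftMap K n (Pi.single j 1) = Pi.single j.succ 1 :=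
  onBasis_single _ j

theorem unshiftMap_single_succ {n : ℕ} (j : Fin n) :
    unshiftMap K n (Pi.single j.succ 1) = Pi.single j 1 := by
  ext l
  simp [unshiftMap, LinearMap.funLeft_apply, Pi.single_apply]

theorem unshiftMap_single_zero {n : ℕ} : unshiftMap K n (Pi.single 0 1) = 0 := by
  ext l
  simp [unshiftMap, LinearMap.funLeft_apply]

theorem unshiftMap_comp_shiftMap (n : ℕ) :
    unshiftMap K n ∘ₗ shiftMap K n = LinearMap.id :=
  pi_linearMap_ext fun j => by simp [shiftMap_single, unshiftMap_single_succ]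

theorem proj_zero_comp_shiftMap (n : ℕ) :
    (LinearMap.proj 0 : (Fin (n + 1) → K) →ₗ[K] K) ∘ₗ shiftMap K n = 0 :=
  pi_linearMap_ext fun j => by simp [shiftMap_single]

theorem nextMap_single {n : ℕ} (j j' : Fin n) (h : j'.val = j.val + 1) :
    nextMap K n (Pi.single j 1) = Pi.single j' 1 := by
  rw [nextMap, onBasis_single, dif_pos (h ▸ j'.2)]
  congr 1
  exact Fin.ext h.symm

theorem nextMap_single_last {n : ℕ} (j : Fin n) (h : j.val + 1 = n) :
    nextMap K n (Pi.single j 1) = 0 := by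
  rw [nextMap, onBasis_single, dif_neg (by omega)]

theorem diagMap_comp_shiftMap {n : ℕ} (z : Fin (n + 1) → K) :
    diagMap z ∘ₗ shiftMap K n = shiftMap K n ∘ₗ diagMap fun j => z j.succ :=
  pi_linearMap_ext fun j => by simp [shiftMap_single, diagMap_single]

theorem permMap_symEmbedding_comp_shiftMap {n : ℕ} (σ : Equiv.Perm (Fin n)) :
    permMap (symEmbedding n σ) ∘ₗ shiftMap K n = shiftMap K n ∘ₗ permMap σ :=
  pi_linearMap_ext fun j => by simp [shiftMap_single, permMap_single, symEmbedding_succ]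

theorem finRotate_succ_of_last {n : ℕ} (i : Fin n) (hi : i.val + 1 = n) :
    finRotate (n + 1) i.succ = 0 := by
  have : i.succ = Fin.last n := Fin.ext (by simpa using hi)
  rw [this, finRotate_last]

theorem finRotate_succ_of_lt {n : ℕ} (j j' : Fin n) (h : j'.val = j.val + 1) :
    finRotate (n + 1) j.succ = j'.succ := by
  rw [show j.succ = ⟨j.val + 1, by omega⟩ from rfl, finRotate_of_lt (by omega)]
  exact Fin.ext (by simp [h])

theorem finRotate_zero_eq {n : ℕ} (i : Fin n) (hi : i.val = 0) :
    finRotate (n + 1) 0 = i.succ := by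
  rw [show (0 : Fin (n + 1)) = ⟨0, by omega⟩ from rfl, finRotate_of_lt (by omega)]
  exact Fin.ext (by simp [hi])

theorem unshift_rotate_shift (n : ℕ) :
    unshiftMap K n ∘ₗ permMap (finRotate (n + 1)) ∘ₗ shiftMap K n = nextMap K n :=
  pi_linearMap_ext fun j => by
    simp only [LinearMap.comp_apply, shiftMap_single, permMap_single]
    by_cases h : j.val + 1 < n
    · rw [finRotate_succ_of_lt j ⟨j.val + 1, h⟩ rfl, unshiftMap_single_succ,
        nextMap_single j ⟨j.val + 1, h⟩ rfl]
    · rw [finRotate_succ_of_last j (by omega), unshiftMap_single_zero,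
        nextMap_single_last j (by omega)]

theorem proj_rotate_shift {n : ℕ} (i : Fin n) (hi : i.val + 1 = n) :
    (LinearMap.proj 0 : (Fin (n + 1) → K) →ₗ[K] K) ∘ₗ
      permMap (finRotate (n + 1)) ∘ₗ shiftMap K n = LinearMap.proj i :=
  pi_linearMap_ext fun j => by
    simp only [LinearMap.comp_apply, shiftMap_single, permMap_single]
    by_cases h : j.val + 1 < n
    · rw [finRotate_succ_of_lt j ⟨j.val + 1, h⟩ rfl]
      have : i ≠ j := fun h' => by subst h'; omega
      simp [this]
    · have : j = i := Fin.ext (by omega)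
      rw [finRotate_succ_of_last j (by omega), this]
      simp

end Basis

namespace Rerooting

variable {K : Type u} [Field K] {M : FreeAlg K} {G : ModuleCat.{u} K ⥤ ModuleCat.{u} K}
  {Θ : tensorId M.functor ⟶ G} (R : Rerooting M Θ)

/-- The element of `Ker Θ` on `K^{n+1}` that corresponds to an element of the free algebra on
`K^n`, the new generator being `e_0`. -/
def expandShift (n : ℕ) : M.obj (piObj K n) →ₗ[K] M.obj (piObj K (n + 1)) ⊗[K] piObj K (n + 1) :=
  R.expand (shiftMap K n) (Pi.single 0 1)

/-- The expansion multiplies weights by the weight of the new generator `e_0`, which occurs once. -/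
theorem map_expandShift_diag {n : ℕ} (z : Fin (n + 1) → K) (p : M.obj (piObj K n)) :
    TensorProduct.map (M.fmap (V := piObj K (n + 1)) (W := piObj K (n + 1)) (diagMap z))
      (diagMap z) (R.expandShift n p) =
    z 0 • R.expandShift n
      (M.fmap (V := piObj K n) (W := piObj K n) (diagMap fun j => z j.succ) p) := by
  rw [expandShift, R.map_expand, diagMap_comp_shiftMap, diagMap_single, R.expand_smul]
  congr 1
  exact (R.expand_fmap (U := piObj K n) (V := piObj K n) (W := piObj K (n + 1)) _ _ _ p).symm

theorem map_expandShift_perm {n : ℕ} (σ : Equiv.Perm (Fin n)) (p : M.obj (piObj K n)) :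
    TensorProduct.map
      (M.fmap (V := piObj K (n + 1)) (W := piObj K (n + 1)) (permMap (symEmbedding n σ)))
      (permMap (symEmbedding n σ)) (R.expandShift n p) =
    R.expandShift n (M.fmap (V := piObj K n) (W := piObj K n) (permMap σ) p) := by
  rw [expandShift, R.map_expand, permMap_symEmbedding_comp_shiftMap, permMap_single,
    symEmbedding_zero]
  exact (R.expand_fmap (U := piObj K n) (V := piObj K n) (W := piObj K (n + 1)) _ _ _ p).symm

/-- The coefficient of `e_0` recovers `p`. -/
theorem unshift_slice_expandShift (n : ℕ) (p : M.obj (piObj K n)) :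
    M.fmap (V := piObj K (n + 1)) (W := piObj K n) (unshiftMap K n)
      (slice _ (LinearMap.proj 0) (R.expandShift n p)) = p :=
  R.slice_expand_eq (V := piObj K n) (W := piObj K (n + 1)) (shiftMap K n)
    (Pi.single 0 1) (LinearMap.proj 0) (unshiftMap K n) (proj_zero_comp_shiftMap n)
    (by simp) (unshiftMap_comp_shiftMap n) p

theorem expandShift_injective (n : ℕ) : Function.Injective (R.expandShift n) := by
  intro a b h
  rw [← R.unshift_slice_expandShift n a, ← R.unshift_slice_expandShift n b, h]

/-- The coefficient at `e_0` of a rotated expansion: the cycle turns the last variable `e_i` into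
`e_0`, so that it extracts the term rerooted at `e_i`. The former root `e_0` becomes the first
variable `e_{i₀}`. -/
theorem unshift_slice_finRotate {n : ℕ} (p : M.obj (piObj K n)) (i₀ i : Fin n)
    (h₀ : i₀.val = 0) (hi : i.val + 1 = n) :
    M.fmap (V := piObj K (n + 1)) (W := piObj K n) (unshiftMap K n)
      (slice _ (LinearMap.proj 0) (TensorProduct.map
        (M.fmap (V := piObj K (n + 1)) (W := piObj K (n + 1)) (permMap (finRotate (n + 1))))
        (permMap (finRotate (n + 1))) (R.expandShift n p))) =
      slice (M.obj (piObj K n)) (LinearMap.proj i)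
        (R.Δ (V := piObj K n) (M.ι (piObj K n) ∘ₗ nextMap K n) p
          (M.ι (piObj K n) (Pi.single i₀ 1))) := by
  rw [expandShift, R.map_expand, R.slice_expand, permMap_single, finRotate_zero_eq i₀ h₀]
  have h1 : (LinearMap.proj 0 : (Fin (n + 1) → K) →ₗ[K] K) (Pi.single i₀.succ 1) = 0 := by simp
  have h2 := M.fmap_ι (V := piObj K (n + 1)) (W := piObj K n) (unshiftMap K n)
    (Pi.single i₀.succ 1)
  have h3 := R.fmap_Δ (U := piObj K n) (V := piObj K (n + 1)) (W := piObj K n)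
    (M.ι (piObj K (n + 1)) ∘ₗ permMap (finRotate (n + 1)) ∘ₗ shiftMap K n) (unshiftMap K n) p
    (M.ι (piObj K (n + 1)) (Pi.single i₀.succ 1))
  have h4 : M.fmap (V := piObj K (n + 1)) (W := piObj K n) (unshiftMap K n) ∘ₗ
      M.ι (piObj K (n + 1)) ∘ₗ permMap (finRotate (n + 1)) ∘ₗ shiftMap K n =
      M.ι (piObj K n) ∘ₗ nextMap K n :=
    LinearMap.ext fun v => (M.fmap_ι (V := piObj K (n + 1)) (W := piObj K n) _ _).trans
      (congrArg (M.ι (piObj K n)) (LinearMap.congr_fun (unshift_rotate_shift n) v))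
  rw [h2, unshiftMap_single_succ, h4] at h3
  rw [h1, zero_smul, zero_add, ← slice_rTensor, h3, proj_rotate_shift i hi]

/-- The element `R.expandShift n p` of `Ker Θ`. -/
def expandShiftKer (n : ℕ) :
    M.functor.obj (piObj K n) →ₗ[K] (kerFunctor Θ).obj (piObj K (n + 1)) :=
  (R.expandShift n).codRestrict (LinearMap.ker (thetaAt Θ (piObj K (n + 1))))
    (R.θ_expand (V := piObj K n) (W := piObj K (n + 1)) _ _)

theorem expandShiftKer_mem {n : ℕ} (p : M.functor.obj (piObj K n))
    (hp : p ∈ multilinear M.functor n) :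
    R.expandShiftKer n p ∈ multilinear (kerFunctor Θ) (n + 1) := by
  intro z hz
  have h1 : mapPi (kerFunctor Θ) (diagMap z) (R.expandShiftKer n p) =
      z 0 • R.expandShiftKer n (mapPi M.functor (diagMap fun j => z j.succ) p) :=
    Subtype.ext (R.map_expandShift_diag z p)
  rw [h1, hp _ fun j => hz j.succ, map_smul, smul_smul, Fin.prod_univ_succ]

variable [CharZero K]

/-- Every multilinear element of `Ker Θ` on `K^{n+1}` is the expansion of a multilinear element,
by transport of `exists_expand_eq` along `K^{n+1} ≅ K e_0 ⊕ K^n`. -/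
theorem exists_expandShift_eq {n : ℕ} (t : M.obj (piObj K (n + 1)) ⊗[K] piObj K (n + 1))
    (h0 : R.θ (piObj K (n + 1)) t = 0)
    (h1 : ∀ z : Fin (n + 1) → K, (∀ i, z i ≠ 0) →
      TensorProduct.map (M.fmap (V := piObj K (n + 1)) (W := piObj K (n + 1)) (diagMap z))
        (diagMap z) t = (∏ i, z i) • t) :
    ∃ p : M.obj (piObj K n), (∀ z : Fin n → K, (∀ i, z i ≠ 0) →
      M.fmap (V := piObj K n) (W := piObj K n) (diagMap z) p = (∏ i, z i) • p) ∧
      R.expandShift n p = t := by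
  let e : piObj K (n + 1) →ₗ[K] addPoint (piObj K n) :=
    (LinearMap.proj 0).prod (unshiftMap K n)
  let e' : addPoint (piObj K n) →ₗ[K] piObj K (n + 1) :=
    LinearMap.coprod (LinearMap.toSpanSingleton K _ (Pi.single 0 1)) (shiftMap K n)
  have he : e' ∘ₗ e = LinearMap.id := pi_linearMap_ext fun j => by
    refine Fin.cases ?_ (fun j => ?_) j
    · simp [e, e', unshiftMap_single_zero]
    · simp [e, e', unshiftMap_single_succ, shiftMap_single]
  have hscale : ∀ z : K, (scalePoint (piObj K n) z).hom ∘ₗ e =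
      e ∘ₗ diagMap (Fin.cons z fun _ => 1) := fun z => pi_linearMap_ext fun j => by
    refine Fin.cases ?_ (fun j => ?_) j
    · simp [e, scalePoint, unshiftMap_single_zero, diagMap_single]
    · simp [e, scalePoint, unshiftMap_single_succ, diagMap_single]
  have hmap : ∀ {U V W : ModuleCat.{u} K} (f : U →ₗ[K] V) (g : V →ₗ[K] W) (t : M.obj U ⊗[K] U),
      TensorProduct.map (M.fmap g) g (TensorProduct.map (M.fmap f) f t) =
        TensorProduct.map (M.fmap (g ∘ₗ f)) (g ∘ₗ f) t := by
    intro U V W f g t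
    induction t with
    | zero => simp
    | add x y hx hy => simp only [map_add, hx, hy]
    | tmul x v => simp [M.fmap_fmap]
  have hθ : R.θ (addPoint (piObj K n)) (TensorProduct.map (M.fmap e) e t) = 0 := by
    exact (R.θ_map (V := piObj K (n + 1)) (W := addPoint (piObj K n))
      (ModuleCat.ofHom e) t).symm.trans ((congrArg _ h0).trans (map_zero _))
  obtain ⟨a, ha⟩ := R.exists_expand_eq (V := piObj K n) (TensorProduct.map (M.fmap e) e t) hθ
    fun z hz => by
      have h2 := h1 (Fin.cons z fun _ => 1) (Fin.cases (by simpa using hz) (by simp))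
      rw [Fin.prod_univ_succ] at h2
      simp only [Fin.cons_zero, Fin.cons_succ, Finset.prod_const_one, mul_one] at h2
      rw [hmap, hscale, ← hmap, h2, map_smul]
  have hat : R.expandShift n a = t := by
    have h3 := congrArg (TensorProduct.map (M.fmap e') e') ha
    rw [hmap, he, R.map_expand] at h3
    have h4 : e' ∘ₗ LinearMap.inr K K (Fin n → K) = shiftMap K n := by
      ext; simp [e']
    have h5 : e' (1, 0) = Pi.single 0 1 := by simp [e']
    rw [h4, h5] at h3
    refine h3.trans ?_
    clear h3 ha hθ h0 h1
    induction t with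
    | zero => simp
    | add x y hx hy => rw [map_add, hx, hy]
    | tmul x v => rw [TensorProduct.map_tmul, M.fmap_id, LinearMap.id_apply]
  refine ⟨a, fun z hz => R.expandShift_injective n ?_, hat⟩
  have h6 := R.map_expandShift_diag (Fin.cons 1 z) a
  simp only [Fin.cons_zero, Fin.cons_succ, one_smul] at h6
  rw [← h6, hat, h1 _ (Fin.cases (by simp) (by simpa using hz)), Fin.prod_univ_succ, map_smul, hat]
  simp

/-- The multilinear elements in `n` variables correspond to the multilinear elements of `Ker Θ`
in `n + 1` variables. -/
def multilinearEquiv (n : ℕ) :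
    (symSeq M.functor).obj n ≃ₗ[K] (symSeq (kerFunctor Θ)).obj (n + 1) :=
  LinearEquiv.ofBijective ((R.expandShiftKer n).restrict (p := multilinear M.functor n)
    (q := multilinear (kerFunctor Θ) (n + 1)) fun p hp => R.expandShiftKer_mem p hp) <| by
    constructor
    · intro a b hab
      exact Subtype.ext (R.expandShift_injective n
        (congrArg (fun x : multilinear (kerFunctor Θ) (n + 1) => (Subtype.val x).val) hab))
    · rintro ⟨⟨t, ht⟩, hw⟩
      obtain ⟨p, hp, hpt⟩ := R.exists_expandShift_eq t ht fun z hz =>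
        congrArg Subtype.val (hw z hz)
      exact ⟨⟨p, hp⟩, Subtype.ext (Subtype.ext hpt)⟩

/-- The action of `𝔖_{n+1}` on the multilinear elements in `n` variables. -/
def cyclicRep (n : ℕ) :
    Representation K (Equiv.Perm (Fin (n + 1))) ((symSeq M.functor).obj n) where
  toFun σ := (R.multilinearEquiv n).symm.toLinearMap ∘ₗ (symSeq (kerFunctor Θ)).rep (n + 1) σ ∘ₗ
    (R.multilinearEquiv n).toLinearMap
  map_one' := LinearMap.ext fun p => by simp
  map_mul' σ τ := LinearMap.ext fun p => by simp

theorem multilinearEquiv_cyclicRep {n : ℕ} (σ : Equiv.Perm (Fin (n + 1)))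
    (p : multilinear M.functor n) :
    R.multilinearEquiv n (R.cyclicRep n σ p) =
      (symSeq (kerFunctor Θ)).rep (n + 1) σ (R.multilinearEquiv n p) :=
  (R.multilinearEquiv n).apply_symm_apply _

theorem expandShift_cyclicRep {n : ℕ} (σ : Equiv.Perm (Fin (n + 1)))
    (p : multilinear M.functor n) :
    R.expandShift n (R.cyclicRep n σ p : multilinear M.functor n).1 =
      TensorProduct.map (M.fmap (V := piObj K (n + 1)) (W := piObj K (n + 1)) (permMap σ))
        (permMap σ) (R.expandShift n p.1) :=
  congrArg (fun x : multilinear (kerFunctor Θ) (n + 1) => (Subtype.val x).val)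
    (R.multilinearEquiv_cyclicRep σ p)

theorem cyclicRep_symEmbedding (n : ℕ) (σ : Equiv.Perm (Fin n)) :
    R.cyclicRep n (symEmbedding n σ) = (symSeq M.functor).rep n σ :=
  LinearMap.ext fun p => Subtype.ext <| R.expandShift_injective n <|
    (R.expandShift_cyclicRep (symEmbedding n σ) p).trans (R.map_expandShift_perm σ p.1)

/-- The action of the cycle `0 ↦ 1 ↦ ⋯ ↦ n ↦ 0`: it reroots at the last variable. -/
theorem cyclicRep_finRotate {n : ℕ} (p : multilinear M.functor n) (i₀ i : Fin n)
    (h₀ : i₀.val = 0) (hi : i.val + 1 = n) :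
    (R.cyclicRep n (finRotate (n + 1)) p : multilinear M.functor n).1 =
      slice (M.obj (piObj K n)) (LinearMap.proj i)
        (R.Δ (V := piObj K n) (M.ι (piObj K n) ∘ₗ nextMap K n) p.1
          (M.ι (piObj K n) (Pi.single i₀ 1))) := by
  rw [← R.unshift_slice_expandShift n (R.cyclicRep n (finRotate (n + 1)) p).1,
    R.expandShift_cyclicRep]
  exact R.unshift_slice_finRotate p.1 i₀ i h₀ hi

end Rerooting

/-! ### Rerooting of compositions -/

section Basis

variable {K : Type u} [Field K]

/-- The diagonal matrix with entry `z` at position `i` and all other entries equal to `1`. -/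
def scaleCoord {m : ℕ} (i : Fin m) (z : K) : (Fin m → K) →ₗ[K] (Fin m → K) :=
  diagMap (Function.update 1 i z)

theorem proj_comp_scaleCoord {m : ℕ} (i : Fin m) (z : K) :
    (LinearMap.proj i : (Fin m → K) →ₗ[K] K) ∘ₗ scaleCoord i z = z • LinearMap.proj i := by
  ext
  simp [scaleCoord, diagMap]

theorem prodMap_comp_inr {V W : Type u} [AddCommGroup V] [Module K V] [AddCommGroup W] [Module K W]
    (f : V →ₗ[K] W) :
    (LinearMap.id : K →ₗ[K] K).prodMap f ∘ₗ LinearMap.inr K K V = LinearMap.inr K K W ∘ₗ f := by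
  ext <;> simp

theorem prodMap_scaleCoord {m : ℕ} (i : Fin m) (z : K) :
    (LinearMap.id : K →ₗ[K] K).prodMap (scaleCoord i z) =
      LinearMap.id.prodMap (scaleCoord i 0) + z • (LinearMap.inr K K (Fin m → K) ∘ₗ
        (LinearMap.single K (fun _ => K) i ∘ₗ LinearMap.proj i) ∘ₗ
          LinearMap.snd K K (Fin m → K)) := by
  refine LinearMap.ext fun ⟨t, v⟩ => Prod.ext (by simp) (funext fun j => ?_)
  by_cases hj : j = i
  · subst hj
    simp [scaleCoord, diagMap]
  · simp [scaleCoord, diagMap, hj]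

end Basis

namespace Rerooting

variable {K : Type u} [Field K] {M : FreeAlg K} {G : ModuleCat.{u} K ⥤ ModuleCat.{u} K}
  {Θ : tensorId M.functor ⟶ G} (R : Rerooting M Θ)

/-- The slice of a rerooted composition `Δ g (bind f a) m`, if only the generator `e_i` of `a`
contributes to it. -/
theorem slice_lift_flip {m : ℕ} {V W : ModuleCat.{u} K} (f : (Fin m → K) →ₗ[K] M.obj V)
    (g : V →ₗ[K] M.obj W) (ξ : V →ₗ[K] K) (L : M.obj W →ₗ[K] M.obj W) (i : Fin m)
    (h : ∀ j x, slice (M.obj W) ξ (R.Δ g (f (Pi.single j 1)) x) = if j = i then L x else 0)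
    (t : M.obj W ⊗[K] (Fin m → K)) :
    slice (M.obj W) ξ (TensorProduct.lift ((R.Δ g ∘ₗ f).flip) t) =
      L (slice (M.obj W) (LinearMap.proj i) t) := by
  induction t with
  | zero => simp
  | add x y hx hy => simp only [map_add, hx, hy]
  | tmul x v =>
    have h1 : slice (M.obj W) ξ ∘ₗ (R.Δ g ∘ₗ f).flip x =
        (LinearMap.toSpanSingleton K _ (L x)) ∘ₗ LinearMap.proj i :=
      pi_linearMap_ext fun j => by
        have h2 := h j x
        simp only [LinearMap.comp_apply, LinearMap.flip_apply, LinearMap.proj_apply,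
          LinearMap.toSpanSingleton_apply, Pi.single_apply, ite_smul, one_smul, zero_smul, h2,
          eq_comm (a := i)]
    have h3 := LinearMap.congr_fun h1 v
    rw [slice_tmul, map_smul]
    exact h3

/-- The generator `e_i`, which occurs once in `p`, does not occur in the term of a rerooting of `p`
in which it has become the root. -/
theorem slice_Δ_congr [CharZero K] {m : ℕ} {W : ModuleCat.{u} K} (p : M.obj (piObj K m))
    (i : Fin m) (hp : ∀ z : K, z ≠ 0 →
      M.fmap (V := piObj K m) (W := piObj K m) (scaleCoord i z) p = z • p)
    (f f' : piObj K m →ₗ[K] M.obj W)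
    (hf : ∀ j, j ≠ i → f (Pi.single j 1) = f' (Pi.single j 1)) (x : M.obj W) :
    slice (M.obj W) (LinearMap.proj i) (R.Δ f p x) =
      slice (M.obj W) (LinearMap.proj i) (R.Δ f' p x) := by
  -- `Y` has an additional generator `x₀`, to be substituted by `x`
  let Y : ModuleCat.{u} K := addPoint (piObj K m)
  let s : piObj K m →ₗ[K] Y := LinearMap.inr K K (Fin m → K)
  let E : K → (Y →ₗ[K] Y) := fun z => LinearMap.id.prodMap (scaleCoord i z)
  let a : M.obj Y := slice (M.obj Y) (LinearMap.proj i)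
    (R.Δ (V := piObj K m) (M.ι Y ∘ₗ s) p (M.ι Y (1, 0)))
  have hEs : ∀ z, E z ∘ₗ s = s ∘ₗ scaleCoord i z := fun z => prodMap_comp_inr _
  have ha : ∀ z, z ≠ 0 → M.fmap (E z) a = a := fun z hz => by
    have h2 := R.Δ_fmap (U := piObj K m) (V := piObj K m) (scaleCoord i z)
      (M.ι Y ∘ₗ s) p (M.ι Y (1, 0))
    rw [hp z hz, map_smul] at h2
    have h3 := congrArg (slice (M.obj Y) (LinearMap.proj i)) h2
    rw [slice_lTensor, proj_comp_scaleCoord, slice_smul, LinearMap.smul_apply, map_smul] at h3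
    have h4 := smul_right_injective _ hz h3
    have h5 := R.fmap_Δ (U := piObj K m) (M.ι Y ∘ₗ s) (E z) p (M.ι Y (1, 0))
    have h6 : E z (1, 0) = (1, 0) := Prod.ext rfl (map_zero (scaleCoord i z))
    rw [M.fmap_ι, h6, ← LinearMap.comp_assoc, M.fmap_comp_ι, LinearMap.comp_assoc, hEs] at h5
    change M.fmap (E z) (slice _ _ _) = slice _ _ _
    rw [← slice_rTensor, h5]
    exact h4.symm
  -- `a` does not change if `e_i` is scaled; by continuation to `z = 0` it does not contain `e_i`
  have ha0 : M.fmap (E 0) a = a := by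
    have h1 := R.poly (V := Y) (W := Y) (E 0) (LinearMap.inr K K (Fin m → K) ∘ₗ
      (LinearMap.single K (fun _ => K) i ∘ₗ LinearMap.proj i) ∘ₗ LinearMap.snd K K _) a
    have h2 := eval_zero_of_const h1 fun z hz => by
      rw [← prodMap_scaleCoord i z]
      exact ha z hz
    rwa [zero_smul, add_zero] at h2
  have key : ∀ f : piObj K m →ₗ[K] M.obj W,
      slice (M.obj W) (LinearMap.proj i) (R.Δ f p x) =
        M.bind ((LinearMap.coprod (LinearMap.toSpanSingleton K _ x) f : Y →ₗ[K] M.obj W) ∘ₗ E 0)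
          a := fun f => by
    have h1 := R.bind_Δ (U := piObj K m) (M.ι Y ∘ₗ s)
      (LinearMap.coprod (LinearMap.toSpanSingleton K _ x) f) p (M.ι Y (1, 0))
    have h2 : M.bind (LinearMap.coprod (LinearMap.toSpanSingleton K _ x) f : Y →ₗ[K] M.obj W) ∘ₗ
        M.ι Y ∘ₗ s = f := by
      rw [← LinearMap.comp_assoc, M.bind_ι]
      exact LinearMap.coprod_inr _ _
    have h3 : (LinearMap.coprod (LinearMap.toSpanSingleton K _ x) f : Y →ₗ[K] M.obj W) (1, 0) =
        x := by simp
    rw [h2, M.bind_apply_ι, h3] at h1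
    rw [← M.bind_fmap (U := Y) (V := Y), ha0, ← h1, slice_rTensor]
  rw [key f, key f']
  congr 2
  refine LinearMap.prod_ext (LinearMap.ext_ring ?_) (pi_linearMap_ext fun j => ?_)
  · simp [E, LinearMap.prodMap_apply]
  · have h : E 0 (0, Pi.single j 1) = (0, scaleCoord i 0 (Pi.single j 1)) := rfl
    simp only [LinearMap.comp_apply, LinearMap.inr_apply, h, LinearMap.coprod_apply, map_zero,
      zero_add, scaleCoord, diagMap_single, map_smul]
    by_cases hj : j = i
    · subst hj
      simp
    · rw [hf j hj]

end Rerooting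

section Substitution

variable {K : Type u} [Field K] (M : FreeAlg K)

/-- The linear map `K^n → K^k` that sends the variables of `q` to their positions in `p ∘_i q`. -/
def innerMap (K : Type u) [Field K] {m n k : ℕ} (h : k + 1 = m + n) (i : Fin m) :
    (Fin n → K) →ₗ[K] (Fin k → K) :=
  onBasis fun l => Pi.single (innerIdx h i l) 1

theorem innerMap_single {m n k : ℕ} (h : k + 1 = m + n) (i : Fin m) (l : Fin n) (l' : Fin k)
    (hl : l'.val = i.val + l.val) :
    innerMap K h i (Pi.single l 1) = Pi.single l' 1 := by
  rw [innerMap, onBasis_single]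
  congr 1
  exact Fin.ext hl.symm

/-- The substitution of `q` for the variable `i`, with the other variables renumbered. -/
def substMap {m n k : ℕ} (h : k + 1 = m + n) (i : Fin m) (q : M.obj (piObj K n)) :
    piObj K m →ₗ[K] M.obj (piObj K k) :=
  onBasis (substValue M h i q)

variable {M}

theorem substMap_single_self {m n k : ℕ} (h : k + 1 = m + n) (i : Fin m)
    (q : M.obj (piObj K n)) :
    substMap M h i q (Pi.single i 1) =
      M.fmap (V := piObj K n) (W := piObj K k) (innerMap K h i) q := by
  exact (onBasis_single (substValue M h i q) i).trans (dif_pos rfl)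

theorem substMap_single_lt {m n k : ℕ} (h : k + 1 = m + n) (i : Fin m)
    (q : M.obj (piObj K n)) (j : Fin m) (hj : j.val < i.val) (j' : Fin k) (hj' : j'.val = j.val) :
    substMap M h i q (Pi.single j 1) = M.ι (piObj K k) (Pi.single j' 1) := by
  have hne : j ≠ i := fun e => by simp [e] at hj
  refine ((onBasis_single (substValue M h i q) j).trans (dif_neg hne)).trans ?_
  have : outerIdx h i ⟨j, hne⟩ = j' := Fin.ext (by simp [outerIdx, hj, hj'])
  rw [this]
  rfl

theorem substMap_single_gt {m n k : ℕ} (h : k + 1 = m + n) (i : Fin m)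
    (q : M.obj (piObj K n)) (j : Fin m) (hj : i.val < j.val) (j' : Fin k)
    (hj' : j'.val + 1 = j.val + n) :
    substMap M h i q (Pi.single j 1) = M.ι (piObj K k) (Pi.single j' 1) := by
  have hne : j ≠ i := fun e => by simp [e] at hj
  refine ((onBasis_single (substValue M h i q) j).trans (dif_neg hne)).trans ?_
  have : outerIdx h i ⟨j, hne⟩ = j' := Fin.ext (by
    simp only [outerIdx]
    rw [dif_neg (by simp; omega)]
    simp only
    omega)
  rw [this]
  rfl

end Substitution

namespace Rerooting

variable {K : Type u} [Field K] {M : FreeAlg K} {G : ModuleCat.{u} K ⥤ ModuleCat.{u} K}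
  {Θ : tensorId M.functor ⟶ G} (R : Rerooting M Θ)

/-- Rerooting at the last variable `e_i`, where the former root becomes the first variable
`e_{i₀}`. -/
def rotate {n : ℕ} (i₀ i : Fin n) (p : M.obj (piObj K n)) : M.obj (piObj K n) :=
  slice (M.obj (piObj K n)) (LinearMap.proj i)
    (R.Δ (V := piObj K n) (M.ι (piObj K n) ∘ₗ nextMap K n) p (M.ι (piObj K n) (Pi.single i₀ 1)))

/-- Substitution in a rerooted element. -/
theorem bind_rotate {n : ℕ} {W : ModuleCat.{u} K} (i₀ i : Fin n) (p : M.obj (piObj K n))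
    (f : piObj K n →ₗ[K] M.obj W) :
    M.bind f (R.rotate i₀ i p) = slice (M.obj W) (LinearMap.proj i)
      (R.Δ (V := piObj K n) (f ∘ₗ nextMap K n) p (f (Pi.single i₀ 1))) := by
  have h : M.bind f ∘ₗ M.ι (piObj K n) ∘ₗ nextMap K n = f ∘ₗ nextMap K n :=
    LinearMap.ext fun v => M.bind_apply_ι f (nextMap K n v)
  rw [rotate, ← slice_rTensor, R.bind_Δ, h, M.bind_apply_ι]

/-- Rerooting at the last variable of a composition in which this variable occurs only in the
argument substituted for `e_i`. -/
theorem rotate_bind {m k : ℕ} (k₀ k₁ : Fin k) (f : piObj K m →ₗ[K] M.obj (piObj K k))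
    (p : M.obj (piObj K m)) (i : Fin m) (L : M.obj (piObj K k) →ₗ[K] M.obj (piObj K k))
    (h : ∀ j x, slice (M.obj (piObj K k)) (LinearMap.proj k₁)
      (R.Δ (V := piObj K k) (M.ι (piObj K k) ∘ₗ nextMap K k) (f (Pi.single j 1)) x) =
        if j = i then L x else 0) :
    R.rotate k₀ k₁ (M.bind f p) = L (slice (M.obj (piObj K k)) (LinearMap.proj i)
      (R.Δ (V := piObj K m) (M.fmap (V := piObj K k) (W := piObj K k) (nextMap K k) ∘ₗ f) p
        (M.ι (piObj K k) (Pi.single k₀ 1)))) := by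
  rw [rotate, R.Δ_bind]
  exact R.slice_lift_flip (V := piObj K k) f _ _ L i h _

/-- Substitution for a variable other than the last one commutes with rerooting. -/
theorem rotate_substMap {m n k : ℕ} (h : k + 1 = m + n) (i i' : Fin m) (hi : i'.val = i.val + 1)
    (m₀ m₁ : Fin m) (hm₀ : m₀.val = 0) (hm₁ : m₁.val + 1 = m)
    (k₀ k₁ : Fin k) (hk₀ : k₀.val = 0) (hk₁ : k₁.val + 1 = k)
    (p : M.obj (piObj K m)) (q : M.obj (piObj K n)) :
    R.rotate k₀ k₁ (M.bind (substMap M h i q) p) =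
      M.bind (substMap M h i' q) (R.rotate m₀ m₁ p) := by
  have hm := i'.2
  -- the last variable of `p ∘_i q` is that of `p`
  rw [R.bind_rotate, R.rotate_bind k₀ k₁ (substMap M h i q) p m₁ LinearMap.id]
  · have h1 : substMap M h i' q (Pi.single m₀ 1) = M.ι (piObj K k) (Pi.single k₀ 1) :=
      substMap_single_lt h i' q m₀ (by omega) k₀ (by omega)
    have h2 : M.fmap (V := piObj K k) (W := piObj K k) (nextMap K k) ∘ₗ substMap M h i q =
        substMap M h i' q ∘ₗ nextMap K m := pi_linearMap_ext fun j => by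
      rw [LinearMap.comp_apply, LinearMap.comp_apply]
      by_cases hj : j.val + 1 < m
      · rw [nextMap_single j ⟨j.val + 1, hj⟩ rfl]
        rcases lt_trichotomy j.val i.val with hlt | heq | hgt
        · rw [substMap_single_lt h i q j hlt ⟨j.val, by omega⟩ rfl,
            substMap_single_lt h i' q _ (by simp; omega) ⟨j.val + 1, by omega⟩ rfl, M.fmap_ι,
            nextMap_single (n := k) ⟨j.val, by omega⟩ ⟨j.val + 1, by omega⟩ rfl]
        · have e1 : j = i := Fin.ext heq
          have e2 : (⟨j.val + 1, hj⟩ : Fin m) = i' := Fin.ext (by simp [hi, heq])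
          rw [e2, e1, substMap_single_self, substMap_single_self, M.fmap_fmap]
          refine LinearMap.congr_fun (congrArg (fun f => M.fmap (V := piObj K n)
            (W := piObj K k) f) (pi_linearMap_ext fun l => ?_)) q
          have := l.2
          rw [LinearMap.comp_apply, innerMap_single h i l ⟨i.val + l.val, by omega⟩ rfl,
            innerMap_single h i' l ⟨i'.val + l.val, by omega⟩ rfl]
          exact nextMap_single _ _ (by simp; omega)
        · rw [substMap_single_gt h i q j hgt ⟨j.val - 1 + n, by omega⟩ (by simp; omega),
            substMap_single_gt h i' q _ (by simp; omega) ⟨j.val + n, by omega⟩ (by simp; omega),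
            M.fmap_ι,
            nextMap_single (n := k) ⟨j.val - 1 + n, by omega⟩ ⟨j.val + n, by omega⟩
              (by simp; omega)]
      · rw [nextMap_single_last j (by omega), map_zero,
          substMap_single_gt h i q j (by omega) k₁ (by omega), M.fmap_ι,
          nextMap_single_last k₁ hk₁, map_zero]
    rw [h1, h2, LinearMap.id_apply]
  · intro j x
    rcases lt_trichotomy j.val i.val with hlt | heq | hgt
    · rw [substMap_single_lt h i q j hlt ⟨j.val, by omega⟩ rfl, R.Δ_ι, slice_tmul]
      have e1 : k₁ ≠ ⟨j.val, by omega⟩ := fun e => by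
        have := congrArg Fin.val e
        simp only at this
        omega
      rw [if_neg (fun e => by rw [e] at hlt; omega)]
      simp [e1]
    · have e1 : j = i := Fin.ext heq
      rw [e1, if_neg (fun e => by rw [e] at hi; omega), substMap_single_self, R.Δ_fmap,
        slice_lTensor]
      have e2 : (LinearMap.proj k₁ : (Fin k → K) →ₗ[K] K) ∘ₗ innerMap K h i = 0 :=
        pi_linearMap_ext fun l => by
          have := l.2
          have hne : k₁ ≠ ⟨i.val + l.val, by omega⟩ := fun e => by
            have := congrArg Fin.val e
            simp only at this
            omega
          rw [LinearMap.comp_apply, innerMap_single h i l ⟨i.val + l.val, by omega⟩ rfl]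
          simp [hne]
      rw [e2, slice_zero]
    · rw [substMap_single_gt h i q j hgt ⟨j.val - 1 + n, by omega⟩ (by simp; omega), R.Δ_ι,
        slice_tmul]
      by_cases e : j = m₁
      · have e1 : k₁ = ⟨j.val - 1 + n, by omega⟩ := Fin.ext (by simp [e]; omega)
        rw [if_pos e, e1]
        simp
      · have e1 : k₁ ≠ ⟨j.val - 1 + n, by omega⟩ := fun e' => e (Fin.ext (by
          have := congrArg Fin.val e'
          simp only at this
          omega))
        rw [if_neg e]
        simp [e1]

/-- Substitution for the last variable is compatible with rerooting. -/
theorem rotate_substMap_last [CharZero K] {m n k : ℕ} (h : k + 1 = m + n) (h' : k + 1 = n + m)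
    (m₀ m₁ : Fin m) (hm₀ : m₀.val = 0) (hm₁ : m₁.val + 1 = m)
    (n₀ n₁ : Fin n) (hn₀ : n₀.val = 0) (hn₁ : n₁.val + 1 = n)
    (k₀ k₁ : Fin k) (hk₀ : k₀.val = 0) (hk₁ : k₁.val + 1 = k)
    (p : M.obj (piObj K m)) (q : M.obj (piObj K n))
    (hp : ∀ z : K, z ≠ 0 →
      M.fmap (V := piObj K m) (W := piObj K m) (scaleCoord m₁ z) p = z • p) :
    R.rotate k₀ k₁ (M.bind (substMap M h m₁ q) p) =
      M.bind (substMap M h' n₀ (R.rotate m₀ m₁ p)) (R.rotate n₀ n₁ q) := by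
  have hm := m₁.2
  have hn := n₁.2
  have hmaps : ((M.ι (piObj K k) ∘ₗ nextMap K k) ∘ₗ innerMap K h m₁ :
        piObj K n →ₗ[K] M.obj (piObj K k)) =
      substMap M h' n₀ (R.rotate m₀ m₁ p) ∘ₗ nextMap K n := pi_linearMap_ext fun l => by
    rw [LinearMap.comp_apply, LinearMap.comp_apply, LinearMap.comp_apply,
      innerMap_single h m₁ l ⟨m₁.val + l.val, by omega⟩ rfl]
    by_cases hl : l.val + 1 < n
    · rw [nextMap_single l ⟨l.val + 1, hl⟩ rfl,
        nextMap_single _ ⟨m₁.val + l.val + 1, by omega⟩ rfl,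
        substMap_single_gt h' n₀ _ _ (by simp; omega) ⟨m₁.val + l.val + 1, by omega⟩
          (by simp; omega)]
    · rw [nextMap_single_last l (by omega), nextMap_single_last _ (by simp; omega), map_zero,
        map_zero]
  have hproj : (LinearMap.proj k₁ : (Fin k → K) →ₗ[K] K) ∘ₗ innerMap K h m₁ = LinearMap.proj n₁ :=
    pi_linearMap_ext fun l => by
      rw [LinearMap.comp_apply, innerMap_single h m₁ l ⟨m₁.val + l.val, by omega⟩ rfl]
      simp only [LinearMap.proj_apply, Pi.single_apply]
      refine if_congr ?_ rfl rfl
      rw [Fin.ext_iff, Fin.ext_iff]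
      simp only
      omega
  -- the last variable of `p ∘_m q` is that of `q`: reroot `p` at its last variable, then `q`
  rw [R.bind_rotate, R.rotate_bind k₀ k₁ (substMap M h m₁ q) p m₁
    (slice (M.obj (piObj K k)) (LinearMap.proj n₁) ∘ₗ
      R.Δ (V := piObj K n) (substMap M h' n₀ (R.rotate m₀ m₁ p) ∘ₗ nextMap K n) q)]
  · rw [LinearMap.comp_apply, substMap_single_self]
    congr 2
    have h1 : M.ι (piObj K k) (Pi.single k₀ 1) =
        (M.ι (piObj K k) ∘ₗ innerMap K h' n₀) (Pi.single m₀ 1) := by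
      rw [LinearMap.comp_apply, innerMap_single h' n₀ m₀ k₀ (by omega)]
    have h2 : M.fmap (V := piObj K m) (W := piObj K k) (innerMap K h' n₀) (R.rotate m₀ m₁ p) =
        _ := R.bind_rotate (W := piObj K k) m₀ m₁ p (M.ι (piObj K k) ∘ₗ innerMap K h' n₀)
    rw [h2, ← h1]
    refine R.slice_Δ_congr p m₁ hp _ _ (fun j hj => ?_) _
    have hlt : j.val < m₁.val := by
      have := Fin.val_ne_of_ne hj
      omega
    rw [LinearMap.comp_apply, LinearMap.comp_apply,
      substMap_single_lt h m₁ q j hlt ⟨j.val, by omega⟩ rfl, M.fmap_ι,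
      nextMap_single (n := k) ⟨j.val, by omega⟩ ⟨j.val + 1, by omega⟩ rfl,
      nextMap_single (n := m) j ⟨j.val + 1, by omega⟩ rfl, LinearMap.comp_apply,
      innerMap_single h' n₀ _ ⟨j.val + 1, by omega⟩ (by simp; omega)]
  · intro j x
    by_cases hj : j = m₁
    · rw [if_pos hj, hj, substMap_single_self, R.Δ_fmap, slice_lTensor, hmaps, hproj]
      rfl
    · have hlt : j.val < m₁.val := by
        have := Fin.val_ne_of_ne hj
        omega
      rw [if_neg hj, substMap_single_lt h m₁ q j hlt ⟨j.val, by omega⟩ rfl, R.Δ_ι, slice_tmul]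
      have e1 : k₁ ≠ ⟨j.val, by omega⟩ := fun e => by
        have := congrArg Fin.val e
        simp only at this
        omega
      simp [e1]

theorem rotate_unit :
    R.rotate (n := 1) 0 0 (M.ι (piObj K 1) (Pi.single 0 1)) =
      M.ι (piObj K 1) (Pi.single 0 1) := by
  rw [rotate, R.Δ_ι, slice_tmul, LinearMap.proj_apply, Pi.single_eq_same, one_smul]

variable [CharZero K]

theorem cyclicRep_unit : R.cyclicRep 1 (finRotate 2) (operadUnit M) = operadUnit M :=
  Subtype.ext ((R.cyclicRep_finRotate (n := 1) (operadUnit M) 0 0 rfl rfl).trans R.rotate_unit)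

theorem cyclicRep_partialComp {m n k : ℕ} (h : k + 1 = m + n) (i i' : Fin m)
    (hi : i'.val = i.val + 1) (p : multilinear M.functor m) (q : multilinear M.functor n) :
    R.cyclicRep k (finRotate (k + 1)) (partialComp M h i p q) =
      partialComp M h i' (R.cyclicRep m (finRotate (m + 1)) p) q := by
  have := i'.2
  refine Subtype.ext ((R.cyclicRep_finRotate (partialComp M h i p q) ⟨0, by omega⟩
    ⟨k - 1, by omega⟩ rfl (by simp; omega)).trans ?_)
  refine (R.rotate_substMap h i i' hi ⟨0, by omega⟩ ⟨m - 1, by omega⟩ rfl (by simp; omega) _ _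
    rfl (by simp; omega) p.1 q.1).trans ?_
  exact congrArg (M.bind (substMap M h i' q.1))
    (R.cyclicRep_finRotate p ⟨0, by omega⟩ ⟨m - 1, by omega⟩ rfl (by simp; omega)).symm

theorem cyclicRep_partialComp_last {m n k : ℕ} (h : k + 1 = m + n) (h' : k + 1 = n + m)
    (i : Fin m) (j : Fin n) (hi : i.val + 1 = m) (hj : j.val = 0)
    (p : multilinear M.functor m) (q : multilinear M.functor n) :
    R.cyclicRep k (finRotate (k + 1)) (partialComp M h i p q) =
      partialComp M h' j (R.cyclicRep n (finRotate (n + 1)) q)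
        (R.cyclicRep m (finRotate (m + 1)) p) := by
  have hm := i.2
  have hn := j.2
  refine Subtype.ext ((R.cyclicRep_finRotate (partialComp M h i p q) ⟨0, by omega⟩
    ⟨k - 1, by omega⟩ rfl (by simp; omega)).trans ?_)
  have hp : ∀ z : K, z ≠ 0 → M.fmap (V := piObj K m) (W := piObj K m) (scaleCoord i z) p.1 =
      z • p.1 := fun z hz => by
    refine (p.2 (Function.update 1 i z) fun l => ?_).trans ?_
    · by_cases hl : l = i
      · subst hl; simpa using hz
      · simp [hl]
    · rw [Finset.prod_update_of_mem (Finset.mem_univ i)]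
      simp
  refine (R.rotate_substMap_last h h' ⟨0, by omega⟩ i rfl hi j ⟨n - 1, by omega⟩ hj
    (by simp; omega) _ _ rfl (by simp; omega) p.1 q.1 hp).trans ?_
  have e1 := R.cyclicRep_finRotate p ⟨0, by omega⟩ i rfl hi
  have e2 := R.cyclicRep_finRotate q j ⟨n - 1, by omega⟩ hj (by simp; omega)
  exact congrArg₂ (fun a b => M.bind (substMap M h' j a) b) e1.symm e2.symm

theorem isCyclicOperad (R : Rerooting M Θ) : IsCyclicOperad M :=
  ⟨R.cyclicRep, R.cyclicRep_symEmbedding, R.cyclicRep_unit,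
    fun _ _ _ h i i' hi p q => R.cyclicRep_partialComp h i i' hi p q,
    fun _ _ _ h h' i j hi hj p q => R.cyclicRep_partialComp_last h h' i j hi hj p q⟩

/-- The actions of `𝔖_{n+1}` on the multilinear elements in `n` variables, as a sequence of
representations; it is zero in degree `0`. -/
def cyclicSeq : SymSeq K where
  obj
    | 0 => ModuleCat.of K PUnit.{u + 1}
    | n + 1 => (symSeq M.functor).obj n
  rep
    | 0 => 1
    | n + 1 => R.cyclicRep n

theorem isCyclicSModule (R : Rerooting M Θ) : (symSeq M.functor).IsCyclicSModule := by
  refine ⟨R.finite, R.cyclicSeq, fun n => ?_, fun n => ⟨LinearEquiv.refl K _, fun σ x => ?_⟩⟩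
  · cases n with
    | zero => exact inferInstanceAs (Module.Finite K PUnit.{u + 1})
    | succ n => exact R.finite n
  · exact (LinearMap.congr_fun (R.cyclicRep_symEmbedding n σ) x).symm

end Rerooting

/-! ### Rerooting in tensor algebras -/

section TensorReroot

variable {K : Type u} [Field K] {V W : Type u} [AddCommGroup V] [Module K V]
  [AddCommGroup W] [Module K W] {B : Type u} [Ring B] [Algebra K B]
  {C : Type u} [Ring C] [Algebra K C]

/-- The action of `v` on the pairs `(c, φ)`, `c ∈ B`, `φ : B → B ⊗ V`, from which the rerooting map
is built: the first component multiplies by `f v` and the second one obeys the product rule. -/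
def rerootStep (f : V →ₗ[K] B) : V →ₗ[K] Module.End K (B × (B →ₗ[K] B ⊗[K] V)) :=
  LinearMap.mk₂ K (fun v p => (f v * p.1, p.2 ∘ₗ LinearMap.mulRight K (f v) +
      (TensorProduct.mk K B V).flip v ∘ₗ LinearMap.mulLeft K p.1))
    (fun v w p => by
      refine Prod.ext (by simp [add_mul]) (LinearMap.ext fun m => ?_)
      simp [mul_add]; abel)
    (fun t v p => by
      refine Prod.ext (by simp) (LinearMap.ext fun m => ?_)
      simp)
    (fun v p q => by
      refine Prod.ext (by simp [mul_add]) (LinearMap.ext fun m => ?_)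
      simp [add_mul]; abel)
    (fun t v p => by
      refine Prod.ext (by simp) (LinearMap.ext fun m => ?_)
      simp [smul_tmul'])

/-- The rerooting map of the tensor algebra: for a word `a = v₁ ⋯ v_r`, it sends `m` to the sum over
`i` of `(f v_{i+1}) ⋯ (f v_r) m (f v₁) ⋯ (f v_{i-1}) ⊗ v_i`. -/
def reroot (f : V →ₗ[K] B) : TensorAlgebra K V →ₗ[K] B →ₗ[K] B ⊗[K] V :=
  LinearMap.snd K B (B →ₗ[K] B ⊗[K] V) ∘ₗ LinearMap.applyₗ (1, 0) ∘ₗ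
    (TensorAlgebra.lift K (rerootStep f)).toLinearMap

/-- The action of a word: rerooting is its component at `(1, 0)`, and this formula yields the product
rule. -/
theorem rerootStep_lift (f : V →ₗ[K] B) (a : TensorAlgebra K V) (c : B)
    (φ : B →ₗ[K] B ⊗[K] V) :
    TensorAlgebra.lift K (rerootStep f) a (c, φ) = (TensorAlgebra.lift K f a * c,
      φ ∘ₗ LinearMap.mulRight K (TensorAlgebra.lift K f a) +
        reroot f a ∘ₗ LinearMap.mulLeft K c) := by
  have h0 : ∀ a, reroot f a = (TensorAlgebra.lift K (rerootStep f) a (1, 0)).2 := fun _ => rfl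
  induction a using TensorAlgebra.induction generalizing c φ with
  | algebraMap r =>
    rw [h0]
    simp only [AlgHom.commutes, Module.algebraMap_end_apply]
    refine Prod.ext (by simp [Algebra.smul_def]) (LinearMap.ext fun m => ?_)
    simp [Algebra.algebraMap_eq_smul_one]
  | ι v =>
    rw [h0]
    simp only [TensorAlgebra.lift_ι_apply, rerootStep, LinearMap.mk₂_apply]
    refine Prod.ext rfl (LinearMap.ext fun m => ?_)
    simp
  | mul a b ha hb =>
    have h1 := ha (TensorAlgebra.lift K f b) (reroot f b)
    have h2 : TensorAlgebra.lift K (rerootStep f) b (1, 0) =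
        (TensorAlgebra.lift K f b, reroot f b) := by
      rw [hb]
      refine Prod.ext (by simp) (LinearMap.ext fun m => ?_)
      simp
    rw [h0, map_mul, Module.End.mul_apply, Module.End.mul_apply, hb, ha, h2, h1, map_mul]
    refine Prod.ext (mul_assoc _ _ _).symm (LinearMap.ext fun m => ?_)
    simp [mul_assoc]
    abel
  | add a b ha hb =>
    rw [h0] at ha hb ⊢
    rw [map_add, LinearMap.add_apply, LinearMap.add_apply, ha, hb, map_add]
    refine Prod.ext (by simp [add_mul]) (LinearMap.ext fun m => ?_)
    simp [mul_add]
    abel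

theorem reroot_mul (f : V →ₗ[K] B) (a b : TensorAlgebra K V) (m : B) :
    reroot f (a * b) m = reroot f a (TensorAlgebra.lift K f b * m) +
      reroot f b (m * TensorAlgebra.lift K f a) := by
  have h1 : reroot f (a * b) = (TensorAlgebra.lift K (rerootStep f) a
    (TensorAlgebra.lift K (rerootStep f) b (1, 0))).2 := by
    rw [← Module.End.mul_apply, ← map_mul]
    rfl
  rw [h1, rerootStep_lift, rerootStep_lift]
  simp [add_comm]

theorem reroot_algebraMap (f : V →ₗ[K] B) (r : K) (m : B) :
    reroot f (algebraMap K _ r) m = 0 := by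
  have h1 : reroot f (algebraMap K _ r) =
    (TensorAlgebra.lift K (rerootStep f) (algebraMap K _ r) (1, 0)).2 := rfl
  rw [h1, AlgHom.commutes, Module.algebraMap_end_apply]
  simp

theorem reroot_ι (f : V →ₗ[K] B) (v : V) (m : B) :
    reroot f (TensorAlgebra.ι K v) m = m ⊗ₜ v := by
  have h1 : reroot f (TensorAlgebra.ι K v) =
    (TensorAlgebra.lift K (rerootStep f) (TensorAlgebra.ι K v) (1, 0)).2 := rfl
  rw [h1, TensorAlgebra.lift_ι_apply]
  simp [rerootStep]

theorem lift_comp_apply (f : V →ₗ[K] B) (φ : B →ₐ[K] C) (a : TensorAlgebra K V) :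
    TensorAlgebra.lift K (φ.toLinearMap ∘ₗ f) a = φ (TensorAlgebra.lift K f a) := by
  have h : TensorAlgebra.lift K (φ.toLinearMap ∘ₗ f) = φ.comp (TensorAlgebra.lift K f) :=
    TensorAlgebra.hom_ext (LinearMap.ext fun v => by simp)
  rw [h]
  rfl

theorem rTensor_reroot (f : V →ₗ[K] B) (φ : B →ₐ[K] C) (a : TensorAlgebra K V) (m : B) :
    φ.toLinearMap.rTensor V (reroot f a m) = reroot (φ.toLinearMap ∘ₗ f) a (φ m) := by
  induction a using TensorAlgebra.induction generalizing m with
  | algebraMap r => simp [reroot_algebraMap]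
  | ι v => simp [reroot_ι]
  | mul a b ha hb => simp only [reroot_mul, map_add, ha, hb, lift_comp_apply, map_mul]
  | add a b ha hb => simp only [map_add, LinearMap.add_apply, ha, hb]

/-- The chain rule for rerooting. -/
theorem reroot_lift (f : V →ₗ[K] TensorAlgebra K W) (g : W →ₗ[K] B) (a : TensorAlgebra K V)
    (m : B) : reroot g (TensorAlgebra.lift K f a) m =
      TensorProduct.lift ((reroot g ∘ₗ f).flip)
        (reroot ((TensorAlgebra.lift K g).toLinearMap ∘ₗ f) a m) := by
  induction a using TensorAlgebra.induction generalizing m with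
  | algebraMap r => simp [reroot_algebraMap]
  | ι v => simp [reroot_ι]
  | mul a b ha hb => simp only [map_mul, reroot_mul, map_add, ha, hb, lift_comp_apply]
  | add a b ha hb => simp only [map_add, LinearMap.add_apply, ha, hb]

/-- Rerooting expresses a commutator through commutators with generators. -/
theorem commSum_reroot (a m : TensorAlgebra K V) :
    a * m - m * a = - commSum (K := K) _
      ((TensorAlgebra.ι K).lTensor (TensorAlgebra K V) (reroot (TensorAlgebra.ι K) a m)) := by
  have hid : ∀ a : TensorAlgebra K V, TensorAlgebra.lift K (TensorAlgebra.ι K) a = a := fun a => by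
    have h : TensorAlgebra.lift K (TensorAlgebra.ι K) = AlgHom.id K (TensorAlgebra K V) :=
      TensorAlgebra.hom_ext (LinearMap.ext fun v => by simp)
    rw [h]
    rfl
  induction a using TensorAlgebra.induction generalizing m with
  | algebraMap r => simp [reroot_algebraMap, Algebra.commutes]
  | ι v => simp [reroot_ι, commSum_tmul]
  | mul a b ha hb =>
    rw [reroot_mul, map_add, map_add, neg_add, hid, hid, ← ha, ← hb]
    noncomm_ring
  | add a b ha hb =>
    simp only [map_add, LinearMap.add_apply, neg_add, ← ha, ← hb]
    noncomm_ring

/-- The maps induced by a line of linear maps depend polynomially on its parameter. -/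
theorem tensorMap_mem_polyIn (f g : V →ₗ[K] W) (a : TensorAlgebra K V) :
    (fun z : K => tensorMap (f + z • g) a) ∈ polyIn fun _ =>
      (⊤ : Submodule K (TensorAlgebra K W)) := by
  induction a using TensorAlgebra.induction with
  | algebraMap r =>
    simp only [AlgHom.commutes]
    exact const_mem_polyIn trivial
  | ι v =>
    have h : ∀ z : K, tensorMap (f + z • g) (TensorAlgebra.ι K v) =
        TensorAlgebra.ι K (f v) + z ^ 1 • TensorAlgebra.ι K (g v) := fun z => by
      simp [tensorMap]
    simp only [h]
    exact add_mem (const_mem_polyIn trivial) (pow_smul_mem_polyIn 1 trivial)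
  | mul a b ha hb =>
    simp only [map_mul]
    exact polyIn_bilinear (S'' := fun _ => ⊤) (LinearMap.mul K _)
      (fun _ _ _ _ _ _ => Submodule.mem_top) ha hb
  | add a b ha hb =>
    simp only [map_add]
    exact add_mem ha hb

/-- The homogeneous components of an element of the tensor algebra. -/
theorem tensorMap_smul_mem_polyIn (a : TensorAlgebra K V) :
    (fun z : K => tensorMap (z • LinearMap.id) a) ∈
      polyIn fun k => LinearMap.range (TensorAlgebra.ι K (M := V)) ^ k := by
  induction a using TensorAlgebra.induction with
  | algebraMap r =>
    simp only [AlgHom.commutes]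
    refine const_mem_polyIn ?_
    rw [pow_zero]
    exact Submodule.mem_one.2 ⟨r, rfl⟩
  | ι v =>
    have h : ∀ z : K, tensorMap (z • (LinearMap.id : V →ₗ[K] V)) (TensorAlgebra.ι K v) =
        z ^ 1 • TensorAlgebra.ι K v := fun z => by
      simp [tensorMap]
    simp only [h]
    refine pow_smul_mem_polyIn 1 ?_
    rw [pow_one]
    exact ⟨v, rfl⟩
  | mul a b ha hb =>
    simp only [map_mul]
    refine polyIn_bilinear (LinearMap.mul K _) (fun i j x hx y hy => ?_) ha hb
    rw [pow_add]
    exact Submodule.mul_mem_mul hx hy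
  | add a b ha hb =>
    simp only [map_add]
    exact add_mem ha hb

/-! Injectivity of the commutator map on `Σ T(V) ⊗ V`. -/

/-- The morphism of the tensor algebra of `K x₀ ⊕ V` to matrices whose upper right entry is the
component of weight one in `x₀`. -/
def firstOrder (K : Type u) [Field K] (V : Type u) [AddCommGroup V] [Module K V] :
    (K × V) →ₗ[K] Matrix (Fin 2) (Fin 2) (TensorAlgebra K (K × V)) where
  toFun x := !![TensorAlgebra.ι K (0, x.2), TensorAlgebra.ι K (x.1, 0); 0,
    TensorAlgebra.ι K (0, x.2)]
  map_add' x y := by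
    ext i j
    fin_cases i <;> fin_cases j <;> simp [← map_add]
  map_smul' t x := by
    ext i j
    fin_cases i <;> fin_cases j <;> simp [← map_smul]

/-- The matrix `firstOrder` of `a` is `[a₀, a₁; 0, a₀]`, for the components `a₀` and `a₁` of weights
zero and one in `x₀`. -/
theorem exists_lift_firstOrder (V : ModuleCat.{u} K) (a : TensorAlgebra K (K × V)) :
    ∃ c : ℕ →₀ TensorAlgebra K (K × V),
      (∀ z, tensorMap (scalePoint V z).hom a = evalPoly _ z c) ∧
      TensorAlgebra.lift K (firstOrder K V) a = !![c 0, c 1; 0, c 0] := by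
  induction a using TensorAlgebra.induction with
  | algebraMap r =>
    refine ⟨Finsupp.single 0 (algebraMap K _ r), fun z => ?_, ?_⟩
    · rw [evalPoly_single, AlgHom.commutes, pow_zero, one_smul]
    · rw [AlgHom.commutes]
      ext i j
      fin_cases i <;> fin_cases j <;> simp [Matrix.algebraMap_matrix_apply]
  | ι x =>
    refine ⟨Finsupp.single 0 (TensorAlgebra.ι K (0, x.2)) +
      Finsupp.single 1 (TensorAlgebra.ι K (x.1, 0)), fun z => ?_, ?_⟩
    · rw [map_add, evalPoly_single, evalPoly_single, tensorMap, TensorAlgebra.lift_ι_apply,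
        ← map_smul, ← map_smul, ← map_add, LinearMap.comp_apply]
      congr 1
      simp [scalePoint]
    · rw [TensorAlgebra.lift_ι_apply]
      simp [firstOrder]
  | mul a b ha hb =>
    obtain ⟨c, h1, h2⟩ := ha
    obtain ⟨d, h3, h4⟩ := hb
    obtain ⟨e, h5, h6, h7⟩ := exists_bilinear_evalPoly (LinearMap.mul K _) c d
    refine ⟨e, fun z => ?_, ?_⟩
    · rw [map_mul, h1, h3, ← h5]
      rfl
    · rw [map_mul, h2, h4, h6, h7]
      simp
  | add a b ha hb =>
    obtain ⟨c, h1, h2⟩ := ha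
    obtain ⟨d, h3, h4⟩ := hb
    refine ⟨c + d, fun z => by rw [map_add, h1, h3, map_add], ?_⟩
    rw [map_add, h2, h4]
    simp

theorem lift_firstOrder_of_weight_one [CharZero K] (V : ModuleCat.{u} K)
    {a : TensorAlgebra K (K × V)}
    (ha : ∀ z : K, z ≠ 0 → tensorMap (scalePoint V z).hom a = z • a) :
    TensorAlgebra.lift K (firstOrder K V) a = !![0, a; 0, 0] := by
  obtain ⟨c, h1, h2⟩ := exists_lift_firstOrder V a
  have h3 : c = Finsupp.single 1 a := evalPoly_ext fun z hz => by
    rw [← h1, ha z hz, evalPoly_single, pow_one]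
  rw [h2, h3]
  simp

/-- The left inverse on `Σ T(V) ⊗ V` of the commutator map: for `a` and `b` free of `x₀` it sends
`a x₀ b` to the sum of the terms `b₂ a x₀ b₁ ⊗ v` over all occurrences `b = b₁ v b₂` of letters. -/
def commInv (K : Type u) [Field K] (V : Type u) [AddCommGroup V] [Module K V] :
    TensorAlgebra K (K × V) →ₗ[K] TensorAlgebra K (K × V) ⊗[K] (K × V) :=
  (Matrix.entryLinearMap K (TensorAlgebra K (K × V)) 0 1).rTensor (K × V) ∘ₗ
    (reroot (firstOrder K V)).flip !![1, 0; 0, 0]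

theorem commInv_commutator [CharZero K] (V : ModuleCat.{u} K) {a : TensorAlgebra K (K × V)}
    (ha : ∀ z : K, z ≠ 0 → tensorMap (scalePoint V z).hom a = z • a) (v : V) :
    commInv K V (a * TensorAlgebra.ι K (0, v) - TensorAlgebra.ι K (0, v) * a) =
      a ⊗ₜ (0, v) := by
  have h1 : TensorAlgebra.lift K (firstOrder K V) (TensorAlgebra.ι K (0, v)) =
      !![TensorAlgebra.ι K (0, v), 0; 0, TensorAlgebra.ι K (0, v)] := by
    rw [TensorAlgebra.lift_ι_apply]
    have h2 : ((0, 0) : K × V) = 0 := rfl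
    simp [firstOrder, h2]
  rw [commInv, LinearMap.comp_apply, LinearMap.flip_apply, map_sub, LinearMap.sub_apply,
    reroot_mul, reroot_mul, h1, lift_firstOrder_of_weight_one V ha, reroot_ι, reroot_ι]
  -- the terms that reroot `a` cancel, as the scalar matrix of `v` commutes with `!![1, 0; 0, 0]`
  simp only [Matrix.mul_fin_two, mul_one, mul_zero, one_mul, zero_mul, add_zero, map_add, map_sub]
  simp

end TensorReroot

/-! ### Stability of `T`, `SJ` and `CJ` under rerooting -/

section TensorSubReroot

variable {K : Type u} [Field K]

/-- The subspaces `S(V)` of the tensor algebras are stable under rerooting. -/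
def TensorSub.IsRerootStable (S : TensorSub K) : Prop :=
  ∀ (V W : Type u) [AddCommGroup V] [Module K V] [AddCommGroup W] [Module K W]
    (f : V →ₗ[K] TensorAlgebra K W), (∀ v, f v ∈ S.carrier W) →
    ∀ a ∈ S.carrier V, ∀ m ∈ S.carrier W,
      reroot f a m ∈ LinearMap.range ((S.carrier W).subtype.rTensor V)

theorem rTensor_subtype_injective {X V : Type u} [AddCommGroup X] [Module K X] [AddCommGroup V]
    [Module K V] (N : Submodule K X) : Function.Injective (N.subtype.rTensor V) :=
  Module.Flat.rTensor_preserves_injective_linearMap _ N.injective_subtype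

/-- Rerooting attaches `m`, so that its values lie in the ideal `T(W)` if `m` does. -/
theorem tensorT_isRerootStable : (tensorT K).IsRerootStable := by
  intro V W _ _ _ _ f hf a ha m hm
  clear ha
  have hideal : ∀ b c : TensorAlgebra K W, c ∈ (tensorT K).carrier W →
      b * c ∈ (tensorT K).carrier W ∧ c * b ∈ (tensorT K).carrier W := fun b c hc => by
    have h : TensorAlgebra.algebraMapInv (R := K) (M := W) c = 0 := hc
    constructor <;> change TensorAlgebra.algebraMapInv (R := K) (M := W) _ = 0 <;> simp [h]
  induction a using TensorAlgebra.induction generalizing m with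
  | algebraMap r => rw [reroot_algebraMap]; exact zero_mem _
  | ι v => exact ⟨(⟨m, hm⟩ : (tensorT K).carrier W) ⊗ₜ v, by simp [reroot_ι]⟩
  | mul a b ha hb =>
    rw [reroot_mul]
    exact add_mem (ha _ (hideal _ _ hm).1) (hb _ (hideal _ _ hm).2)
  | add a b ha hb =>
    rw [map_add, LinearMap.add_apply]
    exact add_mem (ha m hm) (hb m hm)

/-- The product rule of rerooting for the Jordan product. -/
theorem reroot_jordanMul [CharZero K] {V W : Type u} [AddCommGroup V] [Module K V]
    [AddCommGroup W] [Module K W] (f : V →ₗ[K] TensorAlgebra K W) (a b : TensorAlgebra K V)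
    (m : TensorAlgebra K W) :
    reroot f (jordanMul (K := K) _ a b) m =
      reroot f a (jordanMul (K := K) _ (TensorAlgebra.lift K f b) m) +
        reroot f b (jordanMul (K := K) _ (TensorAlgebra.lift K f a) m) := by
  simp only [jordanMul_apply, map_smul, map_add, LinearMap.smul_apply, LinearMap.add_apply,
    reroot_mul]
  rw [← smul_add]
  congr 1
  abel

theorem tensorSJ_isRerootStable [CharZero K] : (tensorSJ K).IsRerootStable := by
  intro V W _ _ _ _ f hf a ha
  let S := (tensorSJ K).carrier W
  let N : Submodule K (TensorAlgebra K V) :=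
    { carrier := {a | a ∈ (tensorSJ K).carrier V ∧
        ∀ m ∈ S, reroot f a m ∈ LinearMap.range (S.subtype.rTensor V)}
      add_mem' := fun {a b} ha hb => ⟨add_mem ha.1 hb.1, fun m hm => by
        rw [map_add, LinearMap.add_apply]
        exact add_mem (ha.2 m hm) (hb.2 m hm)⟩
      zero_mem' := ⟨zero_mem _, fun m _ => by
        rw [map_zero, LinearMap.zero_apply]
        exact zero_mem _⟩
      smul_mem' := fun t a ha => ⟨Submodule.smul_mem _ _ ha.1, fun m hm => by
        rw [map_smul, LinearMap.smul_apply]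
        exact Submodule.smul_mem _ _ (ha.2 m hm)⟩ }
  have h : a ∈ N := Submodule.mem_sInf.1 ha N
    ⟨fun v => ⟨(tensorSJ K).ι_mem V v, fun m hm =>
      ⟨(⟨m, hm⟩ : S) ⊗ₜ v, by simp [reroot_ι]⟩⟩,
    fun a ha b hb => ⟨(tensorSJ K).jordanMul_mem V a ha.1 b hb.1, fun m hm => by
      rw [reroot_jordanMul]
      exact add_mem
        (ha.2 _ ((tensorSJ K).jordanMul_mem W _ ((tensorSJ K).lift_mem V W f hf b hb.1) m hm))
        (hb.2 _ ((tensorSJ K).jordanMul_mem W _ ((tensorSJ K).lift_mem V W f hf a ha.1) m hm))⟩⟩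
  exact h.2

/-- The involution `σ`, as a linear map. -/
def sigmaLinear (K : Type u) [Field K] (V : Type u) [AddCommGroup V] [Module K V] :
    TensorAlgebra K V →ₗ[K] TensorAlgebra K V :=
  (MulOpposite.opLinearEquiv K).symm.toLinearMap ∘ₗ (sigma K V).toLinearMap

section Sigma

variable {V W : Type u} [AddCommGroup V] [Module K V] [AddCommGroup W] [Module K W]

theorem sigmaLinear_mul (a b : TensorAlgebra K V) :
    sigmaLinear K V (a * b) = sigmaLinear K V b * sigmaLinear K V a := by
  simp [sigmaLinear]

theorem sigmaLinear_ι (v : V) : sigmaLinear K V (TensorAlgebra.ι K v) = TensorAlgebra.ι K v := by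
  simp [sigmaLinear, sigma]

theorem sigmaLinear_algebraMap (r : K) :
    sigmaLinear K V (algebraMap K _ r) = algebraMap K _ r := by
  simp [sigmaLinear]

theorem mem_fixedSigma_iff {a : TensorAlgebra K V} :
    a ∈ fixedSigma K V ↔ sigmaLinear K V a = a := by
  rw [mem_fixedSigma, ← MulOpposite.unop_injective.eq_iff]
  rfl

theorem sigmaLinear_sigmaLinear (a : TensorAlgebra K V) :
    sigmaLinear K V (sigmaLinear K V a) = a := by
  induction a using TensorAlgebra.induction with
  | algebraMap r => simp only [sigmaLinear_algebraMap]
  | ι v => simp only [sigmaLinear_ι]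
  | mul a b ha hb => simp only [sigmaLinear_mul, ha, hb]
  | add a b ha hb => simp only [map_add, ha, hb]

theorem algebraMapInv_sigmaLinear (a : TensorAlgebra K V) :
    TensorAlgebra.algebraMapInv (R := K) (sigmaLinear K V a) =
      TensorAlgebra.algebraMapInv (R := K) a := by
  induction a using TensorAlgebra.induction with
  | algebraMap r => simp only [sigmaLinear_algebraMap]
  | ι v => simp only [sigmaLinear_ι]
  | mul a b ha hb => simp only [sigmaLinear_mul, map_mul, ha, hb, mul_comm]
  | add a b ha hb => simp only [map_add, ha, hb]

theorem lift_sigmaLinear (f : V →ₗ[K] TensorAlgebra K W)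
    (hf : ∀ v, sigmaLinear K W (f v) = f v) (a : TensorAlgebra K V) :
    TensorAlgebra.lift K f (sigmaLinear K V a) = sigmaLinear K W (TensorAlgebra.lift K f a) := by
  induction a using TensorAlgebra.induction with
  | algebraMap r => simp only [sigmaLinear_algebraMap, AlgHom.commutes]
  | ι v => simp only [sigmaLinear_ι, TensorAlgebra.lift_ι_apply, hf]
  | mul a b ha hb => simp only [sigmaLinear_mul, map_mul, ha, hb]
  | add a b ha hb => simp only [map_add, ha, hb]

/-- Rerooting commutes with reversing words. -/
theorem rTensor_sigmaLinear_reroot (f : V →ₗ[K] TensorAlgebra K W)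
    (hf : ∀ v, sigmaLinear K W (f v) = f v) (a : TensorAlgebra K V) (m : TensorAlgebra K W) :
    (sigmaLinear K W).rTensor V (reroot f a m) =
      reroot f (sigmaLinear K V a) (sigmaLinear K W m) := by
  induction a using TensorAlgebra.induction generalizing m with
  | algebraMap r => simp [sigmaLinear_algebraMap, reroot_algebraMap]
  | ι v => simp [sigmaLinear_ι, reroot_ι]
  | mul a b ha hb =>
    rw [reroot_mul, map_add, ha, hb, sigmaLinear_mul, sigmaLinear_mul, sigmaLinear_mul,
      reroot_mul, lift_sigmaLinear f hf, lift_sigmaLinear f hf, add_comm]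
  | add a b ha hb => simp only [map_add, LinearMap.add_apply, ha, hb]

/-- The projection `a ↦ ½ (a + σ a)` of `T(V)` onto `CJ(V)`. -/
def symmetrize (K : Type u) [Field K] [CharZero K] (V : Type u) [AddCommGroup V] [Module K V] :
    (tensorT K).carrier V →ₗ[K] (tensorCJ K).carrier V :=
  LinearMap.codRestrict _
    (((2⁻¹ : K) • (LinearMap.id + sigmaLinear K V)) ∘ₗ ((tensorT K).carrier V).subtype)
    fun a => by
      have h : TensorAlgebra.algebraMapInv (R := K) (M := V) a = 0 := a.2
      refine ⟨?_, mem_fixedSigma_iff.2 ?_⟩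
      · change TensorAlgebra.algebraMapInv (R := K) (M := V) _ = 0
        simp [algebraMapInv_sigmaLinear, h]
      · simp [sigmaLinear_sigmaLinear, add_comm]

end Sigma

/-- The reroots of symmetric elements lie in `T(W) ⊗ V` and are symmetric, hence lie in
`CJ(W) ⊗ V`. -/
theorem tensorCJ_isRerootStable [CharZero K] : (tensorCJ K).IsRerootStable := by
  intro V W _ _ _ _ f hf a ha m hm
  obtain ⟨t, ht⟩ := tensorT_isRerootStable V W f (fun v => (hf v).1) a ha.1 m hm.1
  have h1 := rTensor_sigmaLinear_reroot f (fun v => mem_fixedSigma_iff.1 (hf v).2) a m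
  rw [mem_fixedSigma_iff.1 ha.2, mem_fixedSigma_iff.1 hm.2] at h1
  refine ⟨(symmetrize K W).rTensor V t, ?_⟩
  have h2 : ((tensorCJ K).carrier W).subtype.rTensor V ((symmetrize K W).rTensor V t) =
      (2⁻¹ : K) • (((tensorT K).carrier W).subtype.rTensor V t +
        (sigmaLinear K W).rTensor V (((tensorT K).carrier W).subtype.rTensor V t)) := by
    clear ht
    induction t with
    | zero => simp
    | add x y hx hy => simp only [map_add, hx, hy, ← smul_add]; congr 1; abel
    | tmul x v =>
      simp only [LinearMap.rTensor_tmul, ← add_tmul, smul_tmul']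
      rfl
  rw [h2, ht, h1, ← two_smul K, smul_smul, inv_mul_cancel₀ two_ne_zero, one_smul]

end TensorSubReroot

/-! ### The rerooting structure of a family of subspaces of the tensor algebras -/

section TensorSubRerooting

variable {K : Type u} [Field K] (S : TensorSub K)

section Reroot

variable (hS : S.IsRerootStable) {U V W : Type u} [AddCommGroup U] [Module K U] [AddCommGroup V]
  [Module K V] [AddCommGroup W] [Module K W]

/-- The restriction of the rerooting map to the spaces `S(V)`. -/
def TensorSub.reroot (f : V →ₗ[K] S.space W) :
    S.space V →ₗ[K] S.space W →ₗ[K] S.space W ⊗[K] V :=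
  let e := LinearEquiv.ofInjective ((S.carrier W).subtype.rTensor V)
    (rTensor_subtype_injective (S.carrier W))
  LinearMap.mk₂ K (fun a m => e.symm
      ⟨JordanCyclic.reroot ((S.carrier W).subtype ∘ₗ f) a m,
        hS V W _ (fun v => (f v).2) a a.2 m m.2⟩)
    (fun a b m => by rw [← map_add]; congr 1; exact Subtype.ext (by simp))
    (fun t a m => by rw [← map_smul]; congr 1; exact Subtype.ext (by simp))
    (fun a m n => by rw [← map_add]; congr 1; exact Subtype.ext (by simp))
    (fun t a m => by rw [← map_smul]; congr 1; exact Subtype.ext (by simp))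

theorem TensorSub.rTensor_subtype_reroot (f : V →ₗ[K] S.space W) (a : S.space V)
    (m : S.space W) : (S.carrier W).subtype.rTensor V (S.reroot hS f a m) =
      JordanCyclic.reroot ((S.carrier W).subtype ∘ₗ f) (a : TensorAlgebra K V) m :=
  congrArg Subtype.val (LinearEquiv.apply_symm_apply (LinearEquiv.ofInjective
    ((S.carrier W).subtype.rTensor V) (rTensor_subtype_injective (S.carrier W)))
    ⟨JordanCyclic.reroot ((S.carrier W).subtype ∘ₗ f) a m,
      hS V W _ (fun v => (f v).2) a a.2 m m.2⟩)

theorem TensorSub.reroot_ι (f : V →ₗ[K] S.space W) (v : V) (m : S.space W) :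
    S.reroot hS f ⟨TensorAlgebra.ι K v, S.ι_mem V v⟩ m = m ⊗ₜ v := by
  apply rTensor_subtype_injective (S.carrier W)
  rw [S.rTensor_subtype_reroot hS, JordanCyclic.reroot_ι]
  rfl

theorem TensorSub.reroot_bind (f : U →ₗ[K] S.space V) (g : V →ₗ[K] S.space W) (a : S.space U)
    (m : S.space W) : S.reroot hS g (S.bind f a) m =
      TensorProduct.lift ((S.reroot hS g ∘ₗ f).flip) (S.reroot hS (S.bind g ∘ₗ f) a m) := by
  apply rTensor_subtype_injective (S.carrier W)
  rw [S.rTensor_subtype_reroot hS]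
  refine (reroot_lift ((S.carrier V).subtype ∘ₗ f) ((S.carrier W).subtype ∘ₗ g) a
    (m : TensorAlgebra K W)).trans ?_
  have h1 := S.rTensor_subtype_reroot hS (S.bind g ∘ₗ f) a m
  have h2 : (S.carrier W).subtype ∘ₗ S.bind g ∘ₗ f =
      (TensorAlgebra.lift K ((S.carrier W).subtype ∘ₗ g)).toLinearMap ∘ₗ
        (S.carrier V).subtype ∘ₗ f := rfl
  rw [← h2, ← h1]
  generalize S.reroot hS (S.bind g ∘ₗ f) a m = t
  induction t with
  | zero => simp
  | add x y hx hy => simp only [map_add, hx, hy]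
  | tmul x u =>
    rw [LinearMap.rTensor_tmul, TensorProduct.lift.tmul, TensorProduct.lift.tmul]
    exact (S.rTensor_subtype_reroot hS g (f u) x).symm

theorem TensorSub.bind_reroot (f : U →ₗ[K] S.space V) (g : V →ₗ[K] S.space W) (a : S.space U)
    (m : S.space V) : (S.bind g).rTensor U (S.reroot hS f a m) =
      S.reroot hS (S.bind g ∘ₗ f) a (S.bind g m) := by
  apply rTensor_subtype_injective (S.carrier W)
  rw [S.rTensor_subtype_reroot hS]
  refine Eq.trans ?_ (rTensor_reroot ((S.carrier V).subtype ∘ₗ f)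
    (TensorAlgebra.lift K ((S.carrier W).subtype ∘ₗ g)) a (m : TensorAlgebra K V))
  rw [← S.rTensor_subtype_reroot hS]
  rw [← LinearMap.rTensor_comp_apply, ← LinearMap.rTensor_comp_apply]
  rfl

end Reroot

/-- The elements of weight `(1, …, 1)` in `n` variables are finite dimensional, being contained in
the component of degree `n` of the tensor algebra. -/
theorem TensorSub.finite_multilinear [CharZero K] (n : ℕ) :
    Module.Finite K (multilinear S.freeAlg.functor n) := by
  let L : Submodule K (TensorAlgebra K (Fin n → K)) :=
    LinearMap.range (TensorAlgebra.ι K (M := Fin n → K)) ^ n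
  have hL : L.FG := Submodule.FG.pow (Module.Finite.iff_fg.1 inferInstance) n
  have : Module.Finite K L := Module.Finite.iff_fg.2 hL
  let j : multilinear S.freeAlg.functor n →ₗ[K] TensorAlgebra K (Fin n → K) :=
    (S.carrier (Fin n → K)).subtype ∘ₗ (multilinear S.freeAlg.functor n).subtype
  have hmem : ∀ p, j p ∈ L := fun p => by
    refine mem_of_homogeneous (tensorMap_smul_mem_polyIn (j p)) n fun z hz => ?_
    have h1 := congrArg (Subtype.val : S.space (Fin n → K) → _) (p.2 (fun _ => z) fun _ => hz)
    have h2 : diagMap (fun _ : Fin n => z) = z • LinearMap.id := by ext; simp [diagMap]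
    rw [h2] at h1
    refine Eq.trans h1 ?_
    rw [Finset.prod_const, Finset.card_univ, Fintype.card_fin]
    rfl
  refine Module.Finite.of_injective (j.codRestrict L hmem) fun p q h => ?_
  have h2 : j p = j q := congrArg (fun x : L => (x : TensorAlgebra K (Fin n → K))) h
  exact Subtype.ext (Subtype.ext h2)

/-- The commutator map is injective on `Σ S(V) ⊗ V`. -/
theorem TensorSub.eq_zero_of_commSum [CharZero K] (V : ModuleCat.{u} K)
    (t : weightOne S.freeAlg.functor V ⊗[K] V)
    (h : commSum (K := K) (TensorAlgebra K (K × V))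
      (TensorProduct.map ((S.carrier (K × V)).subtype ∘ₗ (weightOne S.freeAlg.functor V).subtype)
        (TensorAlgebra.ι K ∘ₗ LinearMap.inr K K V) t) = 0) : t = 0 := by
  let j : weightOne S.freeAlg.functor V →ₗ[K] TensorAlgebra K (K × V) :=
    (S.carrier (K × V)).subtype ∘ₗ (weightOne S.freeAlg.functor V).subtype
  have hj : Function.Injective j := Subtype.val_injective.comp Subtype.val_injective
  have key : ∀ t : weightOne S.freeAlg.functor V ⊗[K] V,
      commInv K V (commSum (K := K) (TensorAlgebra K (K × V))
        (TensorProduct.map j (TensorAlgebra.ι K ∘ₗ LinearMap.inr K K V) t)) =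
      TensorProduct.map j (LinearMap.inr K K V) t := fun t => by
    induction t with
    | zero => simp
    | add x y hx hy => simp only [map_add, hx, hy]
    | tmul x v =>
      rw [TensorProduct.map_tmul, commSum_tmul, TensorProduct.map_tmul]
      exact commInv_commutator V (fun z hz => congrArg
        (Subtype.val : S.space (K × V) → TensorAlgebra K (K × V)) (x.2 z hz)) v
  have h1 := key t
  rw [h, map_zero] at h1
  have h2 : Function.Injective (TensorProduct.map j (LinearMap.inr K K V)) := by
    rw [← LinearMap.lTensor_comp_rTensor]
    exact (Module.Flat.lTensor_preserves_injective_linearMap _ LinearMap.inr_injective).comp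
      (Module.Flat.rTensor_preserves_injective_linearMap _ hj)
  exact h2 (h1.symm.trans (map_zero _).symm)

/-- The inclusion of the generators in `S(V)`. -/
def TensorSub.gen (V : Type u) [AddCommGroup V] [Module K V] : V →ₗ[K] S.space V :=
  (TensorAlgebra.ι K).codRestrict (S.carrier V) (S.ι_mem V)

/-- A bilinear map on `S(V)` by which the value of a sum of commutators `∑ [a, b]` determines and is
determined by `∑ br a b`. -/
def TensorSub.IsCommBracket {V : Type u} [AddCommGroup V] [Module K V] {X : Type u}
    [AddCommGroup X] [Module K X] (br : S.space V →ₗ[K] S.space V →ₗ[K] X) : Prop :=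
  ∀ t : S.space V ⊗[K] S.space V, TensorProduct.lift br t = 0 ↔
    commSum (K := K) (TensorAlgebra K V)
      (TensorProduct.map (S.carrier V).subtype (S.carrier V).subtype t) = 0

section Bracket

variable {V : Type u} [AddCommGroup V] [Module K V] {X : Type u} [AddCommGroup X] [Module K X]
  {br : S.space V →ₗ[K] S.space V →ₗ[K] X}

theorem TensorSub.bracket_swap (hbr : S.IsCommBracket br) (a b : S.space V) : br a b = - br b a := by
  have h := (hbr (a ⊗ₜ b + b ⊗ₜ a)).2 (by simp [commSum_tmul])
  rw [map_add, TensorProduct.lift.tmul, TensorProduct.lift.tmul] at h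
  exact eq_neg_of_add_eq_zero_left h

theorem TensorSub.bracket_reroot (hbr : S.IsCommBracket br) (hS : S.IsRerootStable) (a m : S.space V) :
    br a m = - TensorProduct.lift (br.compl₂ (S.gen V)) (S.reroot hS (S.gen V) a m) := by
  have h1 := S.rTensor_subtype_reroot hS (S.gen V) a m
  have h2 : (S.carrier V).subtype ∘ₗ S.gen V = TensorAlgebra.ι K := rfl
  have h3 : TensorProduct.lift br ∘ₗ (S.gen V).lTensor (S.space V) =
      TensorProduct.lift (br.compl₂ (S.gen V)) := TensorProduct.ext' fun x v => by simp
  have h4 : TensorProduct.map (S.carrier V).subtype (S.carrier V).subtype ∘ₗ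
      (S.gen V).lTensor (S.space V) =
      (TensorAlgebra.ι K).lTensor _ ∘ₗ (S.carrier V).subtype.rTensor V :=
    TensorProduct.ext' fun x v => rfl
  have h := (hbr (a ⊗ₜ m + (S.gen V).lTensor (S.space V) (S.reroot hS (S.gen V) a m))).2 (by
    have h5 := LinearMap.congr_fun h4 (S.reroot hS (S.gen V) a m)
    rw [LinearMap.comp_apply, LinearMap.comp_apply, h1, h2] at h5
    rw [map_add, map_add, h5, TensorProduct.map_tmul, commSum_tmul]
    exact (congrArg (· + _) (commSum_reroot (K := K) a.1 m.1)).trans (neg_add_cancel _))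
  rw [map_add, TensorProduct.lift.tmul, ← LinearMap.comp_apply, h3] at h
  exact eq_neg_of_add_eq_zero_left h

end Bracket

/-- The rerooting calculus of the spaces `S(V)`, for a bracket `br` that identifies `G(V)` with the
space of sums of commutators of elements of `S(V)`. -/
def TensorSub.rerooting [CharZero K] (hS : S.IsRerootStable)
    {G : ModuleCat.{u} K ⥤ ModuleCat.{u} K}
    (Θ : tensorId S.freeAlg.functor ⟶ G)
    (br : ∀ V : ModuleCat.{u} K, S.freeAlg.obj V →ₗ[K] S.freeAlg.obj V →ₗ[K] G.obj V)
    (br_ι : ∀ {V : ModuleCat.{u} K} (a : S.freeAlg.obj V) (v : V),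
      br V a (S.freeAlg.ι V v) = thetaAt Θ V ((a : S.freeAlg.functor.obj V) ⊗ₜ v))
    (br_map : ∀ {V W : ModuleCat.{u} K} (f : V ⟶ W) (a b : S.freeAlg.obj V),
      (G.map f).hom (br V a b) = br W (S.freeAlg.fmap f.hom a) (S.freeAlg.fmap f.hom b))
    (br_span : ∀ {V : ModuleCat.{u} K} (x : G.obj V),
      x ∈ Submodule.span K {y | ∃ a b : S.freeAlg.obj V, y = br V a b})
    (hbr : ∀ V : ModuleCat.{u} K, S.IsCommBracket (V := V) (br V)) :
    Rerooting S.freeAlg Θ where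
  Δ {V W} f := S.reroot hS (V := V) (W := W) f
  Δ_ι {V W} f v m := S.reroot_ι hS (V := V) (W := W) f v m
  Δ_bind {U V W} f g a m := S.reroot_bind hS (U := U) (V := V) (W := W) f g a m
  bind_Δ {U V W} f g a m := S.bind_reroot hS (U := U) (V := V) (W := W) f g a m
  poly {V W} f g a := polyIn_of_subtype (S.carrier W)
    (tensorMap_mem_polyIn f g (a : S.space V).1)
  br := br
  br_ι := br_ι
  br_map := br_map
  br_span := br_span
  finite := S.finite_multilinear
  br_swap {V} := S.bracket_swap (V := V) (hbr V)
  br_Δ {V} a m := by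
    have hθ : thetaAt Θ V = TensorProduct.lift ((br V).compl₂ (S.freeAlg.ι V)) :=
      TensorProduct.ext' fun x v => (br_ι (V := V) x v).symm
    rw [hθ]
    exact S.bracket_reroot (V := V) (hbr V) hS a m
  inj V := by
    refine (injective_iff_map_eq_zero _).2 fun t ht => S.eq_zero_of_commSum V t ?_
    have h1 : thetaAt Θ (addPoint V) (TensorProduct.map (weightOne S.freeAlg.functor V).subtype
        (LinearMap.inr K K V) t) = 0 := congrArg Subtype.val ht
    let w : weightOne S.freeAlg.functor V →ₗ[K] S.space (K × V) :=
      (weightOne S.freeAlg.functor V).subtype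
    have hθ : thetaAt Θ (addPoint V) ∘ₗ TensorProduct.map (weightOne S.freeAlg.functor V).subtype
        (LinearMap.inr K K V) = TensorProduct.lift (br (addPoint V)) ∘ₗ
          TensorProduct.map w (S.gen (K × V) ∘ₗ LinearMap.inr K K V) :=
      TensorProduct.ext' fun x v => (br_ι (V := addPoint V) _ _).symm
    have hc : TensorProduct.map ((S.carrier (K × V)).subtype ∘ₗ
        (weightOne S.freeAlg.functor V).subtype) (TensorAlgebra.ι K ∘ₗ LinearMap.inr K K V) =
        TensorProduct.map (S.carrier (K × V)).subtype (S.carrier (K × V)).subtype ∘ₗ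
          TensorProduct.map w (S.gen (K × V) ∘ₗ LinearMap.inr K K V) :=
      TensorProduct.ext' fun x v => rfl
    refine (congrArg _ (LinearMap.congr_fun hc t)).trans ?_
    exact (hbr (addPoint V) _).1 ((LinearMap.congr_fun hθ t).symm.trans h1)

end TensorSubRerooting

/-! ### Commutators and inner derivations -/

section TensorInstances

variable (K : Type u) [Field K]

/-- The bilinear map `T(V) × T(V) → [T(V), T(V)]`, `(a, b) ↦ [a, b]`. -/
def commBracket (V : Type u) [AddCommGroup V] [Module K V] :
    (tensorT K).space V →ₗ[K] (tensorT K).space V →ₗ[K] commutatorT K V :=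
  LinearMap.mk₂ K (fun a b => ⟨a * b - b * a, Submodule.subset_span ⟨a, a.2, b, b.2, rfl⟩⟩)
    (fun a b v => Subtype.ext (by simp [add_mul, mul_add]; abel))
    (fun c a v => Subtype.ext (by simp [smul_sub]))
    (fun a v w => Subtype.ext (by simp [add_mul, mul_add]; abel))
    (fun c a v => Subtype.ext (by simp [smul_sub]))

theorem commBracket_isCommBracket (V : Type u) [AddCommGroup V] [Module K V] :
    (tensorT K).IsCommBracket (commBracket K V) := by
  intro t
  have h : (commutatorT K V).subtype ∘ₗ TensorProduct.lift (commBracket K V) =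
      commSum (K := K) (TensorAlgebra K V) ∘ₗ
        TensorProduct.map ((tensorT K).carrier V).subtype ((tensorT K).carrier V).subtype :=
    TensorProduct.ext' fun a b => by
      rw [LinearMap.comp_apply, LinearMap.comp_apply, TensorProduct.map_tmul, commSum_tmul]
      rfl
  have h1 := LinearMap.congr_fun h t
  rw [LinearMap.comp_apply, LinearMap.comp_apply] at h1
  rw [← h1, Submodule.subtype_apply, Submodule.coe_eq_zero]

theorem commBracket_span (V : Type u) [AddCommGroup V] [Module K V] (x : commutatorT K V) :
    x ∈ Submodule.span K {y | ∃ a b, y = commBracket K V a b} := by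
  obtain ⟨c, hc⟩ := x
  induction hc using Submodule.span_induction with
  | mem c hc =>
    obtain ⟨a, ha, b, hb, rfl⟩ := hc
    exact Submodule.subset_span ⟨⟨a, ha⟩, ⟨b, hb⟩, rfl⟩
  | zero => exact zero_mem _
  | add a b ha hb h1 h2 => exact add_mem h1 h2
  | smul t a ha h1 => exact Submodule.smul_mem _ t h1

theorem commBracket_map {V W : Type u} [AddCommGroup V] [Module K V] [AddCommGroup W] [Module K W]
    (f : V →ₗ[K] W) (a b : (tensorT K).space V) :
    (tensorMap f).toLinearMap.restrict (p := commutatorT K V) (q := commutatorT K W)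
      (tensorMap_mem_commutatorT f) (commBracket K V a b) =
    commBracket K W ⟨tensorMap f a.1, tensorMap_mem (tensorT K) f a.2⟩
      ⟨tensorMap f b.1, tensorMap_mem (tensorT K) f b.2⟩ := by
  refine Subtype.ext ?_
  change tensorMap f (a.1 * b.1 - b.1 * a.1) = _
  simp [commBracket]

/-- Rerooting in the free associative algebras `T(V)`. -/
def rerootingT [CharZero K] : Rerooting (tensorT K).freeAlg (thetaT K) :=
  (tensorT K).rerooting tensorT_isRerootStable (thetaT K) (fun V => commBracket K V)
    (fun _ _ => rfl) (fun {V W} f a b => commBracket_map K (V := V) (W := W) f.hom a b)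
    (fun {V} x => commBracket_span K V x) fun V => commBracket_isCommBracket K V

variable {K}

/-- A sum of inner derivations `∂_{a,b}` of `S(V)` vanishes if and only if the sum of the
commutators `[a, b]` does, since the latter can only be central if it is zero. -/
theorem JordanTensorSub.isCommBracket [CharZero K] (S : JordanTensorSub K) (V : Type u)
    [AddCommGroup V] [Module K V] (k : ℕ) (hk : k ≠ 0) :
    S.IsCommBracket (k • toInner (S.mul V)) := by
  intro t
  have h : Inner.val ∘ₗ TensorProduct.lift (k • toInner (S.mul V)) =
      k • TensorProduct.lift (innerDer (S.mul V)) :=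
    TensorProduct.ext' fun a b => by
      simp only [LinearMap.comp_apply, TensorProduct.lift.tmul, LinearMap.smul_apply, map_nsmul]
      rfl
  have h1 := LinearMap.congr_fun h t
  have hval : Function.Injective (Inner.val (m := S.mul V)) := Subtype.val_injective
  rw [← map_eq_zero_iff _ hval, ← LinearMap.comp_apply, h1, LinearMap.smul_apply,
    ← Nat.cast_smul_eq_nsmul K, smul_eq_zero_iff_right (Nat.cast_ne_zero.2 hk)]
  constructor
  · intro h2
    refine commSum_eq_zero _ fun v => ?_
    have h3 := S.lift_innerDer V t ⟨TensorAlgebra.ι K v, S.ι_mem V v⟩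
    rw [h2] at h3
    simp only [LinearMap.zero_apply, ZeroMemClass.coe_zero, smul_zero] at h3
    exact sub_eq_zero.1 h3.symm
  · intro h2
    refine LinearMap.ext fun z => Subtype.ext ?_
    have h3 := S.lift_innerDer V t z
    rw [h2, zero_mul, mul_zero, sub_zero] at h3
    simpa using h3

theorem toInner_span {A : Type u} [AddCommGroup A] [Module K A] (m : A →ₗ[K] A →ₗ[K] A)
    (k : K) (hk : k ≠ 0) (x : Inner m) :
    x ∈ Submodule.span K {y | ∃ a b, y = k • toInner m a b} := by
  obtain ⟨d, hd⟩ := x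
  induction hd using Submodule.span_induction with
  | mem d hd =>
    obtain ⟨a, b, rfl⟩ := hd
    have h : toInner m a b = k⁻¹ • k • toInner m a b := by
      rw [smul_smul, inv_mul_cancel₀ hk, one_smul]
    have h2 : toInner m a b ∈ Submodule.span K {y | ∃ a b, y = k • toInner m a b} := by
      rw [h]
      exact Submodule.smul_mem _ _ (Submodule.subset_span ⟨a, b, rfl⟩)
    exact h2
  | zero => exact zero_mem _
  | add a b ha hb h1 h2 => exact add_mem h1 h2
  | smul t a ha h1 => exact Submodule.smul_mem _ t h1

/-- Rerooting in a family of Jordan subalgebras of the tensor algebras, for a multiple of the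
natural transformation `a ⊗ v ↦ ∂_{a,v}`. -/
def JordanTensorSub.rerooting [CharZero K] (S : JordanTensorSub K)
    (hS : S.IsRerootStable) (k : ℕ) (hk : k ≠ 0)
    (Θ : tensorId S.freeAlg.functor ⟶ S.inner) (hΘ : Θ = k • S.theta) :
    Rerooting S.freeAlg Θ :=
  S.toTensorSub.rerooting hS Θ (fun V => k • toInner (S.mul V))
    (fun a v => by subst hΘ; rfl)
    (fun {V W} f a b => (map_nsmul (S.innerMap f) k _).trans
      (congrArg (k • ·) (S.innerMap_toInner f a b)))
    (fun {V} x => by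
      have h := toInner_span (S.mul V) (k : K) (Nat.cast_ne_zero.2 hk) x
      simp only [Nat.cast_smul_eq_nsmul] at h
      exact h)
    fun V => S.isCommBracket V k hk

variable (K)

/-- Rerooting in the free special Jordan algebras `SJ(V)`. -/
def rerootingSJ [CharZero K] : Rerooting (tensorSJ K).freeAlg (thetaSJ K) :=
  (tensorSJ K).rerooting tensorSJ_isRerootStable 1 one_ne_zero (thetaSJ K)
    (one_nsmul (tensorSJ K).theta).symm

/-- Rerooting in the Cohn-Jordan algebras `CJ(V)`. -/
def rerootingCJ [CharZero K] : Rerooting (tensorCJ K).freeAlg (thetaCJ K) :=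
  (tensorCJ K).rerooting tensorCJ_isRerootStable 4 four_ne_zero (thetaCJ K) rfl

end TensorInstances

/-! ### Rerooting in free Jordan algebras -/

section JordanAlgebra

/-- Linearization of the Jordan identity: `2 [L_a, L_{ab}] + [L_b, L_{a²}] = 0`. -/
theorem jordan_linearized (K : Type u) [Field K] [CharZero K] {A : Type u}
    [NonUnitalNonAssocCommRing A] [IsCommJordan A] [Module K A] (a b m : A) :
    2 • (a * ((a * b) * m)) + b * ((a * a) * m) = 2 • ((a * b) * (a * m)) + (a * a) * (b * m) := by
  have h := DFunLike.congr_fun (two_nsmul_lie_lmul_lmul_add_add_eq_zero a a b) m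
  have h2 : (2 : ℕ) • ((a * ((a * b) * m) - (a * b) * (a * m)) +
      (a * ((b * a) * m) - (b * a) * (a * m)) + (b * ((a * a) * m) - (a * a) * (b * m))) = 0 := h
  rw [← Nat.cast_smul_eq_nsmul K, smul_eq_zero_iff_right (by norm_num), mul_comm b a] at h2
  rw [← sub_eq_zero, ← h2]
  abel

/-- The identity by which the linear maps from `A` to a vector space form a Jordan module. -/
theorem jordan_dual (K : Type u) [Field K] [CharZero K] {A : Type u}
    [NonUnitalNonAssocCommRing A] [IsCommJordan A] [Module K A] (a b m : A) :
    b * ((a * a) * m) + 2 • (a * ((a * b) * m)) =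
      ((a * a) * b) * m + 2 • (a * (b * (a * m))) := by
  have h1 := jordan_linearized K a b m
  have h2 := jordan_linearized K a m b
  rw [mul_comm ((a * a) * b) m, mul_comm b (a * m), add_comm (b * _), h1,
    add_comm (m * _), h2, mul_comm m b, mul_comm (a * m) (a * b)]

variable (K : Type u) [Field K] (A : Type u) [NonUnitalNonAssocCommRing A] [Module K A]

/-- The split null extension of the Jordan algebra `A` by the module of all linear maps from `A` to
a vector space `P`, on which `a` acts by `φ ↦ φ(a ·)`. -/
def NullExt (P : Type u) [AddCommGroup P] [Module K P] : Type u := A × (A →ₗ[K] P)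

namespace NullExt

variable (P : Type u) [AddCommGroup P] [Module K P]

instance : AddCommGroup (NullExt K A P) := inferInstanceAs (AddCommGroup (A × (A →ₗ[K] P)))

instance : Module K (NullExt K A P) := inferInstanceAs (Module K (A × (A →ₗ[K] P)))

instance [SMulCommClass K A A] : Mul (NullExt K A P) where
  mul x y := (x.1 * y.1, x.2 ∘ₗ LinearMap.mulLeft K y.1 + y.2 ∘ₗ LinearMap.mulLeft K x.1)

variable {K A P}

theorem ext {x y : NullExt K A P} (h1 : x.1 = y.1) (h2 : ∀ m, x.2 m = y.2 m) : x = y :=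
  Prod.ext h1 (LinearMap.ext h2)

theorem fst_add (x y : NullExt K A P) : (x + y).1 = x.1 + y.1 := rfl

theorem snd_add (x y : NullExt K A P) (m : A) : (x + y).2 m = x.2 m + y.2 m := rfl

theorem fst_smul (t : K) (x : NullExt K A P) : (t • x).1 = t • x.1 := rfl

theorem snd_smul (t : K) (x : NullExt K A P) (m : A) : (t • x).2 m = t • x.2 m := rfl

theorem fst_zero : (0 : NullExt K A P).1 = 0 := rfl

theorem snd_zero (m : A) : (0 : NullExt K A P).2 m = 0 := rfl

variable [SMulCommClass K A A]

theorem fst_mul (x y : NullExt K A P) : (x * y).1 = x.1 * y.1 := rfl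

theorem snd_mul (x y : NullExt K A P) (m : A) :
    (x * y).2 m = x.2 (y.1 * m) + y.2 (x.1 * m) := rfl

instance : NonUnitalNonAssocCommRing (NullExt K A P) :=
  { (inferInstance : AddCommGroup (NullExt K A P)), (inferInstance : Mul (NullExt K A P)) with
    left_distrib := fun x y z => ext (by simp only [fst_mul, fst_add, mul_add]) fun m => by
      simp only [snd_mul, snd_add, fst_add, add_mul, map_add]; abel
    right_distrib := fun x y z => ext (by simp only [fst_mul, fst_add, add_mul]) fun m => by
      simp only [snd_mul, snd_add, fst_add, add_mul, map_add]; abel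
    zero_mul := fun x => ext (by simp only [fst_mul, fst_zero, zero_mul]) fun m => by
      simp only [snd_mul, snd_zero, fst_zero, zero_mul, map_zero, add_zero]
    mul_zero := fun x => ext (by simp only [fst_mul, fst_zero, mul_zero]) fun m => by
      simp only [snd_mul, snd_zero, fst_zero, zero_mul, map_zero, add_zero]
    mul_comm := fun x y => ext (by simp only [fst_mul, mul_comm]) fun m => by
      simp only [snd_mul, add_comm] }

instance [IsScalarTower K A A] : IsScalarTower K (NullExt K A P) (NullExt K A P) where
  smul_assoc t x y := ext (by simp only [smul_eq_mul, fst_mul, fst_smul, smul_mul_assoc])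
    fun m => by
      simp only [smul_eq_mul, snd_mul, fst_smul, snd_smul, smul_mul_assoc, map_smul, smul_add]

instance [IsScalarTower K A A] : SMulCommClass K (NullExt K A P) (NullExt K A P) where
  smul_comm t x y := by
    simp only [smul_eq_mul]
    rw [mul_comm x y, mul_comm x (t • y), smul_mul_assoc]

instance [CharZero K] [IsCommJordan A] : IsCommJordan (NullExt K A P) where
  lmul_comm_rmul_rmul x y := by
    refine ext (IsCommJordan.lmul_comm_rmul_rmul x.1 y.1) fun m => ?_
    have h1 := congrArg x.2 (jordan_dual K x.1 y.1 m)
    have h2 := IsCommJordan.lmul_comm_rmul_rmul x.1 m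
    rw [mul_comm (x.1 * m), mul_comm m] at h2
    simp only [two_smul, map_add] at h1
    simp only [snd_mul, fst_mul, h2, mul_comm y.1 (x.1 * x.1)]
    rw [add_right_comm, h1]
    abel

end NullExt

end JordanAlgebra

section FreeJordanReroot

variable {K : Type u} [Field K] {U V W : Type u} [AddCommGroup U] [Module K U] [AddCommGroup V]
  [Module K V] [AddCommGroup W] [Module K W]

/-- The free Jordan algebra is generated by `V`. -/
@[elab_as_elim]
theorem FreeJordan.induction {p : FreeJordan K V → Prop} (a : FreeJordan K V)
    (ι : ∀ v, p (FreeJordan.ι K V v)) (add : ∀ a b, p a → p b → p (a + b))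
    (smul : ∀ (t : K) a, p a → p (t • a)) (mul : ∀ a b, p a → p b → p (a * b)) : p a := by
  have hmagma : ∀ x : FreeMagma V, p (FreeJordan.mk (MonoidAlgebra.single x 1)) := fun x => by
    induction x with
    | ih1 v => exact ι v
    | ih2 x y hx hy =>
      have h := mul _ _ hx hy
      rw [← map_mul, MonoidAlgebra.single_mul_single, mul_one] at h
      exact h
  obtain ⟨a, rfl⟩ := Quot.mk_surjective a
  change p (FreeJordan.mk a)
  induction a using MonoidAlgebra.induction_linear with
  | zero =>
    have h := smul 0 _ (ι 0)
    rw [zero_smul] at h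
    rw [map_zero]
    exact h
  | add a b ha hb =>
    rw [map_add]
    exact add _ _ ha hb
  | single x t =>
    have h := smul t _ (hmagma x)
    rw [← map_smul, MonoidAlgebra.smul_single, smul_eq_mul, mul_one] at h
    exact h

theorem FreeJordan.lift_ι_self (a : FreeJordan K V) :
    FreeJordan.lift (FreeJordan.ι K V) a = a := by
  have h : FreeJordan.lift (FreeJordan.ι K V) = NonUnitalAlgHom.id K (FreeJordan K V) :=
    FreeJordan.hom_ext fun v => by simp
  rw [h]
  rfl

theorem FreeJordan.lift_lift (f : U →ₗ[K] FreeJordan K V) (g : V →ₗ[K] FreeJordan K W)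
    (a : FreeJordan K U) : FreeJordan.lift g (FreeJordan.lift f a) =
      FreeJordan.lift ((FreeJordan.lift g : FreeJordan K V →ₗ[K] FreeJordan K W) ∘ₗ f) a :=
  (LinearMap.congr_fun ((freeJordan K).bind_bind (U := ModuleCat.of K U) (V := ModuleCat.of K V)
    (W := ModuleCat.of K W) f g) a)

variable [CharZero K]

/-- The images of the generators under `jordanRerootHom`. -/
def jordanRerootGen (f : V →ₗ[K] FreeJordan K W) :
    V →ₗ[K] NullExt K (FreeJordan K W) (FreeJordan K W ⊗[K] V) :=
  f.prod (TensorProduct.mk K (FreeJordan K W) V).flip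

/-- The morphism of `J(V)` to the null extension of `J(W)` whose second component is rerooting. -/
def jordanRerootHom (f : V →ₗ[K] FreeJordan K W) :
    FreeJordan K V →ₙₐ[K] NullExt K (FreeJordan K W) (FreeJordan K W ⊗[K] V) :=
  FreeJordan.lift (jordanRerootGen f)

/-- The rerooting map of the free Jordan algebra. -/
def jordanReroot (f : V →ₗ[K] FreeJordan K W) :
    FreeJordan K V →ₗ[K] FreeJordan K W →ₗ[K] FreeJordan K W ⊗[K] V where
  toFun a := (jordanRerootHom f a).2
  map_add' a b := congrArg Prod.snd (map_add (jordanRerootHom f) a b)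
  map_smul' t a := congrArg Prod.snd (map_smul (jordanRerootHom f) t a)

theorem fst_jordanRerootHom (f : V →ₗ[K] FreeJordan K W) (a : FreeJordan K V) :
    (jordanRerootHom f a).1 = FreeJordan.lift f a := by
  induction a using FreeJordan.induction with
  | ι v => rw [jordanRerootHom, FreeJordan.lift_ι, FreeJordan.lift_ι]; rfl
  | add a b ha hb => rw [map_add, map_add, NullExt.fst_add, ha, hb]
  | smul t a ha => rw [map_smul, map_smul, NullExt.fst_smul, ha]
  | mul a b ha hb => rw [map_mul, map_mul, NullExt.fst_mul, ha, hb]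

theorem jordanReroot_ι (f : V →ₗ[K] FreeJordan K W) (v : V) (m : FreeJordan K W) :
    jordanReroot f (FreeJordan.ι K V v) m = m ⊗ₜ v := by
  change (jordanRerootHom f (FreeJordan.ι K V v)).2 m = _
  rw [jordanRerootHom, FreeJordan.lift_ι]
  rfl

theorem jordanReroot_mul (f : V →ₗ[K] FreeJordan K W) (a b : FreeJordan K V)
    (m : FreeJordan K W) : jordanReroot f (a * b) m =
      jordanReroot f a (FreeJordan.lift f b * m) + jordanReroot f b (FreeJordan.lift f a * m) := by
  change (jordanRerootHom f (a * b)).2 m = _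
  rw [map_mul, NullExt.snd_mul, fst_jordanRerootHom, fst_jordanRerootHom]
  rfl

/-- The chain rule for rerooting. -/
theorem jordanReroot_lift (f : U →ₗ[K] FreeJordan K V) (g : V →ₗ[K] FreeJordan K W)
    (a : FreeJordan K U) (m : FreeJordan K W) :
    jordanReroot g (FreeJordan.lift f a) m = TensorProduct.lift ((jordanReroot g ∘ₗ f).flip)
      (jordanReroot ((FreeJordan.lift g : FreeJordan K V →ₗ[K] FreeJordan K W) ∘ₗ f) a m) := by
  induction a using FreeJordan.induction generalizing m with
  | ι v => simp [jordanReroot_ι]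
  | add a b ha hb => simp only [map_add, LinearMap.add_apply, ha, hb]
  | smul t a ha => simp only [map_smul, LinearMap.smul_apply, ha]
  | mul a b ha hb =>
    rw [map_mul, jordanReroot_mul, jordanReroot_mul, map_add, ha, hb, FreeJordan.lift_lift,
      FreeJordan.lift_lift]

theorem rTensor_jordanReroot (f : U →ₗ[K] FreeJordan K V) (g : V →ₗ[K] FreeJordan K W)
    (a : FreeJordan K U) (m : FreeJordan K V) :
    (FreeJordan.lift g : FreeJordan K V →ₗ[K] FreeJordan K W).rTensor U (jordanReroot f a m) =
      jordanReroot ((FreeJordan.lift g : FreeJordan K V →ₗ[K] FreeJordan K W) ∘ₗ f) a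
        (FreeJordan.lift g m) := by
  induction a using FreeJordan.induction generalizing m with
  | ι v => simp [jordanReroot_ι]
  | add a b ha hb => simp only [map_add, LinearMap.add_apply, ha, hb]
  | smul t a ha => simp only [map_smul, LinearMap.smul_apply, ha]
  | mul a b ha hb =>
    rw [jordanReroot_mul, map_add, ha, hb, jordanReroot_mul, map_mul (FreeJordan.lift g),
      map_mul (FreeJordan.lift g),
      FreeJordan.lift_lift, FreeJordan.lift_lift]

end FreeJordanReroot

/-! ### The bracket of `𝓑J` -/

section BracketB

variable {K : Type u} [Field K] {A : Type u} [NonUnitalNonAssocCommRing A] [Module K A]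

theorem bracketB_self (a : A) : bracketB (K := K) A a a = 0 := by
  have h : exteriorPower.ιMulti K 2 ![a, a] = 0 :=
    (exteriorPower.ιMulti K 2).map_eq_zero_of_eq ![a, a] (i := 0) (j := 1) rfl (by decide)
  exact (congrArg (relB K A).mkQ h).trans (map_zero _)

theorem bracketB_swap (a b : A) : bracketB (K := K) A a b = - bracketB (K := K) A b a := by
  have h := bracketB_self (K := K) (a + b)
  simp only [map_add, LinearMap.add_apply, bracketB_self, zero_add, add_zero] at h
  exact eq_neg_of_add_eq_zero_left ((add_comm _ _).trans h)

theorem bracketB_sq (a : A) : bracketB (K := K) A a (a * a) = 0 :=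
  (Submodule.Quotient.mk_eq_zero _).2 (Submodule.subset_span ⟨a, rfl⟩)

/-- Linearization of `{a, a²} = 0`. -/
theorem bracketB_mul [CharZero K] (a b c : A) :
    bracketB (K := K) A a (b * c) + bracketB A b (c * a) + bracketB A c (a * b) = 0 := by
  have h1 := bracketB_sq (K := K) (a + b + c)
  have h2 := bracketB_sq (K := K) (a + b)
  have h3 := bracketB_sq (K := K) (a + c)
  have h4 := bracketB_sq (K := K) (b + c)
  simp only [mul_add, add_mul, map_add, LinearMap.add_apply, bracketB_sq, mul_comm b a,
    mul_comm c a, mul_comm c b] at h1 h2 h3 h4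
  have h5 : (2 : K) • (bracketB (K := K) A a (b * c) + bracketB A b (a * c) +
      bracketB A c (a * b)) = 0 := by
    rw [two_smul]
    linear_combination (norm := module) h1 - h2 - h3 - h4
  rw [mul_comm c a]
  exact (smul_eq_zero_iff_right two_ne_zero).1 h5

theorem bracketB_span (x : BSpace K A) :
    x ∈ Submodule.span K {y | ∃ a b : A, y = bracketB A a b} := by
  let N := Submodule.span K {y | ∃ a b : A, y = bracketB (K := K) A a b}
  have h : N.mkQ = 0 := BSpace_hom_ext fun a b => by
    rw [LinearMap.zero_apply]
    exact (Submodule.Quotient.mk_eq_zero _).2 (Submodule.subset_span ⟨a, b, rfl⟩)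
  exact (Submodule.Quotient.mk_eq_zero N).1 (LinearMap.congr_fun h x)

end BracketB

section FreeJordanInstance

variable {K : Type u} [Field K] {V W : Type u} [AddCommGroup V] [Module K V] [AddCommGroup W]
  [Module K W]

/-- The morphism `J(f)` of free Jordan algebras. -/
def jordanMap (f : V →ₗ[K] W) : FreeJordan K V →ₙₐ[K] FreeJordan K W :=
  FreeJordan.lift (FreeJordan.ι K W ∘ₗ f)

theorem jordanMap_ι (f : V →ₗ[K] W) (v : V) :
    jordanMap f (FreeJordan.ι K V v) = FreeJordan.ι K W (f v) :=
  FreeJordan.lift_ι _ _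

theorem jordanMap_mem_polyIn (f g : V →ₗ[K] W) (a : FreeJordan K V) :
    (fun z : K => jordanMap (f + z • g) a) ∈ polyIn fun _ =>
      (⊤ : Submodule K (FreeJordan K W)) := by
  induction a using FreeJordan.induction with
  | ι v =>
    have h : ∀ z : K, jordanMap (f + z • g) (FreeJordan.ι K V v) =
        FreeJordan.ι K W (f v) + z ^ 1 • FreeJordan.ι K W (g v) := fun z => by
      simp [jordanMap_ι]
    simp only [h]
    exact add_mem (const_mem_polyIn (S := fun _ => ⊤) Submodule.mem_top)
      (pow_smul_mem_polyIn 1 Submodule.mem_top)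
  | add a b ha hb =>
    simp only [map_add]
    exact add_mem ha hb
  | smul t a ha =>
    simp only [map_smul]
    exact Submodule.smul_mem _ t ha
  | mul a b ha hb =>
    simp only [map_mul]
    exact polyIn_bilinear (S'' := fun _ => ⊤) (LinearMap.mul K _)
      (fun _ _ _ _ _ _ => Submodule.mem_top) ha hb

/-- An increasing sequence of subspaces of `J(V)`; the `n`-th one contains all products of at least
one and at most `n` generators. -/
def jordanDeg (K : Type u) [Field K] (V : Type u) [AddCommGroup V] [Module K V] :
    ℕ → Submodule K (FreeJordan K V)
  | 0 => ⊥
  | n + 1 => LinearMap.range (FreeJordan.ι K V) ⊔ jordanDeg K V n ⊔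
      Submodule.map₂ (LinearMap.mul K (FreeJordan K V)) (jordanDeg K V n) (jordanDeg K V n)

theorem jordanDeg_mono : Monotone (jordanDeg K V) :=
  monotone_nat_of_le_succ fun _ => le_sup_right.trans le_sup_left

theorem mul_mem_jordanDeg {i j : ℕ} {a b : FreeJordan K V} (ha : a ∈ jordanDeg K V i)
    (hb : b ∈ jordanDeg K V j) : a * b ∈ jordanDeg K V (i + j) := by
  rcases i with _ | i
  · rw [(Submodule.mem_bot K).1 ha, zero_mul]; exact zero_mem _
  rcases j with _ | j
  · rw [(Submodule.mem_bot K).1 hb, mul_zero]; exact zero_mem _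
  exact Submodule.mem_sup_right (Submodule.apply_mem_map₂ (LinearMap.mul K (FreeJordan K V))
    (jordanDeg_mono (show i + 1 ≤ i + 1 + j by omega) ha)
    (jordanDeg_mono (show j + 1 ≤ i + 1 + j by omega) hb))

theorem jordanDeg_fg [Module.Finite K V] (n : ℕ) : (jordanDeg K V n).FG := by
  induction n with
  | zero => exact Submodule.fg_bot
  | succ n ih =>
    exact ((Module.Finite.iff_fg.1 inferInstance).sup ih).sup (ih.map₂ _ ih)

/-- The homogeneous components of an element of the free Jordan algebra. -/
theorem jordanMap_smul_mem_polyIn (a : FreeJordan K V) :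
    (fun z : K => jordanMap (z • LinearMap.id) a) ∈ polyIn (jordanDeg K V) := by
  induction a using FreeJordan.induction with
  | ι v =>
    have h : ∀ z : K, jordanMap (z • (LinearMap.id : V →ₗ[K] V)) (FreeJordan.ι K V v) =
        z ^ 1 • FreeJordan.ι K V v := fun z => by
      simp [jordanMap_ι]
    simp only [h]
    exact pow_smul_mem_polyIn 1 (Submodule.mem_sup_left (Submodule.mem_sup_left ⟨v, rfl⟩))
  | add a b ha hb =>
    simp only [map_add]
    exact add_mem ha hb
  | smul t a ha =>
    simp only [map_smul]
    exact Submodule.smul_mem _ t ha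
  | mul a b ha hb =>
    simp only [map_mul]
    exact polyIn_bilinear (LinearMap.mul K _)
      (fun _ _ _ hx _ hy => mul_mem_jordanDeg hx hy) ha hb

/-- The linear map on `Λ²A` given by a bilinear map `B`, `a ∧ b ↦ B(a, b) - B(b, a)`. -/
def wedgeLift {A X : Type u} [AddCommGroup A] [Module K A] [AddCommGroup X] [Module K X]
    (B : A →ₗ[K] A →ₗ[K] X) : ⋀[K]^2 A →ₗ[K] X :=
  exteriorPower.alternatingMapLinearEquiv
    { toFun := fun v => B (v 0) (v 1) - B (v 1) (v 0)
      map_update_add' := fun v i x y => by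
        fin_cases i <;> simp <;> abel
      map_update_smul' := fun v i t x => by
        fin_cases i <;> simp [smul_sub]
      map_eq_zero_of_eq' := fun v i j h hij => by
        fin_cases i <;> fin_cases j <;> simp_all }

theorem wedgeLift_ιMulti {A X : Type u} [AddCommGroup A] [Module K A] [AddCommGroup X] [Module K X]
    (B : A →ₗ[K] A →ₗ[K] X) (a b : A) :
    wedgeLift B (exteriorPower.ιMulti K 2 ![a, b]) = B a b - B b a :=
  exteriorPower.alternatingMapLinearEquiv_apply_ιMulti _ _

variable [CharZero K]

theorem finite_multilinear_freeJordan (n : ℕ) :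
    Module.Finite K (multilinear (freeJordan K).functor n) := by
  let j : multilinear (freeJordan K).functor n →ₗ[K] FreeJordan K (Fin n → K) :=
    (multilinear (freeJordan K).functor n).subtype
  have : Module.Finite K (jordanDeg K (Fin n → K) n) := Module.Finite.iff_fg.2 (jordanDeg_fg n)
  have hmem : ∀ p, j p ∈ jordanDeg K (Fin n → K) n := fun p => by
    refine mem_of_homogeneous (jordanMap_smul_mem_polyIn (j p)) n fun z hz => ?_
    have h1 := p.2 (fun _ => z) fun _ => hz
    have h2 : diagMap (fun _ : Fin n => z) = z • LinearMap.id := by ext; simp [diagMap]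
    rw [h2, Finset.prod_const, Finset.card_univ, Fintype.card_fin] at h1
    exact h1
  refine Module.Finite.of_injective (j.codRestrict _ hmem) fun p q h => ?_
  have h2 : j p = j q :=
    congrArg (fun x : jordanDeg K (Fin n → K) n => (x : FreeJordan K (Fin n → K))) h
  exact Subtype.ext h2

/-- The bracket of the free Jordan algebra is invariant under rerooting, by induction on `a` from the
identity `{ab, m} = {a, bm} + {b, am}`. -/
theorem bracketB_reroot (a m : FreeJordan K V) :
    bracketB (K := K) _ a m = - TensorProduct.lift ((bracketB (K := K) _).compl₂ (FreeJordan.ι K V))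
      (jordanReroot (FreeJordan.ι K V) a m) := by
  induction a using FreeJordan.induction generalizing m with
  | ι v =>
    rw [jordanReroot_ι, TensorProduct.lift.tmul]
    exact bracketB_swap _ _
  | add a b ha hb => simp only [map_add, LinearMap.add_apply, ha, hb, neg_add]
  | smul t a ha => simp only [map_smul, LinearMap.smul_apply, ha, smul_neg]
  | mul a b ha hb =>
    rw [jordanReroot_mul, map_add, neg_add, FreeJordan.lift_ι_self, FreeJordan.lift_ι_self,
      ← ha, ← hb, bracketB_swap (a * b) m, mul_comm a m]
    exact neg_eq_of_add_eq_zero_right ((add_assoc _ _ _).symm.trans (bracketB_mul m a b))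

/-! Injectivity of the bracket on `Σ J(V) ⊗ V`. -/

/-- The left inverse on `Σ J(V) ⊗ V` of the bracket is `{a, b} ↦ Δ(b₀)(a₁) - Δ(a₀)(b₁)`, where `a₀` and
`a₁` are the components of `a` of weights zero and one in `x₀`. It is well defined on `𝓑J` since
`Δ(a₀²)(a₁) = 2 Δ(a₀)(a₀ a₁)`. -/
theorem exists_bracketB_inv (V : ModuleCat.{u} K) :
    ∃ δ : BSpace K (FreeJordan K (K × V)) →ₗ[K] FreeJordan K (K × V) ⊗[K] (K × V),
      ∀ a : FreeJordan K (K × V), (∀ z : K, z ≠ 0 → jordanMap (scalePoint V z).hom a = z • a) →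
      ∀ v : V, δ (bracketB _ a (FreeJordan.ι K (K × V) (0, v))) = a ⊗ₜ (0, v) := by
  have hpoly : ∀ a : FreeJordan K (K × V), (fun z : K => jordanMap (scalePoint V z).hom a) ∈
      polyIn fun _ => (⊤ : Submodule K (FreeJordan K (K × V))) := fun a => by
    simp_rw [Rerooting.scalePoint_eq]
    exact jordanMap_mem_polyIn _ _ a
  have hzero : (scalePoint V 0).hom = LinearMap.inr K K V ∘ₗ LinearMap.snd K K V := by
    rw [Rerooting.scalePoint_eq, zero_smul, add_zero]
  let p₀ : FreeJordan K (K × V) →ₙₐ[K] FreeJordan K (K × V) := jordanMap (scalePoint V 0).hom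
  obtain ⟨p₁, hp₁⟩ := exists_linearCoeff (fun z => (jordanMap (scalePoint V z).hom :
    FreeJordan K (K × V) →ₗ[K] FreeJordan K (K × V))) hpoly
  have eval_zero : ∀ c : ℕ →₀ FreeJordan K (K × V), evalPoly _ (0 : K) c = c 0 := fun c => by
    induction c using Finsupp.induction_linear with
    | zero => simp
    | add c d hc hd => rw [map_add, hc, hd, Finsupp.add_apply]
    | single k x => rcases k with _ | k <;> simp [evalPoly_single]
  have hsq : ∀ a, p₁ (a * a) = 2 • (p₀ a * p₁ a) := fun a => by
    obtain ⟨c, -, hc⟩ := mem_polyIn_iff.1 (hpoly a)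
    obtain ⟨e, h1, -, h2⟩ := exists_bilinear_evalPoly (LinearMap.mul K _) c c
    have h3 : p₁ (a * a) = e 1 := hp₁ _ _ fun z =>
      (map_mul (jordanMap (scalePoint V z).hom) a a).trans (by rw [hc, ← h1]; rfl)
    have h4 : p₀ a = c 0 := (hc 0).trans (eval_zero c)
    rw [h3, h2, h4, hp₁ a c hc, two_smul]
    exact congrArg (_ + ·) (mul_comm _ _)
  have hw₁ : ∀ a, (∀ z : K, z ≠ 0 → jordanMap (scalePoint V z).hom a = z • a) →
      p₀ a = 0 ∧ p₁ a = a := fun a ha => by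
    obtain ⟨c, -, hc⟩ := mem_polyIn_iff.1 (hpoly a)
    have h3 : c = Finsupp.single 1 a := evalPoly_ext fun z hz => by
      rw [← hc, ha z hz, evalPoly_single, pow_one]
    exact ⟨(hc 0).trans ((eval_zero c).trans (by simp [h3])),
      (hp₁ a c hc).trans (by simp [h3])⟩
  have hv₀ : ∀ v : V, p₀ (FreeJordan.ι K (K × V) (0, v)) = FreeJordan.ι K (K × V) (0, v) :=
    fun v => (jordanMap_ι _ _).trans (by rw [hzero]; rfl)
  have hv₁ : ∀ v : V, p₁ (FreeJordan.ι K (K × V) (0, v)) = 0 := fun v =>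
    (hp₁ _ (Finsupp.single 0 (FreeJordan.ι K (K × V) (0, v))) fun z => by
      rw [evalPoly_single, pow_zero, one_smul]
      refine (jordanMap_ι _ _).trans ?_
      simp [scalePoint]).trans (by simp)
  let B := ((jordanReroot (FreeJordan.ι K (K × V))).compl₁₂
    (p₀ : FreeJordan K (K × V) →ₗ[K] FreeJordan K (K × V)) p₁).flip
  have hB : ∀ a b, B a b = jordanReroot (FreeJordan.ι K (K × V)) (p₀ b) (p₁ a) := fun _ _ => rfl
  have hker : relB K (FreeJordan K (K × V)) ≤ LinearMap.ker (wedgeLift B) := by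
    refine Submodule.span_le.2 ?_
    rintro _ ⟨a, rfl⟩
    refine (wedgeLift_ιMulti B a (a * a)).trans ?_
    -- both terms are equal to `2 Δ(a₀)(a₀ a₁)`
    rw [hB, hB, hsq, map_mul p₀, jordanReroot_mul, FreeJordan.lift_ι_self, map_nsmul, two_smul,
      sub_self]
  refine ⟨(relB K _).liftQ (wedgeLift B) hker, fun a ha v => ?_⟩
  have h1 : (relB K _).liftQ (wedgeLift B) hker (bracketB _ a (FreeJordan.ι K (K × V) (0, v))) =
      wedgeLift B (exteriorPower.ιMulti K 2 ![a, FreeJordan.ι K (K × V) (0, v)]) :=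
    Submodule.liftQ_apply _ _ _
  refine h1.trans ?_
  rw [wedgeLift_ιMulti, hB, hB, hv₀, hv₁, (hw₁ a ha).1, (hw₁ a ha).2, jordanReroot_ι]
  simp

/-- Rerooting in the free Jordan algebras. -/
def rerootingJ (K : Type u) [Field K] [CharZero K] : Rerooting (freeJordan K) (thetaJ K) where
  Δ {V W} f := jordanReroot (V := V) (W := W) f
  Δ_ι {V W} f v m := jordanReroot_ι (V := V) (W := W) f v m
  Δ_bind {U V W} f g a m := jordanReroot_lift (U := U) (V := V) (W := W) f g a m
  bind_Δ {U V W} f g a m := rTensor_jordanReroot (U := U) (V := V) (W := W) f g a m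
  poly {V W} f g a := jordanMap_mem_polyIn (V := V) (W := W) f g a
  br V := bracketB (FreeJordan K V)
  br_ι _ _ := rfl
  br_swap {V} a b := bracketB_swap (A := FreeJordan K V) a b
  br_map {V W} f a b := mapB_bracketB (jordanMap f.hom) a b
  br_span {V} x := bracketB_span (A := FreeJordan K V) x
  br_Δ {V} a m := bracketB_reroot (V := V) a m
  inj V := by
    obtain ⟨δ, hδ⟩ := exists_bracketB_inv V
    refine (injective_iff_map_eq_zero _).2 fun t ht => ?_
    have h1 : thetaAt (thetaJ K) (addPoint V) (TensorProduct.map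
        (weightOne (freeJordan K).functor V).subtype (LinearMap.inr K K V) t) = 0 :=
      congrArg Subtype.val ht
    let w : weightOne (freeJordan K).functor V →ₗ[K] FreeJordan K (K × V) :=
      (weightOne (freeJordan K).functor V).subtype
    have hw : Function.Injective (TensorProduct.map w (LinearMap.inr K K V)) := by
      rw [← LinearMap.lTensor_comp_rTensor]
      exact (Module.Flat.lTensor_preserves_injective_linearMap _ LinearMap.inr_injective).comp
        (Module.Flat.rTensor_preserves_injective_linearMap _ Subtype.val_injective)
    have hδ' : δ ∘ₗ thetaAt (thetaJ K) (addPoint V) ∘ₗ TensorProduct.map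
        (weightOne (freeJordan K).functor V).subtype (LinearMap.inr K K V) =
        TensorProduct.map w (LinearMap.inr K K V) :=
      TensorProduct.ext' fun a v => hδ (w a) a.2 v
    exact hw ((LinearMap.congr_fun hδ' t).symm.trans
      ((congrArg δ h1).trans ((map_zero δ).trans (map_zero _).symm)))
  finite := finite_multilinear_freeJordan

end FreeJordanInstance

end JordanCyclic

end

theorem theorem1 (K : Type u) [Field K] [CharZero K] :
    (IsCyclicTriple (thetaJ K) ∧ IsCyclicTriple (thetaSJ K) ∧
      IsCyclicTriple (thetaCJ K) ∧ IsCyclicTriple (thetaT K)) ∧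
    (Nonempty ((freeJordan K).functor ≅ suspension (Limits.kernel (thetaJ K))) ∧
      Nonempty ((tensorSJ K).freeAlg.functor ≅ suspension (Limits.kernel (thetaSJ K))) ∧
      Nonempty ((tensorCJ K).freeAlg.functor ≅ suspension (Limits.kernel (thetaCJ K))) ∧
      Nonempty ((tensorT K).freeAlg.functor ≅ suspension (Limits.kernel (thetaT K)))) ∧
    ((symSeq (freeJordan K).functor).IsCyclicSModule ∧
      (symSeq (tensorSJ K).freeAlg.functor).IsCyclicSModule ∧
      (symSeq (tensorCJ K).freeAlg.functor).IsCyclicSModule ∧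
      (symSeq (tensorT K).freeAlg.functor).IsCyclicSModule) ∧
    (IsCyclicOperad (freeJordan K) ∧ IsCyclicOperad (tensorSJ K).freeAlg ∧
      IsCyclicOperad (tensorCJ K).freeAlg ∧ IsCyclicOperad (tensorT K).freeAlg) :=
  ⟨⟨(rerootingJ K).isCyclicTriple, (rerootingSJ K).isCyclicTriple,
      (rerootingCJ K).isCyclicTriple, (rerootingT K).isCyclicTriple⟩,
    ⟨⟨(rerootingJ K).functorIso⟩, ⟨(rerootingSJ K).functorIso⟩, ⟨(rerootingCJ K).functorIso⟩,
      ⟨(rerootingT K).functorIso⟩⟩,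
    ⟨(rerootingJ K).isCyclicSModule, (rerootingSJ K).isCyclicSModule,
      (rerootingCJ K).isCyclicSModule, (rerootingT K).isCyclicSModule⟩,
    ⟨(rerootingJ K).isCyclicOperad, (rerootingSJ K).isCyclicOperad,
      (rerootingCJ K).isCyclicOperad, (rerootingT K).isCyclicOperad⟩⟩
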